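/- Let $k\ge 1$ be an integer and let $x>0$. Let $I_n(z)=(z/2)^n\sum_{j\ge 0}\frac{z^{2j}}{2^{2j}(n+j)!\,j!}$ be the modified Bessel function of the first kind, $\tau_k(x)=\det\big(I_{i+j+1}(2\sqrt x)\big)_{i,j=0}^{k-1}$, and for real $t_1,t_2$ $$g_\beta(x,t_1,t_2)=\sum_{n\ge 0}\sum_{m\ge 0}\frac{t_1^nt_2^m}{n!\,m!}\,I_{2n+3m+\beta}(2\sqrt x).$$ For a Young diagram $Y=(l_1,\dots,l_s)$ with $s\le k$ rows (put $l_{s+1}=\dots=l_k=0$) let $G_{k,Y}=\det\big(g_{i+j+1+l_{k-j}}\big)_{i,j=0}^{k-1}$, and let $G_{k,Y}=0$ if $s>k$; write $G_k=G_{k,\emptyset}$. For $1\le q\le m$ let $Y_{m,q}=(m-q+1,1,\dots,1)$ with $q-1$ ones, and put $$f^{(n_1,n_2)}_{m,q}(x)=\partial_{t_1}^{n_1}\partial_{t_2}^{n_2}G_{k,Y_{m,q}}\Big|_{t_1=t_2=0},\qquad {\bf f}^{(n_1,n_2)}_{m,i}=\big(f^{(n_1,n_2)}_{m,i},\dots,f^{(n_1,n_2)}_{m,m}\big)^T,$$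 $$F(n_1,n_2)=\sum_{\substack{h_{1,0}+\dots+h_{1,k-1}=n_1\\ h_{2,0}+\dots+h_{2,k-1}=n_2}}\binom{n_1}{h_{1,0},\dots,h_{1,k-1}}\binom{n_2}{h_{2,0},\dots,h_{2,k-1}}\det\big(I_{2h_{1,j}+3h_{2,j}+i+j+1}(2\sqrt x)\big)_{i,j=0}^{k-1}.$$ For $m\ge 3$ define matrices with the following entries. * $B^{(m)}$ is $m\times m$: $b_{ij}=(-1)^{i-1}/m$ if $j=m$; and for $j<m$, $b_{ij}=\frac{(-1)^{i+j-1}}{j(j+1)}$ if $j\ge i$, $b_{ij}=-1/i$ if $j=i-1$, $b_{ij}=0$ if $j<i-1$. * $C_1^{(m)}$ is $m\times(m-1)$: $(-1)^{i+j}\big(\frac{m-1-j}{j+1}+\frac{2k-j+1}{j(j+1)}\big)$ if $j\ge i$; $-\frac{1}{j+1}\big(j(2k-j)+m-1\big)$ if $j=i-1$; $0$ if $j<i-1$. * $C_2^{(m)}$ is $m\times(m-2)$: $(-1)^{i+j}\frac{k+2}{(j+1)(j+2)}$ if $j\ge i-1$; $\frac{i-k-2}{i}$ if $j=i-2$; $0$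 if $j<i-2$. * $C_3^{(m)}$ is $m\times(m+1)$: $(-1)^j$ if $i=1$, $j\in\{1,2\}$; $\frac{(-1)^{i+j}}{(j-1)(j-2)}$ if $j>i+1$; $\frac{j}{j-1}$ if $j=i+1$, $i\ne1$; $0$ if $j\le i$, $i\ne 1$. * $C_4^{(m)}$ is $m\times(m+2)$: $(-1)^{j-1}$ if $i=1$, $j\in\{1,2,3\}$; $(-1)^{i-j-1}\frac{2}{(j-2)(j-3)}$ if $j>i+2$; $\frac{i+2}{i}$ if $j=i+2$, $i\ne1$; $0$ if $j\le i+1$, $i\neq1$. All the series converge, $G_{k,Y}$ is smooth in $(t_1,t_2)$, the functions $f^{(n_1,n_2)}_{m,q}$ and $F(n_1,n_2)$ are smooth on $(0,\infty)$, and $F(n_1,n_2)=\partial_{t_1}^{n_1}\partial_{t_2}^{n_2}G_k|_{t_1=t_2=0}$. For all $n_1,n_2\ge 0$ and $m\ge 3$ (terms with a negative superscript have coefficient $0$ and are read as $0$) $$\begin{aligned} {\bf f}^{(n_1,n_2)}_{m,1}={}&-\sqrt x\,B^{(m)}\Big(\tfrac{d}{dx}-\tfrac{k^2+m-1-2n_1-3n_2}{2x}\Big)\begin{pmatrix}{\bf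 f}^{(n_1,n_2)}_{m-1,1}\\0\end{pmatrix}-\tfrac1{\sqrt x}C_1^{(m)}{\bf f}^{(n_1,n_2)}_{m-1,1}+C_2^{(m)}{\bf f}^{(n_1,n_2)}_{m-2,1}\\ &+\tfrac{2n_1}{\sqrt x}C_3^{(m)}{\bf f}^{(n_1-1,n_2)}_{m+1,1}-\tfrac{3n_2}{\sqrt x}C_4^{(m)}{\bf f}^{(n_1,n_2-1)}_{m+2,1}\\ &+2n_1B^{(m)}\Big(\tfrac{d}{dx}-\tfrac{k^2+m+2n_1+3n_2-2}{2x}\Big)\begin{pmatrix}{\bf f}^{(n_1-1,n_2)}_{m,2}\\0\end{pmatrix}+\tfrac{3n_2}{\sqrt x}B^{(m)}\begin{pmatrix}{\bf f}^{(n_1+1,n_2-1)}_{m,2}\\0\end{pmatrix}\\ &-3n_2B^{(m)}\Big(\tfrac{d}{dx}-\tfrac{k^2+m+1}{2x}\Big)\begin{pmatrix}{\bf f}^{(n_1,n_2-1)}_{m+1,3}\\0\end{pmatrix}\\ &+\tfrac{3n_1n_2}{x}B^{(m)}\begin{pmatrix}{\bf f}^{(n_1,n_2-1)}_{m+1,3}\\0\end{pmatrix}+\tfrac{9n_2(n_2-1)}{2x}B^{(m)}\begin{pmatrix}{\bf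 f}^{(n_1,n_2-1)}_{m+1,3}\\0\end{pmatrix}. \end{aligned}$$ The initial conditions are $F(0,0)=\tau_k$, $F(1,0)=-2k\frac{d\tau_k}{dx}+\big(k+\frac{k^3}{x}\big)\tau_k$, and for all $n_1,n_2\ge 0$ $$f^{(n_1,n_2)}_{1,1}=\Big(\sqrt x\tfrac{d}{dx}-\tfrac{k^2}{2\sqrt x}-\tfrac{n_1}{\sqrt x}-\tfrac{3n_2}{2\sqrt x}\Big)F(n_1,n_2),$$ $$f^{(n_1,n_2)}_{2,1}=\tfrac12F(n_1+1,n_2)+\tfrac12L\,F(n_1,n_2),\qquad f^{(n_1,n_2)}_{2,2}=-\tfrac12F(n_1+1,n_2)+\tfrac12L\,F(n_1,n_2),$$ $$L=x\tfrac{d^2}{dx^2}-(k^2+2n_1+3n_2)\tfrac{d}{dx}+\tfrac{(k^2+2)n_1}{x}+\tfrac{k^2(k^2+2)}{4x}+\tfrac{n_1(n_1-1)}{x}+\tfrac{(6k^2+15)n_2}{4x}+\tfrac{9n_2(n_2-1)}{4x}+\tfrac{3n_1n_2}{x}.$$ Moreover, for $n_1\ge1$, $n_2\ge 0$, $$\begin{aligned}F(n_1,n_2)={}&kF(n_1-1,n_2)+\sum_{j=0}^{n_2}\Big(\tfrac{3}{\sqrt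 x}\Big)^j\tbinom{n_2}{j}\sum_{i=0}^{n_1-1}(-1)^{i+j}(i+j)!\Big(\tfrac{2}{\sqrt x}\Big)^i\tbinom{n_1-1}{i}\\ &\times\Big(\sum_{s=1}^{i+2j}(-1)^{s-1}f^{(n_1-1-i,n_2-j)}_{i+2j,s}-\tfrac1{\sqrt x}\sum_{s=1}^{i+2j+1}(-1)^{s-1}(2k-2s+i+2j+2)f^{(n_1-1-i,n_2-j)}_{i+2j+1,s}\Big),\end{aligned}$$ and for $n_2\ge 1$ $$\begin{aligned}F(0,n_2)={}&f^{(0,n_2-1)}_{1,1}-\tfrac1{\sqrt x}\Big((2k+1)f^{(0,n_2-1)}_{2,1}-(2k-1)f^{(0,n_2-1)}_{2,2}\Big)+\sum_{i=1}^{n_2-1}(-1)^ii!\Big(\tfrac3{\sqrt x}\Big)^i\tbinom{n_2-1}{i}\\ &\times\Big(\sum_{s=1}^{2i+1}(-1)^{s-1}f^{(0,n_2-1-i)}_{2i+1,s}-\tfrac1{\sqrt x}\sum_{s=1}^{2i+2}(-1)^{s-1}(2k-2s+2i+3)f^{(0,n_2-1-i)}_{2i+2,s}\Big).\end{aligned}$$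 These relations determine everything: any families of functions on $(0,\infty)$ that satisfy the recursive formula, the initial conditions and the two formulae for $F$ coincide with $f^{(n_1,n_2)}_{m,q}$ $(1\le q\le m)$ and $F(n_1,n_2)$. -/

import Mathlib

open scoped ContDiff

namespace HankelHook

noncomputable section

/-- The modified Bessel function of the first kind of order `n`. -/
def besselI (n : ℕ) (z : ℝ) : ℝ :=
  (z / 2) ^ n * ∑' j : ℕ, z ^ (2 * j) / (2 ^ (2 * j) * ((n + j).factorial : ℝ) * (j.factorial : ℝ))

/-- The Hankel determinant `τ_k(x) = det (I_{i+j+1}(2√x))`, with `i, j = 0, …, k-1`. -/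
def tau (k : ℕ) (x : ℝ) : ℝ :=
  Matrix.det (Matrix.of fun i j : Fin k => besselI ((i : ℕ) + j + 1) (2 * √x))

/-- The two-variable generating function `g_β(x, t₁, t₂)` of Bessel functions. -/
def genBessel (β : ℕ) (x t₁ t₂ : ℝ) : ℝ :=
  ∑' n : ℕ, ∑' m : ℕ, t₁ ^ n * t₂ ^ m / ((n.factorial : ℝ) * (m.factorial : ℝ)) *
    besselI (2 * n + 3 * m + β) (2 * √x)

/-- The Hankel determinant `G_{k,Y}` whose columns are shifted by the Young diagram
`Y = (l_1, l_2, …)`: its `(i, j)` entry is `g_{i+j+1+l_{k-j}}`, with `i, j = 0, …, k-1`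
(rows of a `YoungDiagram` are numbered from `0`, so `l_{k-j} = Y.rowLen (k - 1 - j)`).
By convention it is `0` when `Y` has more than `k` rows. -/
def shiftedDet (k : ℕ) (Y : YoungDiagram) (x t₁ t₂ : ℝ) : ℝ :=
  if Y.colLen 0 ≤ k then
    Matrix.det (Matrix.of fun i j : Fin k =>
      genBessel ((i : ℕ) + j + 1 + Y.rowLen (k - 1 - j)) x t₁ t₂)
  else 0

/-- The hook diagram `Y_{l,j} = (l-j+1, 1, …, 1)` with `j - 1` ones, for `1 ≤ j ≤ l`. -/
def hook (l j : ℕ) : YoungDiagram :=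
  YoungDiagram.ofRowLens ((l - j + 1) :: List.replicate (j - 1) 1) (by
    rw [List.sortedGE_iff_pairwise, List.pairwise_cons]
    refine ⟨fun b hb => ?_, ?_⟩
    · rw [List.eq_of_mem_replicate hb]; omega
    · simp [List.pairwise_replicate])

/-- `f^{(n₁,n₂)}_{m,q}(x) = ∂_{t₁}^{n₁} ∂_{t₂}^{n₂} G_{k,Y_{m,q}}` at `t₁ = t₂ = 0`. -/
def hookDeriv (k n₁ n₂ m q : ℕ) (x : ℝ) : ℝ :=
  iteratedDeriv n₁ (fun t₁ => iteratedDeriv n₂ (fun t₂ => shiftedDet k (hook m q) x t₁ t₂) 0) 0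

/-- `F(n₁, n₂)`: the sum of the determinants `det (I_{2h_{1,j}+3h_{2,j}+i+j+1}(2√x))`, weighted by
multinomial coefficients, over all `h₁, h₂ : {0, …, k-1} → ℕ` of sums `n₁` and `n₂`. -/
def sumDet (k n₁ n₂ : ℕ) (x : ℝ) : ℝ :=
  ∑ h₁ ∈ Finset.piAntidiag (Finset.univ : Finset (Fin k)) n₁,
    ∑ h₂ ∈ Finset.piAntidiag (Finset.univ : Finset (Fin k)) n₂,
      (Nat.multinomial Finset.univ h₁ : ℝ) * (Nat.multinomial Finset.univ h₂ : ℝ) *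
        Matrix.det (Matrix.of fun i j : Fin k =>
          besselI (2 * h₁ j + 3 * h₂ j + i + j + 1) (2 * √x))

/-! The coefficient matrices. The entries are written as functions of the indices `i, j`
counted from `1`; the matrices themselves have index types `Fin`, counted from `0`. -/

/-- Entries of `B^{(l)}` (the last column has its own rule). -/
def entryB (l i j : ℕ) : ℝ :=
  if j = l then (-1) ^ (i + 1) / l
  else if i ≤ j then (-1) ^ (i + j + 1) / (j * (j + 1))
  else if i = j + 1 then -1 / i
  else 0

/-- Entries of `C_1^{(l)}`. -/
def entryC1 (k l i j : ℕ) : ℝ :=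
  if i ≤ j then
    (-1) ^ (i + j) * (((l : ℝ) - 1 - j) / (j + 1) + (2 * (k : ℝ) - j + 1) / (j * (j + 1)))
  else if i = j + 1 then -(1 / ((j : ℝ) + 1)) * (j * (2 * (k : ℝ) - j) + l - 1)
  else 0

/-- Entries of `C_2^{(l)}`. -/
def entryC2 (k i j : ℕ) : ℝ :=
  if i ≤ j + 1 then (-1) ^ (i + j) * (((k : ℝ) + 2) / ((j + 1) * (j + 2)))
  else if i = j + 2 then ((i : ℝ) - k - 2) / i
  else 0

/-- Entries of `C_3^{(l)}`. -/
def entryC3 (i j : ℕ) : ℝ :=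
  if i = 1 ∧ (j = 1 ∨ j = 2) then (-1) ^ j
  else if i + 1 < j then (-1) ^ (i + j) / (((j : ℝ) - 1) * ((j : ℝ) - 2))
  else if j = i + 1 then (j : ℝ) / ((j : ℝ) - 1)
  else 0

/-- Entries of `C_4^{(m)}`. -/
def entryC4 (i j : ℕ) : ℝ :=
  if i = 1 ∧ (j = 1 ∨ j = 2 ∨ j = 3) then (-1) ^ (j + 1)
  else if i + 2 < j then (-1) ^ (i + j + 1) * (2 / (((j : ℝ) - 2) * ((j : ℝ) - 3)))
  else if j = i + 2 then ((i : ℝ) + 2) / i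
  else 0

def matB (m : ℕ) : Matrix (Fin m) (Fin m) ℝ :=
  Matrix.of fun a b => entryB m (a + 1) (b + 1)

def matC1 (k m : ℕ) : Matrix (Fin m) (Fin (m - 1)) ℝ :=
  Matrix.of fun a b => entryC1 k m (a + 1) (b + 1)

def matC2 (k m : ℕ) : Matrix (Fin m) (Fin (m - 2)) ℝ :=
  Matrix.of fun a b => entryC2 k (a + 1) (b + 1)

def matC3 (m : ℕ) : Matrix (Fin m) (Fin (m + 1)) ℝ :=
  Matrix.of fun a b => entryC3 (a + 1) (b + 1)

def matC4 (m : ℕ) : Matrix (Fin m) (Fin (m + 2)) ℝ :=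
  Matrix.of fun a b => entryC4 (a + 1) (b + 1)

/-- The column vector `(φ i, φ (i+1), …, φ M)`, followed by zeros up to size `n`. -/
def colVec (φ : ℕ → ℝ) (i M n : ℕ) : Fin n → ℝ :=
  fun a => if i + a ≤ M then φ (i + a) else 0

/-- The first-order operator `d/dx - c/(2x)`. -/
def diffOp (c : ℝ) (φ : ℝ → ℝ) (x : ℝ) : ℝ :=
  deriv φ x - c / (2 * x) * φ x

/-- The recursive formula in `m ≥ 3` for a family `f n₁ n₂ m q`, `1 ≤ q ≤ m`, of functions on
`(0, ∞)`. A member of the family whose upper index would be negative has coefficient zero. -/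
def HookRecursion (k : ℕ) (f : ℕ → ℕ → ℕ → ℕ → ℝ → ℝ) : Prop :=
  ∀ n₁ n₂ m : ℕ, 3 ≤ m → ∀ x : ℝ, 0 < x →
    colVec (fun q => f n₁ n₂ m q x) 1 m m =
      -(√x • (matB m).mulVec
          (colVec (fun q => diffOp ((k : ℝ) ^ 2 + m - 1 - 2 * n₁ - 3 * n₂) (f n₁ n₂ (m - 1) q) x)
            1 (m - 1) m))
      - (1 / √x) • (matC1 k m).mulVec (colVec (fun q => f n₁ n₂ (m - 1) q x) 1 (m - 1) (m - 1))
      + (matC2 k m).mulVec (colVec (fun q => f n₁ n₂ (m - 2) q x) 1 (m - 2) (m - 2))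
      + (2 * n₁ / √x) •
          (matC3 m).mulVec (colVec (fun q => f (n₁ - 1) n₂ (m + 1) q x) 1 (m + 1) (m + 1))
      - (3 * n₂ / √x) •
          (matC4 m).mulVec (colVec (fun q => f n₁ (n₂ - 1) (m + 2) q x) 1 (m + 2) (m + 2))
      + (2 * n₁ : ℝ) • (matB m).mulVec
          (colVec (fun q => diffOp ((k : ℝ) ^ 2 + m + 2 * n₁ + 3 * n₂ - 2) (f (n₁ - 1) n₂ m q) x)
            2 m m)
      + (3 * n₂ / √x) • (matB m).mulVec (colVec (fun q => f (n₁ + 1) (n₂ - 1) m q x) 2 m m)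
      - (3 * n₂ : ℝ) • (matB m).mulVec
          (colVec (fun q => diffOp ((k : ℝ) ^ 2 + m + 1) (f n₁ (n₂ - 1) (m + 1) q) x) 3 (m + 1) m)
      + (3 * n₁ * n₂ / x) •
          (matB m).mulVec (colVec (fun q => f n₁ (n₂ - 1) (m + 1) q x) 3 (m + 1) m)
      + (9 * n₂ * ((n₂ : ℝ) - 1) / (2 * x)) •
          (matB m).mulVec (colVec (fun q => f n₁ (n₂ - 1) (m + 1) q x) 3 (m + 1) m)

/-- The second-order differential operator in the formulae for `f_{2,1}` and `f_{2,2}`. -/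
def diffOp2 (k n₁ n₂ : ℕ) (φ : ℝ → ℝ) (x : ℝ) : ℝ :=
  x * iteratedDeriv 2 φ x - ((k : ℝ) ^ 2 + 2 * n₁ + 3 * n₂) * deriv φ x
    + (((k : ℝ) ^ 2 + 2) * n₁ / x + (k : ℝ) ^ 2 * ((k : ℝ) ^ 2 + 2) / (4 * x)
      + n₁ * ((n₁ : ℝ) - 1) / x + (6 * (k : ℝ) ^ 2 + 15) * n₂ / (4 * x)
      + 9 * n₂ * ((n₂ : ℝ) - 1) / (4 * x) + 3 * n₁ * n₂ / x) * φ x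

/-- The initial conditions: `F(0,0)`, `F(1,0)`, `f_{1,1}`, `f_{2,1}` and `f_{2,2}`. -/
def InitialConditions (k : ℕ) (f : ℕ → ℕ → ℕ → ℕ → ℝ → ℝ) (F : ℕ → ℕ → ℝ → ℝ) : Prop :=
  ∀ x : ℝ, 0 < x →
    F 0 0 x = tau k x ∧
    F 1 0 x = -2 * k * deriv (tau k) x + (k + (k : ℝ) ^ 3 / x) * tau k x ∧
    ∀ n₁ n₂ : ℕ,
      f n₁ n₂ 1 1 x = √x * deriv (F n₁ n₂) x - (k : ℝ) ^ 2 / (2 * √x) * F n₁ n₂ x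
        - n₁ / √x * F n₁ n₂ x - 3 * n₂ / (2 * √x) * F n₁ n₂ x ∧
      f n₁ n₂ 2 1 x = 1 / 2 * F (n₁ + 1) n₂ x + 1 / 2 * diffOp2 k n₁ n₂ (F n₁ n₂) x ∧
      f n₁ n₂ 2 2 x = -(1 / 2) * F (n₁ + 1) n₂ x + 1 / 2 * diffOp2 k n₁ n₂ (F n₁ n₂) x

/-- The recursive formulae expressing `F(n₁, n₂)` with `n₁ ≥ 1`, and `F(0, n₂)` with `n₂ ≥ 1`,
through quantities of lower order. -/
def SumRecursion (k : ℕ) (f : ℕ → ℕ → ℕ → ℕ → ℝ → ℝ) (F : ℕ → ℕ → ℝ → ℝ) : Prop :=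
  (∀ n₁ n₂ : ℕ, 1 ≤ n₁ → ∀ x : ℝ, 0 < x →
    F n₁ n₂ x = k * F (n₁ - 1) n₂ x
      + ∑ j ∈ Finset.range (n₂ + 1), (3 / √x) ^ j * (n₂.choose j : ℝ) *
          ∑ i ∈ Finset.range n₁,
            (-1) ^ (i + j) * ((i + j).factorial : ℝ) * (2 / √x) ^ i * ((n₁ - 1).choose i : ℝ) *
              (∑ s ∈ Finset.Icc 1 (i + 2 * j),
                  (-1) ^ (s - 1) * f (n₁ - 1 - i) (n₂ - j) (i + 2 * j) s x
                - 1 / √x * ∑ s ∈ Finset.Icc 1 (i + 2 * j + 1),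
                    (-1) ^ (s - 1) * (2 * (k : ℝ) - 2 * s + i + 2 * j + 2) *
                      f (n₁ - 1 - i) (n₂ - j) (i + 2 * j + 1) s x)) ∧
  (∀ n₂ : ℕ, 1 ≤ n₂ → ∀ x : ℝ, 0 < x →
    F 0 n₂ x = f 0 (n₂ - 1) 1 1 x
      - 1 / √x * ((2 * (k : ℝ) + 1) * f 0 (n₂ - 1) 2 1 x - (2 * (k : ℝ) - 1) * f 0 (n₂ - 1) 2 2 x)
      + ∑ i ∈ Finset.Icc 1 (n₂ - 1),
          (-1) ^ i * (i.factorial : ℝ) * (3 / √x) ^ i * ((n₂ - 1).choose i : ℝ) *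
            (∑ s ∈ Finset.Icc 1 (2 * i + 1),
                (-1) ^ (s - 1) * f 0 (n₂ - 1 - i) (2 * i + 1) s x
              - 1 / √x * ∑ s ∈ Finset.Icc 1 (2 * i + 2),
                  (-1) ^ (s - 1) * (2 * (k : ℝ) - 2 * s + 2 * i + 3) *
                    f 0 (n₂ - 1 - i) (2 * i + 2) s x))

end

end HankelHook

/-!
Write `u_0, …, u_{k-1}` for the variables of `MvPolynomial (Fin k) ℝ`. A determinant of Bessel
functions is a value of the linear functional (`moment`) that sends the monomial `∏ u_i ^ (s i)` to
`∏ I_{s i + 1}(2√x)`: the Hankel matrix is the moment matrix of this functional, so expanding and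
antisymmetrizing turns `det (I_{i+j+1+l_{k-j}})` into the moment of `Δ² s_Y / k!`, where `Δ` is the
Vandermonde determinant and `s_Y` the Schur polynomial of the diagram. Differentiation in `t₁`,
`t₂` multiplies the integrand by the power sums `p_2`, `p_3`. Hence, with
`avg k n₁ n₂ x s` the moment of `p_2 ^ n₁ p_3 ^ n₂ s Δ² / k!`, the function `f_{m,q}^{(n₁,n₂)}` is
the average of the hook Schur polynomial `hookPoly k m q`, and `F(n₁, n₂)` the average of `1`
(`hookDeriv_eq`, `sumDet_eq`, `iteratedDeriv_shiftedDet_bot`).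

All identities come from two properties of Bessel functions. The derivative formula, combined with
homogeneity, expresses the average of `p_1 s` through `d/dx` of the average of `s`
(`avg_psum_one_mul`). The three-term recurrence says that the moment of `∂_i (u_i² Q)` is `√x`
times that of `(1 - u_i²) Q`; with `Q = V_i p_2 ^ n₁ p_3 ^ n₂ Δ²` and summed over `i` this gives the
loop equation of the vector field `u_i² V_i ∂_i` (`loop_equation`). Two families are used.

* `V_i = u_i ^ n` gives a recurrence for the averages of power sums (`avg_psum_recurrence`), because
  `p_m` is the alternating sum of the hook polynomials of size `m`. Iterating it gives the two
  formulae for `F` (`sum_stepTerm_unroll`, `sumRecursion_hookDeriv`).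
* `V_i = h_{a+1} ∂_i e_r` gives `avg_elem_mul_comp`, because `e_r h_{a+1}` is the sum of two
  consecutive hook polynomials and `∑ u_i² ∂_i e_r ∂_i Δ` is a multiple of `e_r Δ`.

The recursive formula for the vector of all `f_{m,q}` then follows by linear algebra: a vector of
length `m` is determined by the sums of two consecutive entries and by the alternating sum of all
entries (`eq_zero_of_pair_of_alternating`). For the products with the coefficient matrices both are
computed from closed forms, in which most terms cancel; for the averages the first are
given by the second family of loop equations (by expansions of `p_1 h_{m-1}`, `p_2 h_{m-1}`,
`p_3 h_{m-1}` for the first pair), and the last by the first family.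

Uniqueness is an induction on `n₂`, then `n₁`, then `m`: each relation expresses its left-hand side
through quantities that come earlier in this order, once `F(n₁ + 1, n₂)` in the formulae for
`f_{2,q}^{(n₁,n₂)}` is itself expressed by its formula (`agree_of_recursions`).
-/

namespace HankelHook

open MvPolynomial

/-! ### Bessel functions -/

/-- The entire function `∑ x ^ j / ((n + j)! j!)`; `besselI n (2 √x)` is `√x ^ n` times it. -/
noncomputable def besselEntire (n : ℕ) (x : ℝ) : ℝ :=
  ∑' j : ℕ, x ^ j / (((n + j).factorial : ℝ) * (j.factorial : ℝ))

lemma summable_besselEntire (n : ℕ) (x : ℝ) :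
    Summable fun j : ℕ => x ^ j / (((n + j).factorial : ℝ) * (j.factorial : ℝ)) := by
  refine Summable.of_norm_bounded (Real.summable_pow_div_factorial |x|) fun j => ?_
  rw [norm_div, norm_pow, Real.norm_eq_abs, norm_mul]
  simp only [Real.norm_natCast]
  gcongr
  have h1 : (1 : ℝ) ≤ ((n + j).factorial : ℝ) := by
    exact_mod_cast Nat.succ_le_of_lt (Nat.factorial_pos _)
  have h2 : (0 : ℝ) ≤ (j.factorial : ℝ) := by positivity
  nlinarith

lemma summable_besselI (n : ℕ) (z : ℝ) : Summable fun j : ℕ =>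
    z ^ (2 * j) / (2 ^ (2 * j) * ((n + j).factorial : ℝ) * (j.factorial : ℝ)) := by
  refine (summable_besselEntire n ((z / 2) ^ 2)).congr fun j => ?_
  rw [← pow_mul, div_pow, div_div, mul_assoc]

lemma besselI_two_sqrt (n : ℕ) {x : ℝ} (hx : 0 ≤ x) :
    besselI n (2 * √x) = √x ^ n * besselEntire n x := by
  unfold besselI besselEntire
  congr 1
  · ring
  · refine tsum_congr fun j => ?_
    rw [mul_pow, pow_mul (√x), Real.sq_sqrt hx]
    field_simp

lemma hasDerivAt_besselEntire (n : ℕ) (x : ℝ) :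
    HasDerivAt (besselEntire n) (besselEntire (n + 1) x) x := by
  have hu : Summable fun j : ℕ => (j : ℝ) * (|x| + 1) ^ (j - 1) / (j.factorial : ℝ) := by
    rw [← summable_nat_add_iff 1]
    refine (Real.summable_pow_div_factorial (|x| + 1)).congr fun j => ?_
    rw [Nat.factorial_succ, Nat.add_sub_cancel]
    push_cast
    field_simp
  have hd := hasDerivAt_tsum_of_isPreconnected (y₀ := 0) (y := x)
    (g := fun (j : ℕ) (y : ℝ) => y ^ j / (((n + j).factorial : ℝ) * (j.factorial : ℝ)))
    (g' := fun (j : ℕ) (y : ℝ) =>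
      (j : ℝ) * y ^ (j - 1) / (((n + j).factorial : ℝ) * (j.factorial : ℝ)))
    hu (t := Metric.ball 0 (|x| + 1)) Metric.isOpen_ball
    (convex_ball _ _).isPreconnected
    (fun j y _ => (hasDerivAt_pow j y).div_const _)
    (fun j y hy => by
      have hy' : |y| ≤ |x| + 1 := by
        rw [Metric.mem_ball, dist_zero_right, Real.norm_eq_abs] at hy
        exact hy.le
      rw [norm_div, norm_mul, norm_pow, norm_mul]
      simp only [Real.norm_eq_abs, Nat.abs_cast]
      gcongr
      have h1 : (1 : ℝ) ≤ ((n + j).factorial : ℝ) := by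
        exact_mod_cast Nat.succ_le_of_lt (Nat.factorial_pos _)
      have h2 : (0 : ℝ) ≤ (j.factorial : ℝ) := by positivity
      nlinarith)
    (Metric.mem_ball_self (by positivity)) (summable_besselEntire n 0)
    (by simp)
  refine hd.congr_deriv ?_
  rw [Summable.tsum_eq_zero_add]
  · simp only [CharP.cast_eq_zero, zero_mul, zero_div, zero_add, besselEntire]
    refine tsum_congr fun j => ?_
    rw [Nat.factorial_succ j, Nat.add_sub_cancel, show n + (j + 1) = n + 1 + j by ring]
    push_cast
    field_simp
  · rw [← summable_nat_add_iff 1]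
    refine (summable_besselEntire (n + 1) x).congr fun j => ?_
    rw [Nat.factorial_succ j, Nat.add_sub_cancel, show n + (j + 1) = n + 1 + j by ring]
    push_cast
    field_simp

lemma besselEntire_eq_add (n : ℕ) (x : ℝ) :
    besselEntire n x = (n + 1) * besselEntire (n + 1) x + x * besselEntire (n + 2) x := by
  have h : x * besselEntire (n + 2) x =
      ∑' j : ℕ, (j : ℝ) * x ^ j / (((n + 1 + j).factorial : ℝ) * (j.factorial : ℝ)) := by
    have hterm : ∀ j : ℕ, x * (x ^ j / (((n + 2 + j).factorial : ℝ) * (j.factorial : ℝ))) =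
        ((j + 1 : ℕ) : ℝ) * x ^ (j + 1) /
          (((n + 1 + (j + 1)).factorial : ℝ) * ((j + 1).factorial : ℝ)) := fun j => by
      rw [Nat.factorial_succ j, show n + 1 + (j + 1) = n + 2 + j by ring, pow_succ]
      push_cast
      field_simp
    rw [Summable.tsum_eq_zero_add, besselEntire, ← tsum_mul_left]
    · simp only [CharP.cast_eq_zero, zero_mul, zero_div, zero_add]
      exact tsum_congr hterm
    · rw [← summable_nat_add_iff 1]
      exact ((summable_besselEntire (n + 2) x).mul_left x).congr hterm
  have hs := summable_besselEntire (n + 1) x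
  have hs' : Summable fun j : ℕ =>
      (j : ℝ) * x ^ j / (((n + 1 + j).factorial : ℝ) * (j.factorial : ℝ)) := by
    refine ((summable_besselEntire n x).sub (hs.mul_left (n + 1 : ℝ))).congr fun j => ?_
    rw [show n + 1 + j = n + j + 1 by ring, Nat.factorial_succ (n + j)]
    push_cast
    field_simp
    ring
  rw [h, besselEntire, besselEntire, ← tsum_mul_left, ← (hs.mul_left _).tsum_add hs']
  refine tsum_congr fun j => ?_
  rw [show n + 1 + j = n + j + 1 by ring, Nat.factorial_succ (n + j)]
  push_cast
  field_simp
  ring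

/-- The three-term recurrence of the Bessel functions. -/
lemma besselI_recurrence (n : ℕ) {x : ℝ} (hx : 0 < x) :
    √x * (besselI n (2 * √x) - besselI (n + 2) (2 * √x)) = (n + 1) * besselI (n + 1) (2 * √x) := by
  have h := besselEntire_eq_add n x
  have hs : √x ^ 2 = x := Real.sq_sqrt hx.le
  rw [besselI_two_sqrt _ hx.le, besselI_two_sqrt _ hx.le, besselI_two_sqrt _ hx.le, h,
    pow_add _ n 2, hs]
  ring

lemma hasDerivAt_besselI (n : ℕ) {x : ℝ} (hx : 0 < x) :
    HasDerivAt (fun y => besselI n (2 * √y))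
      (besselI (n + 1) (2 * √x) / √x + n / (2 * x) * besselI n (2 * √x)) x := by
  have hs : √x ^ 2 = x := Real.sq_sqrt hx.le
  have hs0 : √x ≠ 0 := (Real.sqrt_pos.2 hx).ne'
  have h := ((Real.hasDerivAt_sqrt hx.ne').pow n).mul (hasDerivAt_besselEntire n x)
  have he : (fun y => besselI n (2 * √y)) =ᶠ[nhds x] (fun y => √y) ^ n * besselEntire n := by
    filter_upwards [lt_mem_nhds hx] with y hy
    simpa using besselI_two_sqrt n hy.le
  refine (h.congr_of_eventuallyEq he).congr_deriv ?_
  rw [besselI_two_sqrt _ hx.le, besselI_two_sqrt _ hx.le]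
  rcases n with _ | n
  · simp; field_simp
  · have hx2 : 2 * x = 2 * √x ^ 2 := by rw [hs]
    rw [hx2]
    simp only [Nat.add_sub_cancel, Pi.pow_apply]
    field_simp
    ring

lemma contDiff_besselEntire (n : ℕ) : ContDiff ℝ ∞ (besselEntire n) := by
  rw [contDiff_infty]
  intro m
  induction m generalizing n with
  | zero =>
    exact contDiff_zero.2 (continuous_iff_continuousAt.2 fun x =>
      (hasDerivAt_besselEntire n x).continuousAt)
  | succ m ih =>
    have hd : deriv (besselEntire n) = besselEntire (n + 1) :=
      funext fun x => (hasDerivAt_besselEntire n x).deriv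
    push_cast
    refine contDiff_succ_iff_deriv.2 ⟨fun x => (hasDerivAt_besselEntire n x).differentiableAt,
      by simp, ?_⟩
    rw [hd]
    exact ih _

lemma contDiffOn_besselI (n : ℕ) :
    ContDiffOn ℝ ∞ (fun x => besselI n (2 * √x)) (Set.Ioi 0) := by
  have h : ContDiffOn ℝ ∞ (fun x => √x ^ n * besselEntire n x) (Set.Ioi 0) :=
    ((contDiffOn_id.sqrt fun x hx => (ne_of_gt hx)).pow n).mul (contDiff_besselEntire n).contDiffOn
  exact h.congr fun x hx => besselI_two_sqrt n (le_of_lt hx)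

/-- The Bessel functions of a fixed argument grow at most geometrically in the order. -/
lemma abs_besselI_le (n : ℕ) {x : ℝ} (hx : 0 ≤ x) :
    |besselI n (2 * √x)| ≤ besselEntire 0 x * √x ^ n := by
  have hpos : 0 ≤ besselEntire n x := tsum_nonneg fun j => by positivity
  rw [besselI_two_sqrt n hx, abs_of_nonneg (by positivity), mul_comm]
  gcongr
  refine (summable_besselEntire n x).tsum_le_tsum (fun j => ?_) (summable_besselEntire 0 x)
  have : (0 + j).factorial ≤ (n + j).factorial := Nat.factorial_le (by omega)
  gcongr

/-! ### Exponential generating functions in two variables -/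

/-- The series `∑ t₁ ^ n t₂ ^ m / (n! m!) a (2 n + 3 m)`. -/
noncomputable def expGen (a : ℕ → ℝ) (t : ℝ × ℝ) : ℝ :=
  ∑' p : ℕ × ℕ, t.1 ^ p.1 * t.2 ^ p.2 / ((p.1.factorial : ℝ) * (p.2.factorial : ℝ)) *
    a (2 * p.1 + 3 * p.2)

/-- Growth at most geometric: the sequences whose generating series are treated. -/
def GeomBounded (a : ℕ → ℝ) : Prop :=
  ∃ C ρ : ℝ, 0 ≤ C ∧ 0 ≤ ρ ∧ ∀ n, |a n| ≤ C * ρ ^ n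

lemma GeomBounded.shift {a : ℕ → ℝ} (h : GeomBounded a) (β : ℕ) :
    GeomBounded fun n => a (n + β) := by
  obtain ⟨C, ρ, hC, hρ, hb⟩ := h
  refine ⟨C * ρ ^ β, ρ, by positivity, hρ, fun n => (hb _).trans_eq ?_⟩
  rw [pow_add]
  ring

lemma geomBounded_besselI {x : ℝ} (hx : 0 ≤ x) : GeomBounded fun n => besselI n (2 * √x) :=
  ⟨besselEntire 0 x, √x, tsum_nonneg fun j => by positivity, Real.sqrt_nonneg x,
    fun n => abs_besselI_le n hx⟩

lemma summable_expGen {a : ℕ → ℝ} (h : GeomBounded a) (t : ℝ × ℝ) :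
    Summable fun p : ℕ × ℕ => t.1 ^ p.1 * t.2 ^ p.2 /
      ((p.1.factorial : ℝ) * (p.2.factorial : ℝ)) * a (2 * p.1 + 3 * p.2) := by
  obtain ⟨C, ρ, hC, hρ, hb⟩ := h
  have h1 := Real.summable_pow_div_factorial (|t.1| * ρ ^ 2)
  have h2 := Real.summable_pow_div_factorial (|t.2| * ρ ^ 3)
  refine Summable.of_norm_bounded
    ((h1.mul_of_nonneg h2 (fun n => by positivity) (fun n => by positivity)).mul_left C)
    fun p => ?_
  rw [norm_mul, norm_div, norm_mul, norm_pow, norm_pow, norm_mul]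
  simp only [Real.norm_eq_abs, Nat.abs_cast]
  refine (mul_le_mul_of_nonneg_left (hb _) (by positivity)).trans_eq ?_
  rw [pow_add, pow_mul, pow_mul, mul_pow, mul_pow]
  field_simp

lemma summable_natCast_mul_pow_div_factorial (c r : ℝ) :
    Summable fun n : ℕ => (n : ℝ) * r ^ (n - 1) * c ^ n / (n.factorial : ℝ) := by
  rw [← summable_nat_add_iff 1]
  refine ((Real.summable_pow_div_factorial (r * c)).mul_left c).congr fun j => ?_
  rw [Nat.factorial_succ, Nat.add_sub_cancel, mul_pow, pow_succ c]
  push_cast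
  field_simp

/-- Differentiation in `t₁` shifts the sequence by `2`, and differentiation in `t₂` by `3`. -/
lemma hasFDerivAt_expGen {a : ℕ → ℝ} (h : GeomBounded a) (t : ℝ × ℝ) :
    HasFDerivAt (expGen a)
      (expGen (fun n => a (n + 2)) t • ContinuousLinearMap.fst ℝ ℝ ℝ +
        expGen (fun n => a (n + 3)) t • ContinuousLinearMap.snd ℝ ℝ ℝ) t := by
  have h1 : HasSum (fun p : ℕ × ℕ => (p.1 : ℝ) * t.1 ^ (p.1 - 1) * t.2 ^ p.2 /
      ((p.1.factorial : ℝ) * (p.2.factorial : ℝ)) * a (2 * p.1 + 3 * p.2))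
      (expGen (fun n => a (n + 2)) t) := by
    have hinj : Function.Injective fun p : ℕ × ℕ => (p.1 + 1, p.2) := fun p q hpq => by
      simp only [Prod.mk.injEq, add_left_inj] at hpq
      exact Prod.ext hpq.1 hpq.2
    rw [← hinj.hasSum_iff]
    · refine (summable_expGen (h.shift 2) t).hasSum.congr_fun fun p => ?_
      simp only [Function.comp, Nat.factorial_succ, Nat.add_sub_cancel]
      rw [show 2 * (p.1 + 1) + 3 * p.2 = 2 * p.1 + 3 * p.2 + 2 by ring]
      push_cast
      field_simp
    · rintro ⟨_ | n, m⟩ hp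
      · simp
      · exact absurd ⟨(n, m), rfl⟩ hp
  have h2 : HasSum (fun p : ℕ × ℕ => t.1 ^ p.1 * ((p.2 : ℝ) * t.2 ^ (p.2 - 1)) /
      ((p.1.factorial : ℝ) * (p.2.factorial : ℝ)) * a (2 * p.1 + 3 * p.2))
      (expGen (fun n => a (n + 3)) t) := by
    have hinj : Function.Injective fun p : ℕ × ℕ => (p.1, p.2 + 1) := fun p q hpq => by
      simp only [Prod.mk.injEq, add_left_inj] at hpq
      exact Prod.ext hpq.1 hpq.2
    rw [← hinj.hasSum_iff]
    · refine (summable_expGen (h.shift 3) t).hasSum.congr_fun fun p => ?_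
      simp only [Function.comp, Nat.factorial_succ, Nat.add_sub_cancel]
      rw [show 2 * p.1 + 3 * (p.2 + 1) = 2 * p.1 + 3 * p.2 + 3 by ring]
      push_cast
      field_simp
    · rintro ⟨n, _ | m⟩ hp
      · simp
      · exact absurd ⟨(n, m), rfl⟩ hp
  have hsum := (h1.smul_const (ContinuousLinearMap.fst ℝ ℝ ℝ)).add
    (h2.smul_const (ContinuousLinearMap.snd ℝ ℝ ℝ))
  rw [← hsum.tsum_eq]
  obtain ⟨C, ρ, hC, hρ, hb⟩ := h
  set r : ℝ := ‖t‖ + 1 with hr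
  have hr0 : 0 < r := by positivity
  have s1 := Real.summable_pow_div_factorial (r * ρ ^ 2)
  have s2 := Real.summable_pow_div_factorial (r * ρ ^ 3)
  have s1' := summable_natCast_mul_pow_div_factorial (ρ ^ 2) r
  have s2' := summable_natCast_mul_pow_div_factorial (ρ ^ 3) r
  have hu := ((s1'.mul_of_nonneg s2 (fun n => by positivity) (fun n => by positivity)).add
    (s1.mul_of_nonneg s2' (fun n => by positivity) (fun n => by positivity))).mul_left C
  refine hasFDerivAt_tsum_of_isPreconnected (x₀ := 0) hu (s := Metric.ball 0 r)
    Metric.isOpen_ball (convex_ball _ _).isPreconnected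
    (f := fun (p : ℕ × ℕ) (y : ℝ × ℝ) => y.1 ^ p.1 * y.2 ^ p.2 /
      ((p.1.factorial : ℝ) * (p.2.factorial : ℝ)) * a (2 * p.1 + 3 * p.2))
    (f' := fun (p : ℕ × ℕ) (y : ℝ × ℝ) =>
      ((p.1 : ℝ) * y.1 ^ (p.1 - 1) * y.2 ^ p.2 /
      ((p.1.factorial : ℝ) * (p.2.factorial : ℝ)) * a (2 * p.1 + 3 * p.2)) •
        ContinuousLinearMap.fst ℝ ℝ ℝ +
      (y.1 ^ p.1 * ((p.2 : ℝ) * y.2 ^ (p.2 - 1)) /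
      ((p.1.factorial : ℝ) * (p.2.factorial : ℝ)) * a (2 * p.1 + 3 * p.2)) •
        ContinuousLinearMap.snd ℝ ℝ ℝ)
    (fun p y _ => ?_) (fun p y hy => ?_) (Metric.mem_ball_self hr0)
    (summable_expGen ⟨C, ρ, hC, hρ, hb⟩ 0) (by simp [hr])
  · have e1 := (hasFDerivAt_fst (𝕜 := ℝ) (p := y)).pow p.1
    have e2 := (hasFDerivAt_snd (𝕜 := ℝ) (p := y)).pow p.2
    have e3 := (e1.mul e2).mul_const
      ((((p.1.factorial : ℝ) * (p.2.factorial : ℝ)))⁻¹ * a (2 * p.1 + 3 * p.2))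
    refine (e3.congr_fderiv ?_).congr_of_eventuallyEq
      (Filter.Eventually.of_forall fun z => ?_)
    · ext <;> simp <;> ring
    · simp; ring
  · have hy' : ‖y‖ ≤ r := by
      rw [Metric.mem_ball, dist_zero_right] at hy
      exact hy.le
    have hy1 : |y.1| ≤ r := (norm_fst_le y).trans hy'
    have hy2 : |y.2| ≤ r := (norm_snd_le y).trans hy'
    have key : ∀ (c d : ℝ) (L : ℝ × ℝ →L[ℝ] ℝ), ‖L‖ ≤ 1 → |c| ≤ d →
        ‖(c / ((p.1.factorial : ℝ) * (p.2.factorial : ℝ)) * a (2 * p.1 + 3 * p.2)) • L‖ ≤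
          d / ((p.1.factorial : ℝ) * (p.2.factorial : ℝ)) * (C * ρ ^ (2 * p.1 + 3 * p.2)) := by
      intro c d L hL hcd
      have hd : 0 ≤ d := (abs_nonneg c).trans hcd
      rw [norm_smul, norm_mul, norm_div, norm_mul]
      simp only [Real.norm_eq_abs, Nat.abs_cast]
      refine (mul_le_of_le_one_right (by positivity) hL).trans ?_
      gcongr
      exact hb _
    refine (norm_add_le _ _).trans ((add_le_add
      (key _ ((p.1 : ℝ) * r ^ (p.1 - 1) * r ^ p.2) _ (ContinuousLinearMap.norm_fst_le ℝ ℝ ℝ) ?_)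
      (key _ (r ^ p.1 * ((p.2 : ℝ) * r ^ (p.2 - 1))) _
        (ContinuousLinearMap.norm_snd_le ℝ ℝ ℝ) ?_)).trans_eq ?_)
    · rw [abs_mul, abs_mul, abs_pow, abs_pow, Nat.abs_cast]
      gcongr
    · rw [abs_mul, abs_mul, abs_pow, abs_pow, Nat.abs_cast]
      gcongr
    · rw [pow_add, pow_mul, pow_mul, mul_pow, mul_pow]
      field_simp

lemma contDiff_expGen {a : ℕ → ℝ} (h : GeomBounded a) : ContDiff ℝ ∞ (expGen a) := by
  rw [contDiff_infty]
  intro m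
  induction m generalizing a with
  | zero =>
    exact contDiff_zero.2 (continuous_iff_continuousAt.2 fun x =>
      (hasFDerivAt_expGen h x).continuousAt)
  | succ m ih =>
    push_cast
    refine contDiff_succ_iff_hasFDerivAt.2 ⟨_, ?_, fun t => hasFDerivAt_expGen h t⟩
    exact ((ih (h.shift 2)).smul contDiff_const).add ((ih (h.shift 3)).smul contDiff_const)

lemma expGen_zero (a : ℕ → ℝ) : expGen a 0 = a 0 := by
  rw [expGen, tsum_eq_single (0, 0)]
  · simp
  · rintro ⟨n, m⟩ hp
    rcases n with _ | n
    · rcases m with _ | m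
      · exact absurd rfl hp
      · simp
    · simp

lemma genBessel_eq_expGen (β : ℕ) {x : ℝ} (hx : 0 ≤ x) (t₁ t₂ : ℝ) :
    genBessel β x t₁ t₂ = expGen (fun n => besselI (n + β) (2 * √x)) (t₁, t₂) :=
  ((summable_expGen ((geomBounded_besselI hx).shift β) (t₁, t₂)).tsum_prod).symm

lemma genBessel_zero (β : ℕ) {x : ℝ} (hx : 0 ≤ x) :
    genBessel β x 0 0 = besselI β (2 * √x) := by
  rw [genBessel_eq_expGen β hx, show ((0 : ℝ), (0 : ℝ)) = 0 from rfl, expGen_zero, zero_add]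

lemma contDiff_genBessel (β : ℕ) {x : ℝ} (hx : 0 ≤ x) :
    ContDiff ℝ ∞ fun t : ℝ × ℝ => genBessel β x t.1 t.2 := by
  simp only [genBessel_eq_expGen β hx]
  exact contDiff_expGen ((geomBounded_besselI hx).shift β)

lemma hasDerivAt_genBessel_left (β : ℕ) {x : ℝ} (hx : 0 ≤ x) (t₁ t₂ : ℝ) :
    HasDerivAt (fun s => genBessel β x s t₂) (genBessel (β + 2) x t₁ t₂) t₁ := by
  simp only [genBessel_eq_expGen _ hx]
  have h := (hasFDerivAt_expGen ((geomBounded_besselI hx).shift β) (t₁, t₂)).comp_hasDerivAt t₁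
    ((hasDerivAt_id t₁).prodMk (hasDerivAt_const t₁ t₂))
  simpa [Function.comp_def, add_assoc, add_comm β] using h

lemma hasDerivAt_genBessel_right (β : ℕ) {x : ℝ} (hx : 0 ≤ x) (t₁ t₂ : ℝ) :
    HasDerivAt (fun s => genBessel β x t₁ s) (genBessel (β + 3) x t₁ t₂) t₂ := by
  simp only [genBessel_eq_expGen _ hx]
  have h := (hasFDerivAt_expGen ((geomBounded_besselI hx).shift β) (t₁, t₂)).comp_hasDerivAt t₂
    ((hasDerivAt_const t₂ t₁).prodMk (hasDerivAt_id t₂))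
  simpa [Function.comp_def, add_assoc, add_comm β] using h

/-! ### Moment functionals -/

/-- The linear functional on polynomials in `u_0, …, u_{k-1}` with
`∏ u_i ^ (s i) ↦ ∏ c (s i)`. -/
noncomputable def moment (k : ℕ) (c : ℕ → ℝ) : MvPolynomial (Fin k) ℝ →ₗ[ℝ] ℝ :=
  (basisMonomials (Fin k) ℝ).constr ℝ fun s => ∏ i, c (s i)

section

variable {k : ℕ} (c : ℕ → ℝ)

lemma moment_monomial (s : Fin k →₀ ℕ) (a : ℝ) :
    moment k c (monomial s a) = a * ∏ i, c (s i) := by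
  have h : moment k c (monomial s 1) = ∏ i, c (s i) := by
    have := (basisMonomials (Fin k) ℝ).constr_basis ℝ (fun s => ∏ i, c (s i)) s
    rwa [coe_basisMonomials] at this
  rw [← mul_one a, ← smul_eq_mul, ← smul_monomial, map_smul, h, smul_eq_mul, smul_eq_mul, mul_one]

lemma moment_prod_X_pow (e : Fin k → ℕ) :
    moment k c (∏ i, X i ^ e i) = ∏ i, c (e i) := by
  have h := moment_monomial c (Finsupp.equivFunOnFinite.symm e) 1
  rw [monomial_eq, Finsupp.prod_fintype _ _ (by simp)] at h
  simpa using h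

lemma moment_X_pow_mul_monomial (i : Fin k) (n : ℕ) (s : Fin k →₀ ℕ) (a : ℝ) :
    moment k c (X i ^ n * monomial s a) =
      a * (c (s i + n) * ∏ l ∈ Finset.univ.erase i, c (s l)) := by
  rw [X_pow_eq_monomial, monomial_mul, one_mul, moment_monomial,
    ← Finset.mul_prod_erase _ _ (Finset.mem_univ i)]
  congr 2
  · simp [add_comm]
  · refine Finset.prod_congr rfl fun l hl => ?_
    simp [Finsupp.single_eq_of_ne (Finset.ne_of_mem_erase hl)]

lemma moment_rename (σ : Equiv.Perm (Fin k)) (Q : MvPolynomial (Fin k) ℝ) :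
    moment k c (rename σ Q) = moment k c Q := by
  induction Q using MvPolynomial.induction_on' with
  | monomial s a =>
    rw [rename_monomial, moment_monomial, moment_monomial, ← Equiv.prod_comp σ]
    simp [Finsupp.mapDomain_apply σ.injective]
  | add p q hp hq => simp only [map_add, hp, hq]

/-- The staircase monomial `∏ u_i ^ i`. -/
noncomputable def staircase (k : ℕ) : MvPolynomial (Fin k) ℝ := ∏ i : Fin k, X i ^ (i : ℕ)

/-- The alternant `det (u_i ^ (d j))`. -/
noncomputable def alternant {k : ℕ} (d : Fin k → ℕ) : MvPolynomial (Fin k) ℝ :=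
  Matrix.det (Matrix.of fun i j : Fin k => (X i : MvPolynomial (Fin k) ℝ) ^ d j)

/-- The Vandermonde determinant of the variables. -/
noncomputable def vdm (k : ℕ) : MvPolynomial (Fin k) ℝ := alternant fun j : Fin k => (j : ℕ)

lemma det_eq_moment_alternant (d : Fin k → ℕ) :
    Matrix.det (Matrix.of fun i j : Fin k => c (i + d j)) =
      moment k c (staircase k * alternant d) := by
  rw [alternant, Matrix.det_apply', Matrix.det_apply', Finset.mul_sum, map_sum]
  refine Finset.sum_congr rfl fun σ _ => ?_
  have h : staircase k * (((Equiv.Perm.sign σ : ℤ) : MvPolynomial (Fin k) ℝ) *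
      ∏ j, (Matrix.of fun i j : Fin k => (X i : MvPolynomial (Fin k) ℝ) ^ d j) (σ j) j) =
      ((Equiv.Perm.sign σ : ℤ) : ℝ) • ∏ i : Fin k, X i ^ ((i : ℕ) + d (σ.symm i)) := by
    have h2 : ∏ j, (Matrix.of fun i j : Fin k => (X i : MvPolynomial (Fin k) ℝ) ^ d j) (σ j) j
        = ∏ i, (X i : MvPolynomial (Fin k) ℝ) ^ d (σ.symm i) := by
      rw [← Equiv.prod_comp σ fun i => (X i : MvPolynomial (Fin k) ℝ) ^ d (σ.symm i)]
      simp
    rw [h2, staircase]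
    simp only [pow_add, Finset.prod_mul_distrib]
    rw [Algebra.smul_def, map_intCast]
    ring
  rw [h, map_smul, moment_prod_X_pow, smul_eq_mul,
    ← Equiv.prod_comp σ fun i => c (i + d (σ.symm i))]
  simp

lemma det_eq_moment_vdm (e : Fin k → ℕ) :
    Matrix.det (Matrix.of fun i j : Fin k => c (e j + i)) =
      moment k c ((∏ j, X j ^ e j) * vdm k) := by
  have hv : vdm k = Matrix.det (Matrix.of fun i j : Fin k =>
      (X j : MvPolynomial (Fin k) ℝ) ^ (i : ℕ)) := by
    rw [vdm, alternant, ← Matrix.det_transpose]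
    rfl
  rw [hv, Matrix.det_apply', Matrix.det_apply', Finset.mul_sum, map_sum]
  refine Finset.sum_congr rfl fun σ _ => ?_
  have h : (∏ j, X j ^ e j) * (((Equiv.Perm.sign σ : ℤ) : MvPolynomial (Fin k) ℝ) *
      ∏ j, (Matrix.of fun i j : Fin k => (X j : MvPolynomial (Fin k) ℝ) ^ (i : ℕ)) (σ j) j) =
      ((Equiv.Perm.sign σ : ℤ) : ℝ) • ∏ j : Fin k, X j ^ (e j + (σ j : ℕ)) := by
    simp only [pow_add, Finset.prod_mul_distrib, Matrix.of_apply]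
    rw [Algebra.smul_def, map_intCast]
    ring
  rw [h, map_smul, moment_prod_X_pow, smul_eq_mul]
  simp

lemma rename_alternant (d : Fin k → ℕ) (σ : Equiv.Perm (Fin k)) :
    rename σ (alternant d) = ((Equiv.Perm.sign σ : ℤ) : MvPolynomial (Fin k) ℝ) * alternant d := by
  rw [alternant, AlgHom.map_det, ← Matrix.det_permute]
  congr 1
  ext1 i j
  simp

/-- Antisymmetrization: on an antisymmetric polynomial, multiplication by the Vandermonde
determinant amounts to `k!` times multiplication by the staircase monomial. -/
lemma moment_mul_vdm {A : MvPolynomial (Fin k) ℝ}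
    (hA : ∀ σ : Equiv.Perm (Fin k),
      rename σ A = ((Equiv.Perm.sign σ : ℤ) : MvPolynomial (Fin k) ℝ) * A) :
    moment k c (A * vdm k) = k.factorial * moment k c (staircase k * A) := by
  have h : A * vdm k = ∑ σ : Equiv.Perm (Fin k), rename σ (staircase k * A) := by
    rw [vdm, alternant, Matrix.det_apply', Finset.mul_sum]
    refine Finset.sum_congr rfl fun σ _ => ?_
    rw [map_mul, hA, staircase, map_prod]
    simp
    ring
  rw [h, map_sum]
  simp only [moment_rename]
  simp [Fintype.card_perm]

end

lemma hasDerivAt_moment {k : ℕ} {c : ℝ → ℕ → ℝ} {c' : ℕ → ℝ} {y : ℝ}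
    (hc : ∀ n, HasDerivAt (fun z => c z n) (c' n) y)
    (A : Fin k → MvPolynomial (Fin k) ℝ →ₗ[ℝ] MvPolynomial (Fin k) ℝ)
    (hA : ∀ (i : Fin k) (s : Fin k →₀ ℕ), moment k (c y) (A i (monomial s 1)) =
      c' (s i) * ∏ l ∈ Finset.univ.erase i, c y (s l)) (Q : MvPolynomial (Fin k) ℝ) :
    HasDerivAt (fun z => moment k (c z) Q) (∑ i, moment k (c y) (A i Q)) y := by
  induction Q using MvPolynomial.induction_on' with
  | monomial s a =>
    simp only [moment_monomial]
    have h := (HasDerivAt.fun_finsetProd (u := Finset.univ) fun i _ => hc (s i)).const_mul a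
    refine h.congr_deriv ?_
    rw [Finset.mul_sum]
    refine Finset.sum_congr rfl fun i _ => ?_
    rw [← mul_one a, ← smul_eq_mul a 1, ← smul_monomial, map_smul, map_smul, hA]
    simp only [smul_eq_mul]
    ring
  | add p q hp hq =>
    simp only [map_add, Finset.sum_add_distrib]
    exact hp.add hq

lemma hasDerivAt_moment_shift {k : ℕ} {c : ℝ → ℕ → ℝ} {y : ℝ} (m : ℕ)
    (hc : ∀ n, HasDerivAt (fun z => c z n) (c y (n + m)) y) (Q : MvPolynomial (Fin k) ℝ) :
    HasDerivAt (fun z => moment k (c z) Q) (moment k (c y) (psum (Fin k) ℝ m * Q)) y := by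
  refine (hasDerivAt_moment hc (fun i => LinearMap.mulLeft ℝ (X i ^ m)) (fun i s => ?_)
    Q).congr_deriv ?_
  · simp [moment_X_pow_mul_monomial]
  · simp [psum, Finset.sum_mul]

/-- The functional with the moments `u ^ n ↦ I_{n+1}(2 √x)`. -/
noncomputable def besselMoment (k : ℕ) (x : ℝ) : MvPolynomial (Fin k) ℝ →ₗ[ℝ] ℝ :=
  moment k fun n => besselI (n + 1) (2 * √x)

/-- The functional with the moments `u ^ n ↦ g_{n+1}(x, t₁, t₂)`. -/
noncomputable def genMoment (k : ℕ) (x t₁ t₂ : ℝ) : MvPolynomial (Fin k) ℝ →ₗ[ℝ] ℝ :=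
  moment k fun n => genBessel (n + 1) x t₁ t₂

lemma genMoment_zero (k : ℕ) {x : ℝ} (hx : 0 ≤ x) : genMoment k x 0 0 = besselMoment k x := by
  simp only [genMoment, besselMoment, genBessel_zero _ hx]

lemma iteratedDeriv_genMoment (k : ℕ) {x : ℝ} (hx : 0 ≤ x) (n₁ n₂ : ℕ)
    (Q : MvPolynomial (Fin k) ℝ) :
    iteratedDeriv n₁ (fun t₁ => iteratedDeriv n₂ (fun t₂ => genMoment k x t₁ t₂ Q) 0) 0 =
      besselMoment k x (psum (Fin k) ℝ 2 ^ n₁ * (psum (Fin k) ℝ 3 ^ n₂ * Q)) := by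
  have h2 : ∀ (t₁ : ℝ) (n : ℕ), iteratedDeriv n (fun t₂ => genMoment k x t₁ t₂ Q) =
      fun t₂ => genMoment k x t₁ t₂ (psum (Fin k) ℝ 3 ^ n * Q) := by
    intro t₁ n
    induction n with
    | zero => simp
    | succ n ih =>
      rw [iteratedDeriv_succ, ih]
      funext t₂
      rw [pow_succ', mul_assoc]
      refine (hasDerivAt_moment_shift 3 (fun n => ?_) _).deriv
      have := hasDerivAt_genBessel_right (n + 1) hx t₁ t₂
      rwa [add_right_comm] at this
  have h1 : ∀ (n : ℕ) (P : MvPolynomial (Fin k) ℝ),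
      iteratedDeriv n (fun t₁ => genMoment k x t₁ 0 P) =
      fun t₁ => genMoment k x t₁ 0 (psum (Fin k) ℝ 2 ^ n * P) := by
    intro n P
    induction n with
    | zero => simp
    | succ n ih =>
      rw [iteratedDeriv_succ, ih]
      funext t₁
      rw [pow_succ', mul_assoc]
      refine (hasDerivAt_moment_shift 2 (fun n => ?_) _).deriv
      have := hasDerivAt_genBessel_left (n + 1) hx t₁ 0
      rwa [add_right_comm] at this
  simp only [h2, h1, genMoment_zero k hx]

lemma pderiv_X_pow_mul_monomial {k : ℕ} (i : Fin k) (n : ℕ) (s : Fin k →₀ ℕ) (a : ℝ) :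
    pderiv i (X i ^ (n + 1) * monomial s a) = X i ^ n * monomial s (a * (s i + n + 1)) := by
  rw [X_pow_eq_monomial, monomial_mul, pderiv_monomial, X_pow_eq_monomial, monomial_mul]
  have h : Finsupp.single i (n + 1) + s - Finsupp.single i 1 = Finsupp.single i n + s := by
    ext l
    by_cases hl : l = i
    · subst hl
      simp
    · simp [Finsupp.single_eq_of_ne hl]
  rw [h]
  congr 1
  simp only [Finsupp.add_apply, Finsupp.single_eq_same]
  push_cast
  ring

/-- Integration by parts: the total derivative of `u_i ^ 2 Q` against the weight
`exp (√x (u + 1/u))`. -/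
lemma besselMoment_pderiv {k : ℕ} {x : ℝ} (hx : 0 < x) (i : Fin k) (Q : MvPolynomial (Fin k) ℝ) :
    besselMoment k x (pderiv i (X i ^ 2 * Q)) =
      √x * besselMoment k x ((1 - X i ^ 2) * Q) := by
  induction Q using MvPolynomial.induction_on' with
  | monomial s a =>
    have e1 := pderiv_X_pow_mul_monomial i 1 s a
    have e2 := moment_X_pow_mul_monomial (fun n => besselI (n + 1) (2 * √x)) i 0 s a
    rw [pow_zero, one_mul] at e2
    rw [show 2 = 1 + 1 from rfl, e1, sub_mul, one_mul, map_sub, besselMoment,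
      moment_X_pow_mul_monomial, e2,
      moment_X_pow_mul_monomial]
    have h := besselI_recurrence (s i + 1) hx
    push_cast at h
    rw [show s i + 2 + 1 = s i + 1 + 2 by ring]
    simp only [add_zero]
    linear_combination (-a * ∏ l ∈ Finset.univ.erase i, besselI (s l + 1) (2 * √x)) * h
  | add p q hp hq =>
    simp only [mul_add, map_add, hp, hq]

lemma hasDerivAt_besselMoment {k : ℕ} {x : ℝ} (hx : 0 < x) (Q : MvPolynomial (Fin k) ℝ) :
    HasDerivAt (fun y => besselMoment k y Q)
      (besselMoment k x (psum (Fin k) ℝ 1 * Q) / √x +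
        1 / (2 * x) * besselMoment k x (∑ i, pderiv i (X i * Q))) x := by
  have h := hasDerivAt_moment (k := k) (c := fun y n => besselI (n + 1) (2 * √y))
    (fun n => hasDerivAt_besselI (n + 1) hx)
    (fun i => (√x)⁻¹ • LinearMap.mulLeft ℝ (X i) +
      (1 / (2 * x)) • (pderiv i).toLinearMap.comp (LinearMap.mulLeft ℝ (X i))) (fun i s => ?_) Q
  · refine h.congr_deriv ?_
    simp only [LinearMap.add_apply, LinearMap.smul_apply, map_add, map_smul, LinearMap.comp_apply,
      LinearMap.mulLeft_apply, Finset.sum_add_distrib, smul_eq_mul, ← Finset.mul_sum, ← map_sum,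
      psum, pow_one, ← Finset.sum_mul, besselMoment,
      Derivation.coeFn_coe]
    ring
  · have e0 := moment_X_pow_mul_monomial (fun n => besselI (n + 1) (2 * √x)) i 1 s 1
    have e1 := pderiv_X_pow_mul_monomial i 0 s 1
    have e2 := moment_X_pow_mul_monomial (fun n => besselI (n + 1) (2 * √x)) i 0 s
      (1 * (s i + (0 : ℕ) + 1))
    rw [← e1, zero_add] at e2
    rw [pow_one] at e0 e2
    simp only [LinearMap.add_apply, LinearMap.smul_apply, map_add, map_smul, LinearMap.comp_apply,
      LinearMap.mulLeft_apply, smul_eq_mul, Derivation.coeFn_coe, e0, e2]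
    push_cast
    rw [show s i + 1 + 1 = s i + 2 by ring]
    simp only [add_zero]
    ring

lemma contDiffOn_besselMoment {k : ℕ} (Q : MvPolynomial (Fin k) ℝ) :
    ContDiffOn ℝ ∞ (fun y => besselMoment k y Q) (Set.Ioi 0) := by
  induction Q using MvPolynomial.induction_on' with
  | monomial s a =>
    simp only [besselMoment, moment_monomial]
    exact contDiffOn_const.mul (contDiffOn_prod fun i _ => contDiffOn_besselI _)
  | add p q hp hq =>
    simp only [map_add]
    exact hp.add hq

/-! ### Elementary and complete symmetric polynomials -/

/-- Logarithmic differentiation of a finite product, with a common denominator `g`. -/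
lemma derivation_prod {A ι : Type*} [CommRing A] [Algebra ℝ A] (D : Derivation ℝ A A) (g : A)
    (s : Finset ι) (f K : ι → A) (h : ∀ i ∈ s, g * D (f i) = K i * f i) :
    g * D (∏ i ∈ s, f i) = (∑ i ∈ s, K i) * ∏ i ∈ s, f i := by
  classical
  induction s using Finset.induction_on with
  | empty => simp
  | insert a s ha ih =>
    rw [Finset.prod_insert ha, Finset.sum_insert ha, D.leibniz, smul_eq_mul, smul_eq_mul]
    have h1 := h a (Finset.mem_insert_self a s)
    have h2 := ih fun i hi => h i (Finset.mem_insert_of_mem hi)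
    linear_combination (∏ i ∈ s, f i) * h1 + f a * h2

/-- A derivation of the ring of coefficients, applied to a power series coefficientwise. -/
noncomputable def coeffDerivation {A : Type*} [CommRing A] [Algebra ℝ A]
    (δ : Derivation ℝ A A) : Derivation ℝ (PowerSeries A) (PowerSeries A) :=
  Derivation.mk'
    { toFun := fun φ => PowerSeries.mk fun n => δ (PowerSeries.coeff n φ)
      map_add' := fun φ ψ => by ext n; simp
      map_smul' := fun r φ => by ext n; simp }
    fun φ ψ => by
      rw [smul_eq_mul, smul_eq_mul, mul_comm ψ]
      ext n
      simp only [LinearMap.coe_mk, AddHom.coe_mk, PowerSeries.coeff_mk, map_add,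
        PowerSeries.coeff_mul, map_sum, Derivation.leibniz, smul_eq_mul, Finset.sum_add_distrib]
      congr 1
      exact Finset.sum_congr rfl fun _ _ => mul_comm _ _

lemma coeff_coeffDerivation {A : Type*} [CommRing A] [Algebra ℝ A] (δ : Derivation ℝ A A)
    (n : ℕ) (φ : PowerSeries A) :
    PowerSeries.coeff n (coeffDerivation δ φ) = δ (PowerSeries.coeff n φ) := by
  simp [coeffDerivation]

lemma coeffDerivation_C {A : Type*} [CommRing A] [Algebra ℝ A] (δ : Derivation ℝ A A)
    (a : A) : coeffDerivation δ (PowerSeries.C a) = PowerSeries.C (δ a) := by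
  ext n
  rw [coeff_coeffDerivation, PowerSeries.coeff_C, PowerSeries.coeff_C]
  split_ifs <;> simp

lemma coeffDerivation_X {A : Type*} [CommRing A] [Algebra ℝ A] (δ : Derivation ℝ A A) :
    coeffDerivation δ (PowerSeries.X : PowerSeries A) = 0 := by
  ext n
  rw [coeff_coeffDerivation, PowerSeries.coeff_X]
  split_ifs <;> simp

/-- The derivation `∑ u_i ∂_i`, which multiplies a homogeneous polynomial by its degree. -/
noncomputable def euler (k : ℕ) : Derivation ℝ (MvPolynomial (Fin k) ℝ) (MvPolynomial (Fin k) ℝ) :=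
  mkDerivation ℝ X

/-- The generating series `∏ (1 + u_i T)`. -/
noncomputable def elemSeries (k : ℕ) : PowerSeries (MvPolynomial (Fin k) ℝ) :=
  ∏ i : Fin k, (1 + PowerSeries.C (X i) * PowerSeries.X)

/-- The generating series `∏ (1 - u_i T)⁻¹`. -/
noncomputable def compSeries (k : ℕ) : PowerSeries (MvPolynomial (Fin k) ℝ) :=
  ∏ i : Fin k, PowerSeries.mk fun n => X i ^ n

/-- The elementary symmetric polynomial of degree `r`. -/
noncomputable def elem (k r : ℕ) : MvPolynomial (Fin k) ℝ := PowerSeries.coeff r (elemSeries k)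

/-- The complete homogeneous symmetric polynomial of degree `p`. -/
noncomputable def comp (k p : ℕ) : MvPolynomial (Fin k) ℝ := PowerSeries.coeff p (compSeries k)

section

variable {k : ℕ}

lemma one_sub_mul_geom (u : MvPolynomial (Fin k) ℝ) :
    (1 - PowerSeries.C u * PowerSeries.X) * PowerSeries.mk (fun n => u ^ n) = 1 := by
  ext n
  rw [sub_mul, one_mul, mul_assoc, map_sub, PowerSeries.coeff_C_mul]
  rcases n with _ | n
  · simp
  · simp [PowerSeries.coeff_succ_X_mul, PowerSeries.coeff_one, pow_succ']

lemma elem_zero : elem k 0 = 1 := by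
  simp [elem, elemSeries, map_prod]

lemma comp_zero : comp k 0 = 1 := by
  simp [comp, compSeries, map_prod]

lemma pderiv_elemSeries (i : Fin k) :
    (1 + PowerSeries.C (X i) * PowerSeries.X) * coeffDerivation (pderiv i) (elemSeries k) =
      PowerSeries.X * elemSeries k := by
  rw [elemSeries, derivation_prod _ _ _ _ fun l => if l = i then PowerSeries.X else 0]
  · simp
  · intro l _
    rw [map_add, Derivation.map_one_eq_zero, Derivation.leibniz, coeffDerivation_X,
      coeffDerivation_C]
    split_ifs with hl
    · subst hl
      simp
      ring
    · simp [pderiv_X_of_ne hl]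

lemma pderiv_compSeries (i : Fin k) :
    (1 - PowerSeries.C (X i) * PowerSeries.X) * coeffDerivation (pderiv i) (compSeries k) =
      PowerSeries.X * compSeries k := by
  rw [compSeries, derivation_prod _ _ _ _ fun l => if l = i then PowerSeries.X else 0]
  · simp
  · intro l _
    split_ifs with hl
    · subst hl
      have h := congrArg (coeffDerivation (pderiv l)) (one_sub_mul_geom (X l))
      rw [Derivation.leibniz, Derivation.map_one_eq_zero, map_sub, Derivation.map_one_eq_zero,
        Derivation.leibniz, coeffDerivation_X, coeffDerivation_C, pderiv_X_self] at h
      simp only [smul_eq_mul, mul_zero, map_one, mul_one, zero_add, zero_sub] at h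
      linear_combination h
    · have h : coeffDerivation (pderiv i)
          (PowerSeries.mk fun n => (X l : MvPolynomial (Fin k) ℝ) ^ n) = 0 := by
        ext1 n
        rw [coeff_coeffDerivation, PowerSeries.coeff_mk, pderiv_pow, pderiv_X_of_ne hl]
        simp
      rw [h]
      simp

lemma pderiv_elem_succ (i : Fin k) (r : ℕ) :
    pderiv i (elem k (r + 1)) = elem k r - X i * pderiv i (elem k r) := by
  have h := congrArg (PowerSeries.coeff (r + 1)) (pderiv_elemSeries i)
  rw [add_mul, one_mul, mul_assoc, map_add, PowerSeries.coeff_C_mul,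
    PowerSeries.coeff_succ_X_mul, PowerSeries.coeff_succ_X_mul, coeff_coeffDerivation,
    coeff_coeffDerivation] at h
  exact eq_sub_of_add_eq h

lemma pderiv_comp_succ (i : Fin k) (p : ℕ) :
    pderiv i (comp k (p + 1)) = comp k p + X i * pderiv i (comp k p) := by
  have h := congrArg (PowerSeries.coeff (p + 1)) (pderiv_compSeries i)
  rw [sub_mul, one_mul, mul_assoc, map_sub, PowerSeries.coeff_C_mul,
    PowerSeries.coeff_succ_X_mul, PowerSeries.coeff_succ_X_mul, coeff_coeffDerivation,
    coeff_coeffDerivation] at h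
  exact sub_eq_iff_eq_add.1 h

lemma euler_coeff_prod (f : Fin k → PowerSeries (MvPolynomial (Fin k) ℝ))
    (hf : ∀ i, coeffDerivation (euler k) (f i) =
      PowerSeries.X * PowerSeries.derivative (MvPolynomial (Fin k) ℝ) (f i)) (n : ℕ) :
    euler k (PowerSeries.coeff n (∏ i, f i)) = n * PowerSeries.coeff n (∏ i, f i) := by
  have h : coeffDerivation (euler k) (∏ i, f i) =
      PowerSeries.X * PowerSeries.derivative (MvPolynomial (Fin k) ℝ) (∏ i, f i) := by
    refine Finset.prod_induction _ (fun φ => coeffDerivation (euler k) φ =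
      PowerSeries.X * PowerSeries.derivative (MvPolynomial (Fin k) ℝ) φ)
      (fun a b ha hb => ?_) ?_ fun i _ => hf i
    · simp only [Derivation.leibniz, ha, hb, smul_eq_mul]
      ring
    · simp only [Derivation.map_one_eq_zero, mul_zero]
  have h' := congrArg (PowerSeries.coeff n) h
  rw [coeff_coeffDerivation] at h'
  rw [h']
  rcases n with _ | n
  · simp
  · rw [PowerSeries.coeff_succ_X_mul, PowerSeries.coeff_derivative]
    push_cast
    ring

lemma euler_X (i : Fin k) : euler k (X i) = X i := mkDerivation_X ..

lemma euler_elem (r : ℕ) : euler k (elem k r) = r * elem k r := by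
  refine euler_coeff_prod _ (fun i => ?_) r
  rw [map_add, Derivation.map_one_eq_zero, Derivation.leibniz, coeffDerivation_X,
    coeffDerivation_C, euler_X, map_add, Derivation.map_one_eq_zero, Derivation.leibniz,
    PowerSeries.derivative_X, PowerSeries.derivative_C]
  simp [mul_comm]

lemma euler_comp (p : ℕ) : euler k (comp k p) = p * comp k p := by
  refine euler_coeff_prod _ (fun i => ?_) p
  ext1 n
  rw [coeff_coeffDerivation, PowerSeries.coeff_mk, Derivation.leibniz_pow, euler_X]
  rcases n with _ | n
  · simp
  · rw [PowerSeries.coeff_succ_X_mul, PowerSeries.coeff_derivative, PowerSeries.coeff_mk]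
    simp [pow_succ]
    ring

lemma mkDerivation_eq_sum (V : Fin k → MvPolynomial (Fin k) ℝ) (Q : MvPolynomial (Fin k) ℝ) :
    mkDerivation ℝ V Q = ∑ i, V i * pderiv i Q := by
  have hs : ∀ P, (∑ i, V i • pderiv i : Derivation ℝ (MvPolynomial (Fin k) ℝ)
      (MvPolynomial (Fin k) ℝ)) P = ∑ i, V i * pderiv i P := fun P => by
    rw [← Derivation.coeFnAddMonoidHom_apply, map_sum, Finset.sum_apply]
    simp
  have h : mkDerivation ℝ V = ∑ i, V i • pderiv i := by
    refine derivation_ext fun l => ?_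
    rw [mkDerivation_X, hs]
    simp [pderiv_X, Pi.single_apply]
  rw [h, hs]

lemma sum_X_mul_pderiv_elem (r : ℕ) :
    ∑ i : Fin k, X i * pderiv i (elem k r) = r * elem k r := by
  rw [← mkDerivation_eq_sum]
  exact euler_elem r

lemma sum_X_mul_pderiv_comp (p : ℕ) :
    ∑ i : Fin k, X i * pderiv i (comp k p) = p * comp k p := by
  rw [← mkDerivation_eq_sum]
  exact euler_comp p

lemma elem_eq_zero {r : ℕ} (hr : k < r) : elem k r = 0 := by
  have h : ∀ (s : Finset (Fin k)) (r : ℕ), s.card < r → PowerSeries.coeff r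
      (∏ i ∈ s, (1 + PowerSeries.C (X i : MvPolynomial (Fin k) ℝ) * PowerSeries.X)) = 0 := by
    intro s
    induction s using Finset.induction_on with
    | empty =>
      intro r hr
      rw [Finset.prod_empty, PowerSeries.coeff_one, if_neg]
      simp at hr
      omega
    | insert a s ha ih =>
      intro r hr
      rw [Finset.card_insert_of_notMem ha] at hr
      obtain ⟨r, rfl⟩ : ∃ r', r = r' + 1 := ⟨r - 1, by omega⟩
      rw [Finset.prod_insert ha, add_mul, one_mul, mul_assoc, map_add, PowerSeries.coeff_C_mul,
        PowerSeries.coeff_succ_X_mul, ih _ (by omega), ih _ (by omega)]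
      simp
  exact h Finset.univ r (by simpa using hr)

lemma sum_elem_mul_comp {n : ℕ} (hn : n ≠ 0) :
    ∑ i ∈ Finset.range (n + 1), (-1) ^ i * elem k i * comp k (n - i) = 0 := by
  have h : PowerSeries.rescale (-1) (elemSeries k) * compSeries k = 1 := by
    rw [elemSeries, compSeries, map_prod, ← Finset.prod_mul_distrib]
    refine Finset.prod_eq_one fun i _ => ?_
    refine Eq.trans ?_ (one_sub_mul_geom (X i))
    rw [map_add, map_one, map_mul, PowerSeries.rescale_neg_one_X]
    congr 1
    have : PowerSeries.rescale (-1) (PowerSeries.C (X i : MvPolynomial (Fin k) ℝ)) =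
        PowerSeries.C (X i) := by
      ext1 n
      rw [PowerSeries.coeff_rescale, PowerSeries.coeff_C]
      split_ifs with h0 <;> simp [h0]
    rw [this]
    ring
  have h' := congrArg (PowerSeries.coeff n) h
  rw [PowerSeries.coeff_mul, PowerSeries.coeff_one, if_neg hn,
    Finset.Nat.sum_antidiagonal_eq_sum_range_succ_mk] at h'
  simpa only [PowerSeries.coeff_rescale, elem, comp] using h'

/-! ### Hook Schur polynomials -/

variable (k) in
/-- The Schur polynomial of the hook with arm `a` and leg `b`, that is of the partition
`(a + 1, 1, …, 1)` with `b` ones, defined through the Pieri rule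
`e_{b+1} h_{a+1} = s_{(a|b+1)} + s_{(a+1|b)}`. -/
noncomputable def hookSym : ℕ → ℕ → MvPolynomial (Fin k) ℝ
  | a, 0 => comp k (a + 1)
  | a, b + 1 => elem k (b + 1) * comp k (a + 1) - hookSym (a + 1) b

lemma hookSym_zero_right (a : ℕ) : hookSym k a 0 = comp k (a + 1) := by rw [hookSym]

lemma elem_mul_comp (a b : ℕ) :
    elem k (b + 1) * comp k (a + 1) = hookSym k a (b + 1) + hookSym k (a + 1) b := by
  rw [hookSym]
  ring

lemma hookSym_eq_sum (a b : ℕ) : hookSym k a b =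
    (-1) ^ b * ∑ i ∈ Finset.range (b + 1), (-1) ^ i * elem k i * comp k (a + 1 + b - i) := by
  induction b generalizing a with
  | zero => simp [hookSym, elem_zero]
  | succ b ih =>
    rw [hookSym, ih, Finset.sum_range_succ _ (b + 1), pow_succ]
    have h1 : a + 1 + (b + 1) - (b + 1) = a + 1 := by omega
    have h2 : ((-1 : MvPolynomial (Fin k) ℝ) ^ b) * (-1) ^ b = 1 := by
      rw [← mul_pow]
      simp
    rw [h1, show a + 1 + 1 + b = a + 1 + (b + 1) by ring]
    linear_combination (-elem k (b + 1) * comp k (a + 1)) * h2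

lemma hookSym_zero_left (b : ℕ) : hookSym k 0 b = elem k (b + 1) := by
  have h := sum_elem_mul_comp (k := k) (Nat.succ_ne_zero b)
  rw [Finset.sum_range_succ, Nat.sub_self, comp_zero, pow_succ] at h
  have h2 : ((-1 : MvPolynomial (Fin k) ℝ) ^ b) * (-1) ^ b = 1 := by
    rw [← mul_pow]
    simp
  rw [hookSym_eq_sum, zero_add, add_comm 1 b]
  linear_combination (-1) ^ b * h + elem k (b + 1) * h2

lemma hookSym_eq_zero (a : ℕ) {b : ℕ} (hb : k ≤ b) : hookSym k a b = 0 := by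
  induction a generalizing b with
  | zero => rw [hookSym_zero_left, elem_eq_zero (by omega)]
  | succ a ih =>
    have h := elem_mul_comp (k := k) a b
    rw [ih (by omega), elem_eq_zero (by omega)] at h
    simpa using h.symm

lemma sum_elem_mul_X_pow (i : Fin k) (n : ℕ) :
    ∑ b ∈ Finset.range (n + 1), (-1) ^ b * elem k b * X i ^ (n - b) =
      (-1) ^ n * pderiv i (elem k (n + 1)) := by
  induction n with
  | zero => simp [pderiv_elem_succ, elem_zero]
  | succ n ih =>
    rw [Finset.sum_range_succ, Nat.sub_self, pderiv_elem_succ i (n + 1)]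
    have h : ∑ b ∈ Finset.range (n + 1), (-1) ^ b * elem k b * X i ^ (n + 1 - b) =
        X i * ∑ b ∈ Finset.range (n + 1), (-1) ^ b * elem k b * X i ^ (n - b) := by
      rw [Finset.mul_sum]
      refine Finset.sum_congr rfl fun b hb => ?_
      rw [Nat.succ_sub (Nat.lt_succ_iff.1 (Finset.mem_range.1 hb)), pow_succ]
      ring
    rw [h, ih]
    ring

/-- Reduction of a power of a variable modulo `∏ (T - u_l)`: up to sign, the coefficients are hook
Schur polynomials. -/
lemma X_pow_eq_sum_hookSym (i : Fin k) (a : ℕ) :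
    X i ^ (k + a) = ∑ b ∈ Finset.range k, (-1) ^ b * hookSym k a b * X i ^ (k - 1 - b) := by
  have h0 : (X i : MvPolynomial (Fin k) ℝ) ^ k =
      ∑ b ∈ Finset.range k, (-1) ^ b * elem k (b + 1) * X i ^ (k - 1 - b) := by
    have h := sum_elem_mul_X_pow i k
    rw [elem_eq_zero (Nat.lt_succ_self k), map_zero, mul_zero, Finset.sum_range_succ'] at h
    simp only [pow_zero, elem_zero, one_mul, Nat.sub_zero] at h
    rw [eq_neg_of_add_eq_zero_right h, ← Finset.sum_neg_distrib]
    refine Finset.sum_congr rfl fun b _ => ?_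
    rw [pow_succ, show k - (b + 1) = k - 1 - b by omega]
    ring
  induction a with
  | zero => simpa only [hookSym_zero_left, add_zero] using h0
  | succ a ih =>
    obtain ⟨n, rfl⟩ : ∃ n, k = n + 1 := ⟨k - 1, by have := i.pos; omega⟩
    have e1 : (X i : MvPolynomial (Fin (n + 1)) ℝ) ^ (n + 1 + (a + 1)) =
        ∑ b ∈ Finset.range (n + 1), (-1) ^ b * hookSym (n + 1) a b * X i ^ (n + 1 - b) := by
      rw [← add_assoc, pow_succ, ih, Finset.sum_mul]
      refine Finset.sum_congr rfl fun b hb => ?_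
      rw [show n + 1 - b = n + 1 - 1 - b + 1 by have := Finset.mem_range.1 hb; omega, pow_succ]
      ring
    have e2 : ∑ b ∈ Finset.range (n + 1), (-1) ^ (b + 1) * hookSym (n + 1) a (b + 1) *
        (X i : MvPolynomial (Fin (n + 1)) ℝ) ^ (n + 1 - (b + 1)) =
        ∑ b ∈ Finset.range n, (-1) ^ (b + 1) * hookSym (n + 1) a (b + 1) *
          X i ^ (n + 1 - (b + 1)) := by
      rw [Finset.sum_range_succ, hookSym_eq_zero a le_rfl]
      simp
    rw [e1, Finset.sum_range_succ', ← e2, pow_zero, one_mul, Nat.sub_zero, h0,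
      hookSym_zero_right, Finset.mul_sum, ← Finset.sum_add_distrib]
    refine Finset.sum_congr rfl fun b _ => ?_
    have h := elem_mul_comp (k := n + 1) a b
    rw [show n + 1 - (b + 1) = n + 1 - 1 - b by omega, pow_succ]
    linear_combination ((-1) ^ b * X i ^ (n + 1 - 1 - b)) * h

lemma sum_X_mul_pderiv_mul_pderiv (a b : ℕ) :
    ∑ i : Fin k, X i * pderiv i (elem k (b + 1)) * pderiv i (comp k (a + 1)) =
      ((a : MvPolynomial (Fin k) ℝ) + b + 1) * hookSym k a b := by
  induction b generalizing a with
  | zero =>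
    have h := sum_X_mul_pderiv_comp (k := k) (a + 1)
    simp only [pderiv_elem_succ, elem_zero, Derivation.map_one_eq_zero, mul_zero, sub_zero,
      mul_one, hookSym_zero_right, h]
    push_cast
    ring
  | succ b ih =>
    have e1 := sum_X_mul_pderiv_elem (k := k) (b + 1)
    have e2 := sum_X_mul_pderiv_comp (k := k) (a + 1)
    have e3 := ih (a + 1)
    have h : ∀ i : Fin k,
        X i * pderiv i (elem k (b + 1 + 1)) * pderiv i (comp k (a + 1)) +
          X i * pderiv i (elem k (b + 1)) * pderiv i (comp k (a + 1 + 1)) =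
        elem k (b + 1) * (X i * pderiv i (comp k (a + 1))) +
          comp k (a + 1) * (X i * pderiv i (elem k (b + 1))) := fun i => by
      rw [pderiv_elem_succ i (b + 1), pderiv_comp_succ i (a + 1)]
      ring
    have hs := Finset.sum_congr (rfl : (Finset.univ : Finset (Fin k)) = _) fun i _ => h i
    rw [Finset.sum_add_distrib, Finset.sum_add_distrib, ← Finset.mul_sum, ← Finset.mul_sum, e1,
      e2, e3] at hs
    have hp := elem_mul_comp (k := k) a b
    push_cast at hs ⊢
    linear_combination hs + ((a : MvPolynomial (Fin k) ℝ) + b + 2) * hp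

lemma sum_X_sq_mul_pderiv_mul_pderiv (a b : ℕ) :
    ∑ i : Fin k, X i ^ 2 * pderiv i (elem k b) * pderiv i (comp k (a + 1)) =
      ((a : MvPolynomial (Fin k) ℝ) + 1) * (elem k b * comp k (a + 1)) -
        ((a : MvPolynomial (Fin k) ℝ) + b + 1) * hookSym k a b := by
  have e2 := sum_X_mul_pderiv_comp (k := k) (a + 1)
  have h : ∀ i : Fin k, X i ^ 2 * pderiv i (elem k b) * pderiv i (comp k (a + 1)) =
      elem k b * (X i * pderiv i (comp k (a + 1))) -
        X i * pderiv i (elem k (b + 1)) * pderiv i (comp k (a + 1)) := fun i => by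
    rw [pderiv_elem_succ i b]
    ring
  rw [Finset.sum_congr rfl fun i _ => h i, Finset.sum_sub_distrib, ← Finset.mul_sum, e2,
    sum_X_mul_pderiv_mul_pderiv]
  push_cast
  ring

/-! ### Power sums against derivatives of elementary symmetric polynomials -/

lemma sum_pderiv_elem_succ (r : ℕ) :
    ∑ i : Fin k, pderiv i (elem k (r + 1)) = ((k : MvPolynomial (Fin k) ℝ) - r) * elem k r := by
  simp only [pderiv_elem_succ, Finset.sum_sub_distrib, sum_X_mul_pderiv_elem]
  simp
  ring

lemma sum_X_pow_succ_mul_pderiv_elem (n r : ℕ) :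
    ∑ i : Fin k, X i ^ (n + 1) * pderiv i (elem k r) =
      psum (Fin k) ℝ n * elem k r - ∑ i : Fin k, X i ^ n * pderiv i (elem k (r + 1)) := by
  rw [psum, Finset.sum_mul, ← Finset.sum_sub_distrib]
  refine Finset.sum_congr rfl fun i _ => ?_
  rw [pderiv_elem_succ]
  ring

lemma sum_X_sq_mul_pderiv_elem (r : ℕ) :
    ∑ i : Fin k, X i ^ 2 * pderiv i (elem k r) =
      psum (Fin k) ℝ 1 * elem k r - ((r : MvPolynomial (Fin k) ℝ) + 1) * elem k (r + 1) := by
  rw [sum_X_pow_succ_mul_pderiv_elem]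
  simp only [pow_one, sum_X_mul_pderiv_elem]
  push_cast
  ring

lemma sum_X_cube_mul_pderiv_elem (r : ℕ) :
    ∑ i : Fin k, X i ^ 3 * pderiv i (elem k r) =
      psum (Fin k) ℝ 2 * elem k r - psum (Fin k) ℝ 1 * elem k (r + 1) +
        ((r : MvPolynomial (Fin k) ℝ) + 2) * elem k (r + 2) := by
  rw [sum_X_pow_succ_mul_pderiv_elem, sum_X_sq_mul_pderiv_elem]
  push_cast
  ring

lemma sum_X_pow_four_mul_pderiv_elem (r : ℕ) :
    ∑ i : Fin k, X i ^ 4 * pderiv i (elem k r) =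
      psum (Fin k) ℝ 3 * elem k r - psum (Fin k) ℝ 2 * elem k (r + 1) +
        psum (Fin k) ℝ 1 * elem k (r + 2) -
        ((r : MvPolynomial (Fin k) ℝ) + 3) * elem k (r + 3) := by
  rw [sum_X_pow_succ_mul_pderiv_elem, sum_X_cube_mul_pderiv_elem]
  push_cast
  ring

lemma pderiv_pderiv_elem_self (i : Fin k) (r : ℕ) : pderiv i (pderiv i (elem k r)) = 0 := by
  induction r with
  | zero => simp [elem_zero]
  | succ r ih =>
    rw [pderiv_elem_succ, map_sub, pderiv_mul, pderiv_X_self, ih]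
    ring

lemma pderiv_comm (i l : Fin k) (Q : MvPolynomial (Fin k) ℝ) :
    pderiv i (pderiv l Q) = pderiv l (pderiv i Q) := by
  have h : ⁅(pderiv i : Derivation ℝ (MvPolynomial (Fin k) ℝ) (MvPolynomial (Fin k) ℝ)),
      (pderiv l : Derivation ℝ (MvPolynomial (Fin k) ℝ) (MvPolynomial (Fin k) ℝ))⁆ = 0 := by
    refine derivation_ext fun j => ?_
    rw [Derivation.commutator_apply, pderiv_X, pderiv_X]
    simp only [Pi.single_apply]
    split_ifs <;> simp
  have h' := congrArg
    (fun D : Derivation ℝ (MvPolynomial (Fin k) ℝ) (MvPolynomial (Fin k) ℝ) => D Q) h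
  simp only [Derivation.commutator_apply, Derivation.coe_zero, Pi.zero_apply] at h'
  exact sub_eq_zero.1 h'

lemma sub_mul_pderiv_pderiv_elem {i l : Fin k} (hil : i ≠ l) (r : ℕ) :
    (X i - X l) * pderiv l (pderiv i (elem k r)) = pderiv l (elem k r) - pderiv i (elem k r) := by
  have h1 := congrArg (pderiv l) (pderiv_elem_succ i r)
  have h2 := congrArg (pderiv i) (pderiv_elem_succ l r)
  rw [map_sub, pderiv_mul, pderiv_X_of_ne hil] at h1
  rw [map_sub, pderiv_mul, pderiv_X_of_ne hil.symm, pderiv_comm i l, pderiv_comm i l] at h2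
  linear_combination h1 - h2

/-- The divided difference of the vector field `u_i ^ 2 ∂_i e_r`. -/
lemma X_sq_mul_pderiv_elem_sub {i l : Fin k} (hil : i ≠ l) (r : ℕ) :
    X i ^ 2 * pderiv i (elem k r) - X l ^ 2 * pderiv l (elem k r) =
      (elem k r - pderiv l (pderiv i (elem k (r + 2)))) * (X i - X l) := by
  have h := sub_mul_pderiv_pderiv_elem hil (r + 2)
  have h1 := pderiv_elem_succ i (r + 1)
  have h2 := pderiv_elem_succ l (r + 1)
  have h3 := pderiv_elem_succ i r
  have h4 := pderiv_elem_succ l r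
  linear_combination h - h1 + h2 + X i * h3 - X l * h4

lemma sum_sum_pderiv_pderiv_elem (r : ℕ) :
    ∑ i : Fin k, ∑ l : Fin k, pderiv l (pderiv i (elem k (r + 2))) =
      ((k : MvPolynomial (Fin k) ℝ) - r) * ((k : MvPolynomial (Fin k) ℝ) - r - 1) * elem k r := by
  rw [Finset.sum_comm]
  simp only [← map_sum, sum_pderiv_elem_succ]
  have h : ((k : MvPolynomial (Fin k) ℝ) - ((r + 1 : ℕ) : MvPolynomial (Fin k) ℝ)) =
      C ((k : ℝ) - (r + 1)) := by simp
  simp only [h, pderiv_C_mul, ← Finset.mul_sum, sum_pderiv_elem_succ]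
  simp
  ring

lemma vdm_eq_prod : vdm k = ∏ i : Fin k, ∏ j ∈ Finset.Ioi i, (X j - X i) :=
  Matrix.det_vandermonde X

/-- A vector field with divided differences `K i j` multiplies the squared Vandermonde determinant
by `∑_{i ≠ j} K i j`. -/
lemma mkDerivation_vdm_sq (V : Fin k → MvPolynomial (Fin k) ℝ)
    (K : Fin k → Fin k → MvPolynomial (Fin k) ℝ)
    (h : ∀ i j, i ≠ j → V j - V i = K j i * (X j - X i)) :
    mkDerivation ℝ V (vdm k ^ 2) =
      (∑ i, ∑ j ∈ ({i}ᶜ : Finset (Fin k)), K j i) * vdm k ^ 2 := by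
  have hV : ∀ i j, i ≠ j → K i j = K j i := fun i j hij => by
    have h1 := h i j hij
    have h2 := h j i hij.symm
    have h3 : (X j - X i : MvPolynomial (Fin k) ℝ) ≠ 0 :=
      sub_ne_zero.2 fun hc => hij (X_injective hc).symm
    exact mul_right_cancel₀ h3 (by linear_combination h1 + h2)
  have h1 : mkDerivation ℝ V (vdm k) = (∑ i, ∑ j ∈ Finset.Ioi i, K j i) * vdm k := by
    rw [vdm_eq_prod]
    have := derivation_prod (mkDerivation ℝ V) 1 Finset.univ
      (fun i : Fin k => ∏ j ∈ Finset.Ioi i, (X j - X i)) (fun i => ∑ j ∈ Finset.Ioi i, K j i)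
      fun i _ => derivation_prod _ _ _ _ _ fun j hj => by
        rw [map_sub, mkDerivation_X, mkDerivation_X, one_mul,
          h i j (ne_of_lt (Finset.mem_Ioi.1 hj))]
    rwa [one_mul] at this
  rw [← Finset.sum_sum_Ioi_add_eq_sum_sum_off_diag, Derivation.leibniz_pow, h1]
  have h2 : ∑ i, ∑ j ∈ Finset.Ioi i, (K j i + K i j) = 2 * ∑ i, ∑ j ∈ Finset.Ioi i, K j i := by
    rw [Finset.mul_sum]
    refine Finset.sum_congr rfl fun i _ => ?_
    rw [Finset.mul_sum]
    refine Finset.sum_congr rfl fun j hj => ?_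
    rw [hV i j (ne_of_lt (Finset.mem_Ioi.1 hj))]
    ring
  rw [h2]
  simp
  ring

lemma mkDerivation_elem_vdm_sq (r : ℕ) :
    mkDerivation ℝ (fun i : Fin k => X i ^ 2 * pderiv i (elem k r)) (vdm k ^ 2) =
      (2 * (k : MvPolynomial (Fin k) ℝ) * r - r ^ 2 - r) * elem k r * vdm k ^ 2 := by
  rw [mkDerivation_vdm_sq _ (fun j i => elem k r - pderiv i (pderiv j (elem k (r + 2))))
    fun i j hij => X_sq_mul_pderiv_elem_sub hij.symm r]
  congr 1
  have h : ∀ i : Fin k, ∑ j ∈ ({i}ᶜ : Finset (Fin k)),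
      (elem k r - pderiv i (pderiv j (elem k (r + 2)))) =
      ((k : MvPolynomial (Fin k) ℝ) - 1) * elem k r -
        ∑ j, pderiv i (pderiv j (elem k (r + 2))) := fun i => by
    have hs := Finset.sum_compl_add_sum ({i} : Finset (Fin k))
      fun j => elem k r - pderiv i (pderiv j (elem k (r + 2)))
    have hu : ∑ j, (elem k r - pderiv i (pderiv j (elem k (r + 2)))) =
        (k : MvPolynomial (Fin k) ℝ) * elem k r - ∑ j, pderiv i (pderiv j (elem k (r + 2))) := by
      simp [Finset.sum_sub_distrib]
    rw [Finset.sum_singleton, pderiv_pderiv_elem_self, hu] at hs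
    linear_combination hs
  rw [Finset.sum_congr rfl fun i _ => h i, Finset.sum_sub_distrib, Finset.sum_comm,
    sum_sum_pderiv_pderiv_elem]
  simp
  ring

end

/-! ### Alternants of hook shape -/

section

variable {k : ℕ}

lemma derivation_prod_erase {A ι : Type*} [CommRing A] [Algebra ℝ A] [DecidableEq ι]
    (D : Derivation ℝ A A) (s : Finset ι) (f : ι → A) :
    D (∏ i ∈ s, f i) = ∑ i ∈ s, D (f i) * ∏ j ∈ s.erase i, f j := by
  induction s using Finset.induction_on with
  | empty => simp
  | insert a s ha ih =>
    rw [Finset.prod_insert ha, Finset.sum_insert ha, D.leibniz, ih, Finset.erase_insert ha,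
      smul_eq_mul, smul_eq_mul, Finset.mul_sum, add_comm, mul_comm]
    congr 1
    refine Finset.sum_congr rfl fun i hi => ?_
    have hia : a ≠ i := fun h => ha (h ▸ hi)
    rw [Finset.erase_insert_of_ne hia, Finset.prod_insert
      fun h => ha (Finset.mem_of_mem_erase h)]
    ring

lemma det_updateCol_eq_sum {A : Type*} [CommRing A] (M : Matrix (Fin k) (Fin k) A)
    (j : Fin k) (v : Fin k → A) :
    (M.updateCol j v).det = ∑ σ : Equiv.Perm (Fin k), ((Equiv.Perm.sign σ : ℤ) : A) *
      (v (σ j) * ∏ l ∈ Finset.univ.erase j, M (σ l) l) := by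
  rw [Matrix.det_apply']
  refine Finset.sum_congr rfl fun σ _ => ?_
  rw [← Finset.mul_prod_erase _ _ (Finset.mem_univ j), Matrix.updateCol_self]
  congr 2
  exact Finset.prod_congr rfl fun l hl => Matrix.updateCol_ne (Finset.ne_of_mem_erase hl)

lemma derivation_det {A : Type*} [CommRing A] [Algebra ℝ A] (D : Derivation ℝ A A)
    (M : Matrix (Fin k) (Fin k) A) :
    D M.det = ∑ j, (M.updateCol j fun i => D (M i j)).det := by
  simp only [det_updateCol_eq_sum]
  rw [Finset.sum_comm, Matrix.det_apply', map_sum]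
  refine Finset.sum_congr rfl fun σ _ => ?_
  rw [D.leibniz, D.map_intCast, smul_zero, add_zero, smul_eq_mul, derivation_prod_erase,
    Finset.mul_sum]

lemma sum_mul_det {A : Type*} [CommRing A] (w : Fin k → A) (M : Matrix (Fin k) (Fin k) A) :
    (∑ i, w i) * M.det = ∑ j, (M.updateCol j fun i => w i * M i j).det := by
  simp only [det_updateCol_eq_sum]
  rw [Finset.sum_comm, Matrix.det_apply', Finset.mul_sum]
  refine Finset.sum_congr rfl fun σ _ => ?_
  rw [← Equiv.sum_comp σ, Finset.sum_mul]
  refine Finset.sum_congr rfl fun j _ => ?_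
  rw [← Finset.mul_prod_erase _ _ (Finset.mem_univ j)]
  ring

variable (k) in
/-- The Vandermonde matrix of the variables. -/
noncomputable def vdmMatrix : Matrix (Fin k) (Fin k) (MvPolynomial (Fin k) ℝ) :=
  Matrix.of fun i j => X i ^ (j : ℕ)

lemma det_vdmMatrix : (vdmMatrix k).det = vdm k := rfl

/-- The Vandermonde determinant in which the exponent of the column `j` is raised by `m`. -/
noncomputable def raisedDet (j : Fin k) (m : ℕ) : MvPolynomial (Fin k) ℝ :=
  ((vdmMatrix k).updateCol j fun i => X i ^ ((j : ℕ) + m)).det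

lemma raisedDet_of_lt {j : Fin k} {m : ℕ} (hm : m ≠ 0) (h : (j : ℕ) + m < k) :
    raisedDet j m = 0 := by
  have hne : j ≠ ⟨(j : ℕ) + m, h⟩ := fun hc => hm (by
    have := congrArg Fin.val hc
    simp at this
    exact this)
  refine Matrix.det_zero_of_column_eq hne fun i => ?_
  rw [Matrix.updateCol_self, Matrix.updateCol_ne hne.symm]
  rfl

lemma raisedDet_of_le (j : Fin k) {m a b : ℕ} (hb : k - 1 - j = b) (hm : m = a + b + 1) :
    raisedDet j m = (-1) ^ b * hookSym k a b * vdm k := by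
  have hj : (j : ℕ) + m = k + a := by have := j.isLt; omega
  have h : (fun i : Fin k => (X i : MvPolynomial (Fin k) ℝ) ^ ((j : ℕ) + m)) = fun i =>
      ∑ l : Fin k, ((-1) ^ (k - 1 - l) * hookSym k a (k - 1 - l)) • vdmMatrix k i l := by
    funext i
    rw [hj, X_pow_eq_sum_hookSym, ← Finset.sum_range_reflect, Finset.sum_range]
    refine Finset.sum_congr rfl fun l _ => ?_
    rw [show k - 1 - (k - 1 - l) = (l : ℕ) by have := l.isLt; omega]
    rfl
  rw [raisedDet, h, Matrix.det_updateCol_sum, det_vdmMatrix, hb, smul_eq_mul]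

/-- The Schur polynomial of the hook `(m - q + 1, 1, …, 1)` with `q - 1` ones, extended by zero
to `q = 0`. -/
noncomputable def hookPoly (k m : ℕ) : ℕ → MvPolynomial (Fin k) ℝ
  | 0 => 0
  | b + 1 => hookSym k (m - (b + 1)) b

lemma sum_raisedDet (g : ℕ → MvPolynomial (Fin k) ℝ) {m : ℕ} (hm : m ≠ 0) :
    ∑ j : Fin k, g (k - j) * raisedDet j m =
      (∑ q ∈ Finset.Icc 1 m, g q * ((-1) ^ (q - 1) * hookPoly k m q)) * vdm k := by
  have h1 : ∑ j : Fin k, g (k - j) * raisedDet j m = ∑ b ∈ Finset.range k,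
      if b < m then g (b + 1) * ((-1) ^ b * hookSym k (m - (b + 1)) b) * vdm k else 0 := by
    rw [← Finset.sum_range_reflect, Finset.sum_range]
    refine Finset.sum_congr rfl fun j _ => ?_
    have := j.isLt
    split_ifs with hb
    · rw [raisedDet_of_le (a := m - (k - 1 - j + 1)) j rfl (by omega),
        show k - 1 - (j : ℕ) + 1 = k - j by omega]
      ring
    · rw [raisedDet_of_lt hm (by omega), mul_zero]
  have h2 : ∑ q ∈ Finset.Icc 1 m, g q * ((-1) ^ (q - 1) * hookPoly k m q) =
      ∑ b ∈ Finset.range m, g (b + 1) * ((-1) ^ b * hookSym k (m - (b + 1)) b) := by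
    rw [Finset.range_eq_Ico]
    exact (Finset.sum_Ico_add' (fun q => g q * ((-1) ^ (q - 1) * hookPoly k m q)) 0 m 1).symm
  rw [h1, h2, Finset.sum_mul, ← Finset.sum_filter]
  refine Finset.sum_subset (fun b hb => ?_) fun b hb hb' => ?_
  · simp at hb ⊢
    exact hb.2
  · simp at hb hb'
    rw [hookSym_eq_zero _ (by omega)]
    ring

/-- Newton's expansion of a power sum into hook Schur polynomials. -/
lemma psum_eq_sum_hookPoly {m : ℕ} (hm : m ≠ 0) :
    psum (Fin k) ℝ m = ∑ q ∈ Finset.Icc 1 m, (-1) ^ (q - 1) * hookPoly k m q := by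
  have h := sum_mul_det (fun i => (X i : MvPolynomial (Fin k) ℝ) ^ m) (vdmMatrix k)
  have h1 := sum_raisedDet (k := k) (fun _ => 1) hm
  have h2 : vdm k ≠ 0 := by
    rw [vdm_eq_prod]
    refine Finset.prod_ne_zero_iff.2 fun i _ => Finset.prod_ne_zero_iff.2 fun j hj => ?_
    exact sub_ne_zero.2 fun hc => (ne_of_lt (Finset.mem_Ioi.1 hj)) (X_injective hc).symm
  refine mul_right_cancel₀ h2 ?_
  simp only [one_mul] at h1
  rw [← h1, ← det_vdmMatrix, psum, h]
  refine Finset.sum_congr rfl fun j _ => ?_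
  rw [raisedDet]
  congr 2
  funext i
  rw [add_comm, pow_add]
  rfl

lemma mkDerivation_X_pow_vdm_sq (n : ℕ) :
    mkDerivation ℝ (fun i : Fin k => X i ^ (n + 2)) (vdm k ^ 2) =
      (∑ q ∈ Finset.Icc 1 (n + 1), (2 * ((k : MvPolynomial (Fin k) ℝ) - q)) *
        ((-1) ^ (q - 1) * hookPoly k (n + 1) q)) * vdm k ^ 2 := by
  have h := derivation_det (mkDerivation ℝ fun i : Fin k => X i ^ (n + 2)) (vdmMatrix k)
  have h1 := sum_raisedDet (k := k)
    (fun q => 2 * ((k : MvPolynomial (Fin k) ℝ) - (q : MvPolynomial (Fin k) ℝ)))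
    (Nat.succ_ne_zero n)
  rw [det_vdmMatrix] at h
  have h3 : 2 * mkDerivation ℝ (fun i : Fin k => X i ^ (n + 2)) (vdm k) =
      ∑ j : Fin k, 2 * ((k : MvPolynomial (Fin k) ℝ) - ((k - j : ℕ) : MvPolynomial (Fin k) ℝ)) *
        raisedDet j (n + 1) := by
    rw [h, Finset.mul_sum]
    refine Finset.sum_congr rfl fun j _ => ?_
    have hc : (fun i => mkDerivation ℝ (fun i : Fin k => (X i : MvPolynomial (Fin k) ℝ) ^ (n + 2))
        (vdmMatrix k i j)) = (j : MvPolynomial (Fin k) ℝ) •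
          fun i => X i ^ ((j : ℕ) + (n + 1)) := by
      funext i
      have he : vdmMatrix k i j = X i ^ (j : ℕ) := rfl
      rw [he, Derivation.leibniz_pow, mkDerivation_X]
      rcases Nat.eq_zero_or_pos (j : ℕ) with h0 | h0
      · simp [h0]
      · simp only [smul_eq_mul, nsmul_eq_mul, Pi.smul_apply]
        rw [← pow_add, show (j : ℕ) - 1 + (n + 2) = j + (n + 1) by omega]
    rw [hc, Matrix.det_updateCol_smul, raisedDet, Nat.cast_sub j.isLt.le]
    ring
  rw [Derivation.leibniz_pow]
  simp only [nsmul_eq_mul, smul_eq_mul]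
  rw [show n.succ = n + 1 from rfl] at h1
  rw [← h3] at h1
  push_cast
  linear_combination vdm k * h1

lemma rowLen_eq_zero {Y : YoungDiagram} {i : ℕ} (h : Y.colLen 0 ≤ i) : Y.rowLen i = 0 := by
  by_contra h0
  have h1 : (i, 0) ∈ Y := YoungDiagram.mem_iff_lt_rowLen.2 (Nat.pos_of_ne_zero h0)
  exact absurd (YoungDiagram.mem_iff_lt_colLen.1 h1) (by omega)

lemma colLen_hook {m q : ℕ} (hq : 1 ≤ q) : (hook m q).colLen 0 = q := by
  rw [← YoungDiagram.length_rowLens, hook, YoungDiagram.rowLens_length_ofRowLens]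
  · simp
    omega
  · intro a ha
    rcases List.mem_cons.1 ha with rfl | ha
    · omega
    · rw [List.eq_of_mem_replicate ha]
      omega

lemma rowLen_hook {m q : ℕ} (hq : 1 ≤ q) (i : ℕ) :
    (hook m q).rowLen i = if i = 0 then m - q + 1 else if i < q then 1 else 0 := by
  by_cases hi : i < q
  · have hl : i < ((m - q + 1) :: List.replicate (q - 1) 1).length := by
      simp
      omega
    have h := YoungDiagram.rowLen_ofRowLens (w := (m - q + 1) :: List.replicate (q - 1) 1)
      (hw := by
        rw [List.sortedGE_iff_pairwise, List.pairwise_cons]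
        refine ⟨fun b hb => ?_, ?_⟩
        · rw [List.eq_of_mem_replicate hb]; omega
        · simp [List.pairwise_replicate]) ⟨i, hl⟩
    refine h.trans ?_
    rcases i with _ | i
    · simp
    · simp [hi]
  · rw [rowLen_eq_zero (by rw [colLen_hook hq]; omega), if_neg (by omega), if_neg hi]

/-- Jacobi's bialternant formula for hooks. The columns of the alternant are those of the
Vandermonde matrix with one exponent raised by `m`, in cyclically permuted order. -/
lemma alternant_hook {m q : ℕ} (hq : 1 ≤ q) (hqm : q ≤ m) (hqk : q ≤ k) :
    alternant (fun j : Fin k => (j : ℕ) + (hook m q).rowLen (k - 1 - j)) =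
      hookPoly k m q * vdm k := by
  obtain ⟨n, rfl⟩ : ∃ n, k = n + 1 := ⟨k - 1, by omega⟩
  set l : Fin (n + 1) := ⟨n + 1 - q, by omega⟩ with hl
  have hle : l ≤ Fin.last n := Fin.le_last l
  have hr := raisedDet_of_le (a := m - q) (b := q - 1) (m := m) l
    (by simp [hl]; omega) (by omega)
  have hM : (Matrix.of fun i j : Fin (n + 1) => (X i : MvPolynomial (Fin (n + 1)) ℝ) ^
      ((j : ℕ) + (hook m q).rowLen (n + 1 - 1 - j))) =
      ((vdmMatrix (n + 1)).updateCol l fun i => X i ^ ((l : ℕ) + m)).submatrix id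
        (Fin.cycleIcc l (Fin.last n)) := by
    ext1 i j
    rw [Matrix.submatrix_apply, Matrix.of_apply, rowLen_hook hq]
    rcases lt_or_ge j l with hj | hj
    · rw [Fin.cycleIcc_of_lt hj, Matrix.updateCol_ne hj.ne, if_neg, if_neg]
      · rfl
      · have : (j : ℕ) < n + 1 - q := hj
        omega
      · have : (j : ℕ) < n + 1 - q := hj
        omega
    · have hj' : n + 1 - q ≤ (j : ℕ) := hj
      rcases eq_or_ne j (Fin.last n) with rfl | hne
      · rw [Fin.cycleIcc_of_last hle, Matrix.updateCol_self, if_pos (by simp)]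
        simp only [id, hl, Fin.val_last]
        congr 1
        omega
      · have hlt : j < Fin.last n := lt_of_le_of_ne (Fin.le_last j) hne
        have hlt' : (j : ℕ) < n := hlt
        have hv : ((j + 1 : Fin (n + 1)) : ℕ) = j + 1 := Fin.val_add_one_of_lt hlt
        rw [Fin.cycleIcc_of_ge_of_lt hj hlt, Matrix.updateCol_ne, if_neg (by omega),
          if_pos (by omega)]
        · change _ = X i ^ ((j + 1 : Fin (n + 1)) : ℕ)
          rw [hv]
        · intro hc
          have := congrArg Fin.val hc
          rw [hv] at this
          simp only [hl] at this
          omega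
  have hs : ((Equiv.Perm.sign (Fin.cycleIcc l (Fin.last n)) : ℤ) :
      MvPolynomial (Fin (n + 1)) ℝ) = (-1) ^ (q - 1) := by
    rw [Fin.sign_cycleIcc_of_le hle]
    have : n - (l : ℕ) = q - 1 := by
      simp only [hl]
      omega
    simp [this]
  rw [alternant, hM, Matrix.det_permute', hs]
  change _ * raisedDet l m = _
  have hp : hookPoly (n + 1) m q = hookSym (n + 1) (m - q) (q - 1) := by
    obtain ⟨b, rfl⟩ : ∃ b, q = b + 1 := ⟨q - 1, by omega⟩
    rfl
  rw [hr, hp]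
  have h2 : ((-1 : MvPolynomial (Fin (n + 1)) ℝ) ^ (q - 1)) * (-1) ^ (q - 1) = 1 := by
    rw [← mul_pow]
    simp
  linear_combination (hookSym (n + 1) (m - q) (q - 1) * vdm (n + 1)) * h2

lemma hookPoly_eq_zero {m q : ℕ} (h : k < q) : hookPoly k m q = 0 := by
  obtain ⟨b, rfl⟩ : ∃ b, q = b + 1 := ⟨q - 1, by omega⟩
  exact hookSym_eq_zero _ (by omega)

end

/-! ### Averages of symmetric polynomials -/

/-- The average of `p_2 ^ n₁ p_3 ^ n₂ s` against the squared Vandermonde determinant, normalized so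
that it represents the derivatives of Hankel determinants. -/
noncomputable def avg (k n₁ n₂ : ℕ) (x : ℝ) : MvPolynomial (Fin k) ℝ →ₗ[ℝ] ℝ :=
  (k.factorial : ℝ)⁻¹ • (besselMoment k x).comp
    (LinearMap.mulRight ℝ (psum (Fin k) ℝ 2 ^ n₁ * psum (Fin k) ℝ 3 ^ n₂ * vdm k ^ 2))

section

variable {k : ℕ}

lemma avg_apply (n₁ n₂ : ℕ) (x : ℝ) (s : MvPolynomial (Fin k) ℝ) :
    avg k n₁ n₂ x s = (k.factorial : ℝ)⁻¹ * besselMoment k x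
      (s * (psum (Fin k) ℝ 2 ^ n₁ * psum (Fin k) ℝ 3 ^ n₂ * vdm k ^ 2)) := rfl

lemma besselMoment_staircase_mul_alternant (n₁ n₂ : ℕ) (x : ℝ) {d : Fin k → ℕ}
    {s : MvPolynomial (Fin k) ℝ} (hd : alternant d = s * vdm k) :
    besselMoment k x (psum (Fin k) ℝ 2 ^ n₁ * (psum (Fin k) ℝ 3 ^ n₂ *
      (staircase k * alternant d))) = avg k n₁ n₂ x s := by
  have h := moment_mul_vdm (fun n => besselI (n + 1) (2 * √x))
    (A := psum (Fin k) ℝ 2 ^ n₁ * psum (Fin k) ℝ 3 ^ n₂ * alternant d) fun σ => by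
      rw [map_mul, map_mul, map_pow, map_pow, psum_isSymmetric _ _ _ σ, psum_isSymmetric _ _ _ σ,
        rename_alternant]
      ring
  rw [avg_apply, besselMoment, show s * (psum (Fin k) ℝ 2 ^ n₁ * psum (Fin k) ℝ 3 ^ n₂ *
      vdm k ^ 2) = psum (Fin k) ℝ 2 ^ n₁ * psum (Fin k) ℝ 3 ^ n₂ * alternant d * vdm k by
        rw [hd]; ring, h]
  have hk : (k.factorial : ℝ) ≠ 0 := by positivity
  rw [inv_mul_cancel_left₀ hk]
  congr 1
  ring

lemma shiftedDet_eq (Y : YoungDiagram) (hY : Y.colLen 0 ≤ k) (x t₁ t₂ : ℝ) :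
    shiftedDet k Y x t₁ t₂ = genMoment k x t₁ t₂
      (staircase k * alternant fun j : Fin k => (j : ℕ) + Y.rowLen (k - 1 - j)) := by
  rw [shiftedDet, if_pos hY, genMoment, ← det_eq_moment_alternant]
  congr 1
  ext1 i j
  rw [Matrix.of_apply, Matrix.of_apply]
  congr 1
  ring

lemma hookDeriv_eq (n₁ n₂ : ℕ) {m q : ℕ} (hq : 1 ≤ q) (hqm : q ≤ m) {x : ℝ} (hx : 0 ≤ x) :
    hookDeriv k n₁ n₂ m q x = avg k n₁ n₂ x (hookPoly k m q) := by
  rw [hookDeriv]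
  by_cases hqk : q ≤ k
  · have hY : (hook m q).colLen 0 ≤ k := by rwa [colLen_hook hq]
    simp only [shiftedDet_eq (hook m q) hY, iteratedDeriv_genMoment k hx]
    exact besselMoment_staircase_mul_alternant n₁ n₂ x (alternant_hook hq hqm hqk)
  · have h : ∀ t₁ t₂, shiftedDet k (hook m q) x t₁ t₂ = 0 := fun t₁ t₂ => by
      rw [shiftedDet, if_neg (by rwa [colLen_hook hq])]
    rw [hookPoly_eq_zero (by omega), map_zero]
    have h0 : ∀ n : ℕ, iteratedDeriv n (fun _ : ℝ => (0 : ℝ)) 0 = 0 := fun n => by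
      rw [iteratedDeriv_const]
      simp
    simp only [h, h0]

lemma iteratedDeriv_shiftedDet_bot (n₁ n₂ : ℕ) {x : ℝ} (hx : 0 ≤ x) :
    iteratedDeriv n₁ (fun t₁ => iteratedDeriv n₂ (fun t₂ => shiftedDet k ⊥ x t₁ t₂) 0) 0 =
      avg k n₁ n₂ x 1 := by
  have hb : (⊥ : YoungDiagram).colLen 0 = 0 := by
    by_contra h0
    exact YoungDiagram.notMem_bot _ (YoungDiagram.mem_iff_lt_colLen.2 (Nat.pos_of_ne_zero h0))
  simp only [shiftedDet_eq ⊥ (by omega : (⊥ : YoungDiagram).colLen 0 ≤ k),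
    iteratedDeriv_genMoment k hx]
  refine besselMoment_staircase_mul_alternant n₁ n₂ x ?_
  have : (fun j : Fin k => (j : ℕ) + (⊥ : YoungDiagram).rowLen (k - 1 - j)) =
      fun j : Fin k => (j : ℕ) := by
    funext j
    rw [rowLen_eq_zero (by omega), add_zero]
  rw [this, one_mul, vdm]

lemma sumDet_eq (n₁ n₂ : ℕ) (x : ℝ) : sumDet k n₁ n₂ x = avg k n₁ n₂ x 1 := by
  rw [← besselMoment_staircase_mul_alternant (k := k) n₁ n₂ x (d := fun j : Fin k => (j : ℕ))
    (s := 1) (one_mul _).symm, psum, psum, Finset.sum_pow_eq_sum_piAntidiag,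
    Finset.sum_pow_eq_sum_piAntidiag, Finset.sum_mul, map_sum, sumDet]
  refine Finset.sum_congr rfl fun h₁ _ => ?_
  rw [Finset.sum_mul, Finset.mul_sum, map_sum]
  refine Finset.sum_congr rfl fun h₂ _ => ?_
  have h := det_eq_moment_vdm (fun n => besselI (n + 1) (2 * √x))
    fun j : Fin k => 2 * h₁ j + 3 * h₂ j + j
  have hM : (Matrix.of fun i j : Fin k =>
      besselI (2 * h₁ j + 3 * h₂ j + i + j + 1) (2 * √x)) =
      Matrix.of fun i j : Fin k => besselI (2 * h₁ j + 3 * h₂ j + j + i + 1) (2 * √x) := by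
    ext1 i j
    rw [Matrix.of_apply, Matrix.of_apply, add_right_comm (2 * h₁ j + 3 * h₂ j)]
  rw [hM, h, ← smul_eq_mul, ← map_smul, besselMoment, Algebra.smul_def]
  congr 1
  simp only [pow_add, pow_mul, Finset.prod_mul_distrib, map_mul, map_natCast, staircase]
  rw [← vdm]
  ring

lemma contDiffOn_avg (n₁ n₂ : ℕ) (s : MvPolynomial (Fin k) ℝ) :
    ContDiffOn ℝ ∞ (fun x => avg k n₁ n₂ x s) (Set.Ioi 0) :=
  contDiffOn_const.mul (contDiffOn_besselMoment _)

lemma contDiff_shiftedDet (Y : YoungDiagram) {x : ℝ} (hx : 0 ≤ x) :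
    ContDiff ℝ ∞ fun t : ℝ × ℝ => shiftedDet k Y x t.1 t.2 := by
  unfold shiftedDet
  split_ifs
  · simp only [Matrix.det_apply', Matrix.of_apply]
    exact ContDiff.sum fun σ _ => contDiff_const.mul (contDiff_prod fun i _ =>
      contDiff_genBessel _ hx)
  · exact contDiff_const

end

/-! ### Homogeneity of hook Schur polynomials -/

section

variable {k : ℕ}

lemma elem_mul_comp_eq_hookPoly (a r : ℕ) :
    elem k r * comp k (a + 1) = hookPoly k (a + r + 1) r + hookPoly k (a + r + 1) (r + 1) := by
  rcases r with _ | b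
  · rw [elem_zero, one_mul, ← hookSym_zero_right]
    simp [hookPoly]
  · rw [elem_mul_comp, hookPoly, hookPoly, show a + (b + 1) + 1 - (b + 1) = a + 1 by omega,
      show a + (b + 1) + 1 - (b + 1 + 1) = a by omega]
    ring

lemma euler_hookSym (a b : ℕ) :
    euler k (hookSym k a b) = ((a + b + 1 : ℕ) : MvPolynomial (Fin k) ℝ) * hookSym k a b := by
  induction b generalizing a with
  | zero => rw [hookSym_zero_right, euler_comp, add_zero]
  | succ b ih =>
    rw [hookSym, map_sub, Derivation.leibniz, ih, euler_elem, euler_comp]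
    simp only [smul_eq_mul]
    push_cast
    ring

lemma euler_hookPoly {m q : ℕ} (hqm : q ≤ m) :
    euler k (hookPoly k m q) = (m : MvPolynomial (Fin k) ℝ) * hookPoly k m q := by
  rcases q with _ | b
  · simp [hookPoly]
  · rw [hookPoly, euler_hookSym, show m - (b + 1) + b + 1 = m by omega]

lemma euler_psum (n : ℕ) :
    euler k (psum (Fin k) ℝ n) = (n : MvPolynomial (Fin k) ℝ) * psum (Fin k) ℝ n := by
  rw [psum, map_sum, Finset.mul_sum]
  refine Finset.sum_congr rfl fun i _ => ?_
  rw [Derivation.leibniz_pow, euler_X]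
  rcases n with _ | n
  · simp
  · simp [pow_succ]

lemma euler_vdm_sq :
    euler k (vdm k ^ 2) =
      (k : MvPolynomial (Fin k) ℝ) * ((k : MvPolynomial (Fin k) ℝ) - 1) * vdm k ^ 2 := by
  rw [euler, mkDerivation_vdm_sq _ (fun _ _ => 1) fun i j _ => by rw [one_mul]]
  congr 1
  have h : ∀ i : Fin k, ∑ _j ∈ ({i}ᶜ : Finset (Fin k)), (1 : MvPolynomial (Fin k) ℝ) =
      (k : MvPolynomial (Fin k) ℝ) - 1 := fun i => by
    have hs := Finset.sum_compl_add_sum ({i} : Finset (Fin k))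
      fun _ => (1 : MvPolynomial (Fin k) ℝ)
    rw [Finset.sum_singleton] at hs
    rw [eq_sub_of_add_eq hs]
    simp
  rw [Finset.sum_congr rfl fun i _ => h i]
  simp
  ring

/-! ### Differential equation and loop equations for the averages -/

lemma natCast_mul_avg_psum_two (n₁ n₂ : ℕ) (x : ℝ) (s : MvPolynomial (Fin k) ℝ) :
    (n₁ : ℝ) * avg k (n₁ - 1) n₂ x (psum (Fin k) ℝ 2 * s) = n₁ * avg k n₁ n₂ x s := by
  rcases n₁ with _ | n
  · simp
  · rw [avg_apply, avg_apply, Nat.add_sub_cancel]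
    congr 3
    ring

lemma natCast_mul_avg_psum_three (n₁ n₂ : ℕ) (x : ℝ) (s : MvPolynomial (Fin k) ℝ) :
    (n₂ : ℝ) * avg k n₁ (n₂ - 1) x (psum (Fin k) ℝ 3 * s) = n₂ * avg k n₁ n₂ x s := by
  rcases n₂ with _ | n
  · simp
  · rw [avg_apply, avg_apply, Nat.add_sub_cancel]
    congr 3
    ring

lemma avg_psum_two (n₁ n₂ : ℕ) (x : ℝ) (s : MvPolynomial (Fin k) ℝ) :
    avg k n₁ n₂ x (psum (Fin k) ℝ 2 * s) = avg k (n₁ + 1) n₂ x s := by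
  rw [avg_apply, avg_apply]
  congr 2
  ring

lemma avg_psum_three (n₁ n₂ : ℕ) (x : ℝ) (s : MvPolynomial (Fin k) ℝ) :
    avg k n₁ n₂ x (psum (Fin k) ℝ 3 * s) = avg k n₁ (n₂ + 1) x s := by
  rw [avg_apply, avg_apply]
  congr 2
  ring

lemma map_natCast_mul (L : MvPolynomial (Fin k) ℝ →ₗ[ℝ] ℝ) (n : ℕ) (Q : MvPolynomial (Fin k) ℝ) :
    L ((n : MvPolynomial (Fin k) ℝ) * Q) = n * L Q := by
  rw [← nsmul_eq_mul, map_nsmul, nsmul_eq_mul]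

lemma hasDerivAt_avg (n₁ n₂ : ℕ) {x : ℝ} (hx : 0 < x) {s : MvPolynomial (Fin k) ℝ} {d : ℕ}
    (hs : euler k s = (d : MvPolynomial (Fin k) ℝ) * s) :
    HasDerivAt (fun y => avg k n₁ n₂ y s) (avg k n₁ n₂ x (psum (Fin k) ℝ 1 * s) / √x +
      ((k : ℝ) ^ 2 + d + 2 * n₁ + 3 * n₂) / (2 * x) * avg k n₁ n₂ x s) x := by
  have h := (hasDerivAt_besselMoment hx
    (s * (psum (Fin k) ℝ 2 ^ n₁ * psum (Fin k) ℝ 3 ^ n₂ * vdm k ^ 2))).const_mul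
      (k.factorial : ℝ)⁻¹
  set Q := s * (psum (Fin k) ℝ 2 ^ n₁ * psum (Fin k) ℝ 3 ^ n₂ * vdm k ^ 2) with hQ
  have hpow : ∀ n l : ℕ, euler k (psum (Fin k) ℝ n ^ l) =
      (n : MvPolynomial (Fin k) ℝ) * l * psum (Fin k) ℝ n ^ l := fun n l => by
    rw [Derivation.leibniz_pow, euler_psum]
    rcases l with _ | l
    · simp
    · simp only [Nat.add_sub_cancel, nsmul_eq_mul, smul_eq_mul, pow_succ]
      ring
  have he : euler k Q =
      (d + 2 * n₁ + 3 * n₂ + k * (k - 1) : MvPolynomial (Fin k) ℝ) * Q := by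
    simp only [hQ, Derivation.leibniz, hs, hpow, euler_vdm_sq, smul_eq_mul]
    push_cast
    ring
  have hsum : ∑ i, pderiv i (X i * Q) = ((k ^ 2 + d + 2 * n₁ + 3 * n₂ : ℕ) :
      MvPolynomial (Fin k) ℝ) * Q := by
    simp only [pderiv_mul, pderiv_X_self, one_mul, Finset.sum_add_distrib]
    rw [← mkDerivation_eq_sum, ← euler, he]
    simp
    ring
  refine h.congr_deriv ?_
  rw [hsum, map_natCast_mul, avg_apply, avg_apply, ← hQ, mul_assoc (psum (Fin k) ℝ 1), ← hQ]
  push_cast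
  ring

lemma avg_psum_one_mul (n₁ n₂ : ℕ) {x : ℝ} (hx : 0 < x) {s : MvPolynomial (Fin k) ℝ} {d : ℕ}
    (hs : euler k s = (d : MvPolynomial (Fin k) ℝ) * s) :
    avg k n₁ n₂ x (psum (Fin k) ℝ 1 * s) =
      √x * diffOp ((k : ℝ) ^ 2 + d + 2 * n₁ + 3 * n₂) (fun y => avg k n₁ n₂ y s) x := by
  rw [diffOp, (hasDerivAt_avg n₁ n₂ hx hs).deriv]
  have hs0 : √x ≠ 0 := (Real.sqrt_pos.2 hx).ne'
  field_simp
  ring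

/-- The loop equation of a vector field `u_i ^ 2 V_i`; the polynomial `κ` accounts for its action
on the squared Vandermonde determinant. -/
lemma loop_equation (n₁ n₂ : ℕ) {x : ℝ} (hx : 0 < x) (V : Fin k → MvPolynomial (Fin k) ℝ)
    (κ : MvPolynomial (Fin k) ℝ)
    (hκ : mkDerivation ℝ (fun i => X i ^ 2 * V i) (vdm k ^ 2) = κ * vdm k ^ 2) :
    √x * avg k n₁ n₂ x (∑ i, (1 - X i ^ 2) * V i) =
      avg k n₁ n₂ x (∑ i, pderiv i (X i ^ 2 * V i) + κ) +
      2 * n₁ * avg k (n₁ - 1) n₂ x (∑ i, X i ^ 3 * V i) +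
      3 * n₂ * avg k n₁ (n₂ - 1) x (∑ i, X i ^ 4 * V i) := by
  set Q := psum (Fin k) ℝ 2 ^ n₁ * psum (Fin k) ℝ 3 ^ n₂ * vdm k ^ 2 with hQ
  have h1 : besselMoment k x (∑ i, pderiv i (X i ^ 2 * (V i * Q))) =
      √x * besselMoment k x ((∑ i, (1 - X i ^ 2) * V i) * Q) := by
    rw [Finset.sum_mul, map_sum, map_sum, Finset.mul_sum]
    refine Finset.sum_congr rfl fun i _ => ?_
    rw [besselMoment_pderiv hx, mul_assoc]
  have hp : ∀ n : ℕ, mkDerivation ℝ (fun i => X i ^ 2 * V i) (psum (Fin k) ℝ (n + 1)) =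
      ((n + 1 : ℕ) : MvPolynomial (Fin k) ℝ) * ∑ i, X i ^ (n + 2) * V i := fun n => by
    rw [psum, map_sum, Finset.mul_sum]
    refine Finset.sum_congr rfl fun i _ => ?_
    rw [Derivation.leibniz_pow, mkDerivation_X]
    simp only [Nat.add_sub_cancel, nsmul_eq_mul, smul_eq_mul]
    ring
  have hp2 := hp 1
  have hp3 := hp 2
  have h2 : ∑ i, pderiv i (X i ^ 2 * (V i * Q)) =
      (∑ i, pderiv i (X i ^ 2 * V i) + κ) * Q +
      (n₁ : MvPolynomial (Fin k) ℝ) * (((2 : ℕ) : MvPolynomial (Fin k) ℝ) * ((∑ i, X i ^ 3 * V i) *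
        (psum (Fin k) ℝ 2 ^ (n₁ - 1) * psum (Fin k) ℝ 3 ^ n₂ * vdm k ^ 2))) +
      (n₂ : MvPolynomial (Fin k) ℝ) * (((3 : ℕ) : MvPolynomial (Fin k) ℝ) * ((∑ i, X i ^ 4 * V i) *
        (psum (Fin k) ℝ 2 ^ n₁ * psum (Fin k) ℝ 3 ^ (n₂ - 1) * vdm k ^ 2))) := by
    have e : ∑ i, pderiv i (X i ^ 2 * (V i * Q)) = (∑ i, pderiv i (X i ^ 2 * V i)) * Q +
        mkDerivation ℝ (fun i => X i ^ 2 * V i) Q := by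
      rw [mkDerivation_eq_sum, Finset.sum_mul, ← Finset.sum_add_distrib]
      refine Finset.sum_congr rfl fun i _ => ?_
      rw [← mul_assoc, pderiv_mul]
    rw [e, hQ, Derivation.leibniz, Derivation.leibniz, hκ, Derivation.leibniz_pow,
      Derivation.leibniz_pow, hp2, hp3]
    simp only [smul_eq_mul, nsmul_eq_mul]
    push_cast
    ring
  rw [h2, map_add, map_add, map_natCast_mul, map_natCast_mul, map_natCast_mul,
    map_natCast_mul] at h1
  rw [avg_apply, avg_apply, avg_apply, avg_apply, ← hQ]
  push_cast at h1
  linear_combination (-(k.factorial : ℝ)⁻¹) * h1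

/-- The Virasoro constraints, in which products of power sums are replaced by combinations of hook
Schur polynomials. -/
lemma avg_psum_recurrence (n₁ n₂ n : ℕ) {x : ℝ} (hx : 0 < x) :
    √x * (avg k n₁ n₂ x (psum (Fin k) ℝ n) - avg k n₁ n₂ x (psum (Fin k) ℝ (n + 2))) =
      ∑ q ∈ Finset.Icc 1 (n + 1), (-1) ^ (q - 1) * (2 * (k : ℝ) - 2 * q + n + 2) *
        avg k n₁ n₂ x (hookPoly k (n + 1) q) +
      2 * n₁ * avg k (n₁ - 1) n₂ x (psum (Fin k) ℝ (n + 3)) +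
      3 * n₂ * avg k n₁ (n₂ - 1) x (psum (Fin k) ℝ (n + 4)) := by
  have h := loop_equation n₁ n₂ hx (fun i : Fin k => X i ^ n) _ (by
    have := mkDerivation_X_pow_vdm_sq (k := k) n
    simpa only [← pow_add, add_comm n 2] using this)
  have e1 : ∑ i : Fin k, (1 - X i ^ 2) * X i ^ n =
      psum (Fin k) ℝ n - psum (Fin k) ℝ (n + 2) := by
    rw [psum, psum, ← Finset.sum_sub_distrib]
    exact Finset.sum_congr rfl fun i _ => by ring
  have e2 : ∑ i : Fin k, pderiv i (X i ^ 2 * X i ^ n) =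
      ∑ q ∈ Finset.Icc 1 (n + 1), ((n : MvPolynomial (Fin k) ℝ) + 2) *
        ((-1) ^ (q - 1) * hookPoly k (n + 1) q) := by
    rw [← Finset.mul_sum, ← psum_eq_sum_hookPoly (Nat.succ_ne_zero n), psum, Finset.mul_sum]
    refine Finset.sum_congr rfl fun i _ => ?_
    rw [← pow_add, pderiv_pow, pderiv_X_self, show 2 + n - 1 = n + 1 by omega]
    rw [Nat.succ_eq_add_one]
    push_cast
    ring
  have e3 : ∀ l : ℕ, ∑ i : Fin k, (X i : MvPolynomial (Fin k) ℝ) ^ l * X i ^ n =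
      psum (Fin k) ℝ (n + l) := fun l => by
    rw [psum]
    exact Finset.sum_congr rfl fun i _ => by ring
  rw [e1, e2, e3, e3, map_sub, ← Finset.sum_add_distrib, map_sum] at h
  rw [h]
  congr 2
  refine Finset.sum_congr rfl fun q _ => ?_
  rw [← smul_eq_mul (_ * _ : ℝ), ← LinearMap.map_smul, Algebra.smul_def]
  congr 1
  simp only [map_mul, map_pow, map_neg, map_one, map_add, map_sub, map_ofNat, map_natCast]
  ring

lemma avg_psum {m : ℕ} (hm : m ≠ 0) (n₁ n₂ : ℕ) (x : ℝ) :
    avg k n₁ n₂ x (psum (Fin k) ℝ m) =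
      ∑ q ∈ Finset.Icc 1 m, (-1) ^ (q - 1) * avg k n₁ n₂ x (hookPoly k m q) := by
  rw [psum_eq_sum_hookPoly hm, map_sum]
  refine Finset.sum_congr rfl fun q _ => ?_
  rw [← smul_eq_mul (_ ^ _ : ℝ), ← LinearMap.map_smul, Algebra.smul_def]
  simp

/-- The loop equation of the vector field `u_i² h_{a+1} (∂_i e_r) ∂_i`. -/
lemma avg_elem_mul_comp (n₁ n₂ a r : ℕ) {x : ℝ} (hx : 0 < x) :
    √x * (avg k n₁ n₂ x ((∑ i, pderiv i (elem k r)) * comp k (a + 1)) -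
        avg k n₁ n₂ x (psum (Fin k) ℝ 1 * (elem k r * comp k (a + 1))) +
        (r + 1) * avg k n₁ n₂ x (elem k (r + 1) * comp k (a + 1))) =
      (2 * k * r - r ^ 2 + r + a + 1) * avg k n₁ n₂ x (elem k r * comp k (a + 1)) -
      (a + r + 1) * avg k n₁ n₂ x (hookPoly k (a + r + 1) (r + 1)) +
      2 * n₁ * (avg k n₁ n₂ x (elem k r * comp k (a + 1)) -
        avg k (n₁ - 1) n₂ x (psum (Fin k) ℝ 1 * (elem k (r + 1) * comp k (a + 1))) +
        (r + 2) * avg k (n₁ - 1) n₂ x (elem k (r + 2) * comp k (a + 1))) +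
      3 * n₂ * (avg k n₁ n₂ x (elem k r * comp k (a + 1)) -
        avg k (n₁ + 1) (n₂ - 1) x (elem k (r + 1) * comp k (a + 1)) +
        avg k n₁ (n₂ - 1) x (psum (Fin k) ℝ 1 * (elem k (r + 2) * comp k (a + 1))) -
        (r + 3) * avg k n₁ (n₂ - 1) x (elem k (r + 3) * comp k (a + 1))) := by
  set H := comp k (a + 1) with hH
  have h := loop_equation n₁ n₂ hx (fun i : Fin k => pderiv i (elem k r) * H)
    (((2 * k * r - r ^ 2 - r : ℝ)) • (elem k r * H)) (by
      have := mkDerivation_elem_vdm_sq (k := k) r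
      rw [mkDerivation_eq_sum] at this ⊢
      have h' := congrArg (· * H) this
      simp only [Finset.sum_mul] at h'
      rw [Algebra.smul_def]
      simp only [map_sub, map_mul, map_pow, map_ofNat, map_natCast]
      refine (Finset.sum_congr rfl fun i _ => ?_).trans (h'.trans ?_)
      · ring
      · ring)
  have e1 : ∑ i : Fin k, (1 - X i ^ 2) * (pderiv i (elem k r) * H) =
      (∑ i, pderiv i (elem k r)) * H - psum (Fin k) ℝ 1 * (elem k r * H) +
        ((r + 1 : ℝ)) • (elem k (r + 1) * H) := by
    have e := sum_X_sq_mul_pderiv_elem (k := k) r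
    have : ∑ i : Fin k, (1 - X i ^ 2) * (pderiv i (elem k r) * H) =
        (∑ i, pderiv i (elem k r)) * H - (∑ i : Fin k, X i ^ 2 * pderiv i (elem k r)) * H := by
      rw [Finset.sum_mul, Finset.sum_mul, ← Finset.sum_sub_distrib]
      exact Finset.sum_congr rfl fun i _ => by ring
    rw [this, e, Algebra.smul_def]
    simp only [map_add, map_one, map_natCast]
    ring
  have e2 : ∑ i : Fin k, pderiv i (X i ^ 2 * (pderiv i (elem k r) * H)) =
      (2 * r + a + 1 : ℝ) • (elem k r * H) -
        (a + r + 1 : ℝ) • hookPoly k (a + r + 1) (r + 1) := by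
    have e := sum_X_sq_mul_pderiv_mul_pderiv (k := k) a r
    have e' := sum_X_mul_pderiv_elem (k := k) r
    have hi : ∀ i : Fin k, pderiv i (X i ^ 2 * (pderiv i (elem k r) * H)) =
        2 * H * (X i * pderiv i (elem k r)) +
          X i ^ 2 * pderiv i (elem k r) * pderiv i (comp k (a + 1)) := fun i => by
      rw [pderiv_mul, pderiv_mul, pderiv_pderiv_elem_self, pderiv_pow, pderiv_X_self]
      push_cast
      ring
    rw [Finset.sum_congr rfl fun i _ => hi i, Finset.sum_add_distrib, ← Finset.mul_sum, e, e',
      hookPoly, show a + r + 1 - (r + 1) = a by omega, Algebra.smul_def, Algebra.smul_def]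
    simp only [map_add, map_mul, map_one, map_natCast, map_ofNat]
    ring
  have e3 : ∑ i : Fin k, X i ^ 3 * (pderiv i (elem k r) * H) =
      psum (Fin k) ℝ 2 * (elem k r * H) - psum (Fin k) ℝ 1 * (elem k (r + 1) * H) +
        (r + 2 : ℝ) • (elem k (r + 2) * H) := by
    have e := congrArg (· * H) (sum_X_cube_mul_pderiv_elem (k := k) r)
    simp only [Finset.sum_mul] at e
    rw [Finset.sum_congr rfl fun i _ => (mul_assoc _ _ _).symm, e, Algebra.smul_def]
    simp only [map_add, map_ofNat, map_natCast]
    ring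
  have e4 : ∑ i : Fin k, X i ^ 4 * (pderiv i (elem k r) * H) =
      psum (Fin k) ℝ 3 * (elem k r * H) - psum (Fin k) ℝ 2 * (elem k (r + 1) * H) +
        psum (Fin k) ℝ 1 * (elem k (r + 2) * H) - (r + 3 : ℝ) • (elem k (r + 3) * H) := by
    have e := congrArg (· * H) (sum_X_pow_four_mul_pderiv_elem (k := k) r)
    simp only [Finset.sum_mul] at e
    rw [Finset.sum_congr rfl fun i _ => (mul_assoc _ _ _).symm, e, Algebra.smul_def]
    simp only [map_add, map_ofNat, map_natCast]
    ring
  rw [e1, e2, e3, e4] at h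
  simp only [map_add, map_sub, map_smul, smul_eq_mul, avg_psum_two n₁ (n₂ - 1)] at h
  have h2 := natCast_mul_avg_psum_two n₁ n₂ x (elem k r * H)
  have h3 := natCast_mul_avg_psum_three n₁ n₂ x (elem k r * H)
  linear_combination h + 2 * h2 + 3 * h3

end

/-! ### The coefficient matrices -/

/-- The sequence `φ (s + 1), …, φ (s + N)` in the positions `1, …, N`, extended by zero. -/
def seg (φ : ℕ → ℝ) (s N c : ℕ) : ℝ := if 1 ≤ c ∧ c ≤ N then φ (c + s) else 0

lemma seg_of_le (φ : ℕ → ℝ) (s : ℕ) {N c : ℕ} (h1 : 1 ≤ c) (h2 : c ≤ N) :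
    seg φ s N c = φ (c + s) := if_pos ⟨h1, h2⟩

lemma seg_zero (φ : ℕ → ℝ) (s N : ℕ) : seg φ s N 0 = 0 := if_neg (by omega)

lemma seg_of_lt (φ : ℕ → ℝ) (s : ℕ) {N c : ℕ} (h : N < c) : seg φ s N c = 0 :=
  if_neg (by omega)

/-- The product of a row of a matrix with columns `1, …, M` and a vector. -/
def rowSum (E : ℕ → ℕ → ℝ) (M : ℕ) (ψ : ℕ → ℝ) (i : ℕ) : ℝ :=
  ∑ c ∈ Finset.Icc 1 M, E i c * ψ c

lemma mulVec_colVec (E : ℕ → ℕ → ℝ) (m n s N : ℕ) (φ : ℕ → ℝ) (a : Fin m) :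
    (Matrix.of fun (a : Fin m) (b : Fin n) => E (a + 1) (b + 1)).mulVec
      (colVec φ (s + 1) (N + s) n) a = rowSum E n (seg φ s N) (a + 1) := by
  have h := Finset.sum_Ico_add' (fun c => E (a + 1) c * seg φ s N c) 0 n 1
  rw [← Finset.range_eq_Ico, Finset.sum_range] at h
  refine Eq.trans ?_ h
  simp only [Matrix.mulVec, dotProduct]
  refine Finset.sum_congr rfl fun b _ => ?_
  rw [Matrix.of_apply, colVec, seg]
  congr 1
  by_cases hb : (b : ℕ) + 1 ≤ N
  · rw [if_pos (by omega), if_pos (by omega)]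
    congr 1
    ring
  · rw [if_neg (by omega), if_neg (by omega)]

lemma sum_two_ite {M : ℕ} {E ψ : ℕ → ℝ} {α β : ℝ} {p q : ℕ}
    (h : ∀ c ∈ Finset.Icc 1 M, E c = (if c = p then α else 0) + (if c = q then β else 0))
    (hp : p ∈ Finset.Icc 1 M ∨ ψ p = 0) (hq : q ∈ Finset.Icc 1 M ∨ ψ q = 0) :
    ∑ c ∈ Finset.Icc 1 M, E c * ψ c = α * ψ p + β * ψ q := by
  have key : ∀ (γ : ℝ) (l : ℕ), (l ∈ Finset.Icc 1 M ∨ ψ l = 0) →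
      ∑ c ∈ Finset.Icc 1 M, (if c = l then γ else 0) * ψ c = γ * ψ l := by
    intro γ l hl
    simp only [ite_mul, zero_mul]
    rw [Finset.sum_ite_eq']
    split_ifs with hm
    · rfl
    · rw [hl.resolve_left hm, mul_zero]
  rw [Finset.sum_congr rfl fun c hc => by rw [h c hc, add_mul], Finset.sum_add_distrib,
    key _ _ hp, key _ _ hq]

lemma sum_range_ite {m N : ℕ} {γ δ : ℝ} {E : ℕ → ℝ}
    (h : ∀ a < m, (-1) ^ a * E a = (if a < N then γ else 0) + (if a = N then δ else 0))
    (hN : N < m) : ∑ a ∈ Finset.range m, (-1) ^ a * E a = N * γ + δ := by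
  rw [Finset.sum_congr rfl fun a ha => h a (Finset.mem_range.1 ha), Finset.sum_add_distrib,
    Finset.sum_ite_eq', if_pos (Finset.mem_range.2 hN), ← Finset.sum_filter, Finset.sum_const,
    nsmul_eq_mul]
  congr 3
  rw [show (Finset.range m).filter (fun a => a < N) = Finset.range N by
    ext a
    simp
    omega, Finset.card_range]

/-- Alternating sums of a matrix-vector product, computed columnwise. -/
lemma alternating_rowSum {E : ℕ → ℕ → ℝ} {m M : ℕ} {w : ℕ → ℝ}
    (h : ∀ c ∈ Finset.Icc 1 M, ∑ a ∈ Finset.range m, (-1) ^ a * E (a + 1) c = w c)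
    (ψ : ℕ → ℝ) : ∑ a ∈ Finset.range m, (-1) ^ a * rowSum E M ψ (a + 1) =
      ∑ c ∈ Finset.Icc 1 M, w c * ψ c := by
  simp only [rowSum, Finset.mul_sum]
  rw [Finset.sum_comm]
  refine Finset.sum_congr rfl fun c hc => ?_
  rw [← h c hc, Finset.sum_mul]
  exact Finset.sum_congr rfl fun a _ => by ring

lemma rowSum_pair (E : ℕ → ℕ → ℝ) (M : ℕ) (ψ : ℕ → ℝ) (r : ℕ) :
    ((r : ℝ) + 1) * (rowSum E M ψ (r + 1) + rowSum E M ψ (r + 2)) =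
      ∑ c ∈ Finset.Icc 1 M, ((r : ℝ) + 1) * (E (r + 1) c + E (r + 2) c) * ψ c := by
  rw [rowSum, rowSum, ← Finset.sum_add_distrib, Finset.mul_sum]
  exact Finset.sum_congr rfl fun c _ => by ring

lemma neg_one_pow_mul_self (n : ℕ) : ((-1 : ℝ)) ^ n * (-1) ^ n = 1 := by
  rw [← mul_pow]
  norm_num

lemma rowSum_entryB_pair {m r : ℕ} (hr : r + 2 ≤ m) {ψ : ℕ → ℝ} (h0 : ψ 0 = 0) :
    ((r : ℝ) + 1) * (rowSum (entryB m) m ψ (r + 1) + rowSum (entryB m) m ψ (r + 2)) =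
      -(ψ r + ψ (r + 1)) := by
  rw [rowSum_pair, sum_two_ite (α := -1) (β := -1) (p := r + 1) (q := r)]
  · ring
  · intro c hc
    have hc' := Finset.mem_Icc.1 hc
    have hn := neg_one_pow_mul_self r
    unfold entryB
    by_cases hm : c = m
    · rw [if_pos hm, if_pos hm, if_neg (by omega), if_neg (by omega)]
      ring
    rw [if_neg hm, if_neg hm]
    rcases lt_trichotomy c r with h | rfl | h
    · rw [if_neg (by omega), if_neg (by omega), if_neg (by omega), if_neg (by omega),
        if_neg (by omega), if_neg (by omega)]
      ring
    · rw [if_neg (by omega), if_pos rfl, if_neg (by omega), if_neg (by omega),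
        if_neg (by omega), if_pos rfl]
      push_cast
      field_simp
      ring
    · rcases eq_or_lt_of_le (Nat.succ_le_of_lt h) with h | h
      · rw [Nat.succ_eq_add_one] at h
        subst h
        rw [if_pos le_rfl, if_neg (by omega), if_pos rfl, if_pos rfl, if_neg (by omega),
          show r + 1 + (r + 1) + 1 = r + r + 3 by ring, pow_add, pow_add, hn]
        push_cast
        field_simp
        ring
      · rw [if_pos (by omega), if_pos (by omega), if_neg (by omega), if_neg (by omega)]
        ring
  · exact Or.inl (Finset.mem_Icc.2 (by omega))
  · rcases Nat.eq_zero_or_pos r with rfl | h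
    · exact Or.inr h0
    · exact Or.inl (Finset.mem_Icc.2 (by omega))

lemma alternating_rowSum_entryB {m : ℕ} {ψ : ℕ → ℝ} (hψ : ψ m = 0) :
    ∑ a ∈ Finset.range m, (-1) ^ a * rowSum (entryB m) m ψ (a + 1) = 0 := by
  rw [alternating_rowSum (w := fun c => if c = m then
    ∑ a ∈ Finset.range m, (-1) ^ a * entryB m (a + 1) m else 0)]
  · refine Finset.sum_eq_zero fun c _ => ?_
    split_ifs with h
    · rw [h, hψ, mul_zero]
    · rw [zero_mul]
  · intro c hc
    have hc' := Finset.mem_Icc.1 hc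
    split_ifs with hm
    · rw [hm]
    have hc0 : (c : ℝ) ≠ 0 := by
      have : c ≠ 0 := by omega
      exact_mod_cast this
    rw [sum_range_ite (N := c) (γ := (-1) ^ c / (c * (c + 1))) (δ := -(-1) ^ c / (c + 1)) _
      (by omega)]
    · field_simp
      ring
    · intro a _
      have hn := neg_one_pow_mul_self a
      unfold entryB
      rw [if_neg hm]
      rcases lt_trichotomy a c with h | rfl | h
      · rw [if_pos (by omega), if_pos h, if_neg (by omega),
          show a + 1 + c + 1 = a + c + 2 by ring, pow_add, pow_add]
        linear_combination (((-1 : ℝ)) ^ c / (c * (c + 1))) * hn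
      · rw [if_neg (by omega), if_pos rfl, if_neg (by omega), if_pos rfl]
        push_cast
        ring
      · rw [if_neg (by omega), if_neg (by omega), if_neg (by omega), if_neg (by omega)]
        ring

lemma rowSum_entryC1_pair (k : ℕ) {m r : ℕ} (hr : r + 2 ≤ m) {ψ : ℕ → ℝ} (h0 : ψ 0 = 0) :
    ((r : ℝ) + 1) * (rowSum (entryC1 k m) (m - 1) ψ (r + 1) +
      rowSum (entryC1 k m) (m - 1) ψ (r + 2)) =
      -(2 * k * r - r ^ 2) * ψ (r + 1) - (r * (2 * k - r) + m - 1) * ψ r := by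
  rw [rowSum_pair, sum_two_ite (α := -(2 * k * r - r ^ 2)) (β := -(r * (2 * k - r) + m - 1))
    (p := r + 1) (q := r)]
  · ring
  · intro c hc
    have hc' := Finset.mem_Icc.1 hc
    have hn := neg_one_pow_mul_self r
    unfold entryC1
    rcases lt_trichotomy c r with h | rfl | h
    · rw [if_neg (by omega), if_neg (by omega), if_neg (by omega), if_neg (by omega),
        if_neg (by omega), if_neg (by omega)]
      ring
    · rw [if_neg (by omega), if_pos rfl, if_neg (by omega), if_neg (by omega),
        if_neg (by omega), if_pos rfl]
      field_simp
      ring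
    · rcases eq_or_lt_of_le (Nat.succ_le_of_lt h) with h | h
      · rw [Nat.succ_eq_add_one] at h
        subst h
        rw [if_pos le_rfl, if_neg (by omega), if_pos rfl, if_pos rfl, if_neg (by omega),
          show r + 1 + (r + 1) = r + r + 2 by ring, pow_add, pow_add, hn]
        push_cast
        field_simp
        ring
      · rw [if_pos (by omega), if_pos (by omega), if_neg (by omega), if_neg (by omega)]
        ring
  · exact Or.inl (Finset.mem_Icc.2 (by omega))
  · rcases Nat.eq_zero_or_pos r with rfl | h
    · exact Or.inr h0
    · exact Or.inl (Finset.mem_Icc.2 (by omega))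

lemma alternating_rowSum_entryC1 (k : ℕ) {m : ℕ} (ψ : ℕ → ℝ) :
    ∑ a ∈ Finset.range m, (-1) ^ a * rowSum (entryC1 k m) (m - 1) ψ (a + 1) =
      ∑ c ∈ Finset.Icc 1 (m - 1), (-1) ^ (c + 1) * (2 * k - 2 * c + m) * ψ c := by
  refine alternating_rowSum (fun c hc => ?_) ψ
  have hc' := Finset.mem_Icc.1 hc
  have hc0 : (c : ℝ) ≠ 0 := by
    have : c ≠ 0 := by omega
    exact_mod_cast this
  rw [sum_range_ite (N := c)
    (γ := (-1) ^ (c + 1) * (((m : ℝ) - 1 - c) / (c + 1) + (2 * (k : ℝ) - c + 1) / (c * (c + 1))))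
    (δ := (-1) ^ (c + 1) * (1 / ((c : ℝ) + 1) * (c * (2 * (k : ℝ) - c) + m - 1))) _ (by omega)]
  · field_simp
    ring
  · intro a _
    have hn := neg_one_pow_mul_self a
    unfold entryC1
    rcases lt_trichotomy a c with h | rfl | h
    · rw [if_pos (by omega), if_pos h, if_neg (by omega),
        show a + 1 + c = a + (c + 1) by ring, pow_add]
      linear_combination (((-1 : ℝ)) ^ (c + 1) * (((m : ℝ) - 1 - c) / (c + 1) +
        (2 * (k : ℝ) - c + 1) / (c * (c + 1)))) * hn
    · rw [if_neg (by omega), if_pos rfl, if_neg (by omega), if_pos rfl]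
      ring
    · rw [if_neg (by omega), if_neg (by omega), if_neg (by omega), if_neg (by omega)]
      ring

lemma rowSum_entryC2_pair (k : ℕ) {m r : ℕ} (hr : r + 2 ≤ m) {ψ : ℕ → ℝ} (h0 : ψ 0 = 0) :
    ((r : ℝ) + 1) * (rowSum (entryC2 k) (m - 2) ψ (r + 1) +
      rowSum (entryC2 k) (m - 2) ψ (r + 2)) = (r - 1 - k) * (ψ r + ψ (r - 1)) := by
  rw [rowSum_pair, sum_two_ite (α := (r - 1 - k : ℝ)) (β := (r - 1 - k : ℝ))
    (p := r) (q := r - 1)]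
  · ring
  · intro c hc
    have hc' := Finset.mem_Icc.1 hc
    unfold entryC2
    rcases lt_trichotomy c r with h | rfl | h
    · rcases eq_or_lt_of_le (Nat.succ_le_of_lt h) with h | h
      · rw [Nat.succ_eq_add_one] at h
        subst h
        rw [if_neg (by omega), if_pos rfl, if_neg (by omega), if_neg (by omega),
          if_neg (by omega), if_pos (by omega)]
        push_cast
        field_simp
        ring
      · rw [if_neg (by omega), if_neg (by omega), if_neg (by omega), if_neg (by omega),
          if_neg (by omega), if_neg (by omega)]
        ring
    · have hn := neg_one_pow_mul_self c
      rw [if_pos le_rfl, if_neg (by omega), if_pos rfl, if_pos rfl, if_neg (by omega),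
        show c + 1 + c = c + c + 1 by ring, pow_add, pow_add, hn]
      push_cast
      field_simp
      ring
    · rw [if_pos (by omega), if_pos (by omega), if_neg (by omega), if_neg (by omega)]
      ring
  · rcases Nat.eq_zero_or_pos r with rfl | h
    · exact Or.inr h0
    · exact Or.inl (Finset.mem_Icc.2 (by omega))
  · rcases Nat.lt_or_ge r 2 with h | h
    · rw [show r - 1 = 0 by omega]
      exact Or.inr h0
    · exact Or.inl (Finset.mem_Icc.2 (by omega))

lemma alternating_rowSum_entryC2 (k : ℕ) {m : ℕ} (ψ : ℕ → ℝ) :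
    ∑ a ∈ Finset.range m, (-1) ^ a * rowSum (entryC2 k) (m - 2) ψ (a + 1) =
      ∑ c ∈ Finset.Icc 1 (m - 2), (-1) ^ (c + 1) * ψ c := by
  refine alternating_rowSum (fun c hc => ?_) ψ
  have hc' := Finset.mem_Icc.1 hc
  rw [sum_range_ite (N := c + 1)
    (γ := (-1) ^ (c + 1) * (((k : ℝ) + 2) / ((c + 1) * (c + 2))))
    (δ := (-1) ^ (c + 1) * (((c : ℝ) - k) / (c + 2))) _ (by omega)]
  · push_cast
    field_simp
    ring
  · intro a _
    have hn := neg_one_pow_mul_self a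
    unfold entryC2
    rcases lt_trichotomy a (c + 1) with h | rfl | h
    · rw [if_pos (by omega), if_pos h, if_neg (by omega),
        show a + 1 + c = a + (c + 1) by ring, pow_add]
      linear_combination (((-1 : ℝ)) ^ (c + 1) * (((k : ℝ) + 2) / ((c + 1) * (c + 2)))) * hn
    · rw [if_neg (by omega), if_pos rfl, if_neg (by omega), if_pos rfl]
      push_cast
      field_simp
      ring
    · rw [if_neg (by omega), if_neg (by omega), if_neg (by omega), if_neg (by omega)]
      ring

lemma rowSum_entryC3_pair {m r : ℕ} (hr1 : 1 ≤ r) (hr : r + 2 ≤ m) (ψ : ℕ → ℝ) :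
    ((r : ℝ) + 1) * (rowSum entryC3 (m + 1) ψ (r + 1) + rowSum entryC3 (m + 1) ψ (r + 2)) =
      (r + 2) * (ψ (r + 2) + ψ (r + 3)) := by
  rw [rowSum_pair, sum_two_ite (α := (r + 2 : ℝ)) (β := (r + 2 : ℝ)) (p := r + 2) (q := r + 3)]
  · ring
  · intro c hc
    have hr0 : (r : ℝ) ≠ 0 := by
      have : r ≠ 0 := by omega
      exact_mod_cast this
    unfold entryC3
    rw [if_neg (show ¬(r + 1 = 1 ∧ (c = 1 ∨ c = 2)) by omega),
      if_neg (show ¬(r + 2 = 1 ∧ (c = 1 ∨ c = 2)) by omega)]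
    rcases lt_trichotomy c (r + 2) with h | rfl | h
    · rw [if_neg (by omega), if_neg (by omega), if_neg (by omega), if_neg (by omega),
        if_neg (by omega), if_neg (by omega)]
      ring
    · rw [if_neg (by omega), if_pos rfl, if_neg (by omega), if_neg (by omega), if_pos rfl,
        if_neg (by omega)]
      push_cast
      rw [show (r : ℝ) + 2 - 1 = r + 1 by ring]
      field_simp
      ring
    · rcases eq_or_lt_of_le (Nat.succ_le_of_lt h) with h | h
      · rw [Nat.succ_eq_add_one] at h
        subst h
        have hn := neg_one_pow_mul_self r
        rw [if_pos (by omega), if_neg (by omega), if_pos rfl, if_neg (by omega), if_pos rfl,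
          show r + 1 + (r + 2 + 1) = r + r + 4 by ring, pow_add, pow_add, hn]
        push_cast
        rw [show (r : ℝ) + 2 + 1 - 1 = r + 2 by ring, show (r : ℝ) + 2 + 1 - 2 = r + 1 by ring]
        field_simp
        ring
      · rw [if_pos (by omega), if_pos (by omega), if_neg (by omega), if_neg (by omega)]
        ring
  · exact Or.inl (Finset.mem_Icc.2 (by omega))
  · exact Or.inl (Finset.mem_Icc.2 (by omega))

lemma rowSum_entryC3_pair_zero {m : ℕ} (hm : 2 ≤ m) (ψ : ℕ → ℝ) :
    rowSum entryC3 (m + 1) ψ 1 + rowSum entryC3 (m + 1) ψ 2 = -ψ 1 + ψ 2 + 2 * ψ 3 := by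
  have h := sum_two_ite (M := m + 1) (E := fun c => entryC3 1 c + entryC3 2 c -
    (if c = 3 then 2 else 0)) (ψ := ψ) (α := -1) (β := 1) (p := 1) (q := 2)
    (fun c hc => by
      have hc' := Finset.mem_Icc.1 hc
      simp only [entryC3]
      rcases Nat.lt_or_ge 3 c with h | h
      · rw [if_neg (by omega), if_pos (by omega), if_neg (by omega), if_pos (by omega),
          if_neg (by omega), if_neg (by omega), if_neg (by omega)]
        ring
      · obtain ⟨h1, _⟩ := hc'
        interval_cases c <;> norm_num)
    (Or.inl (Finset.mem_Icc.2 (by omega))) (Or.inl (Finset.mem_Icc.2 (by omega)))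
  have h3 : ∑ c ∈ Finset.Icc 1 (m + 1), (if c = 3 then (2 : ℝ) else 0) * ψ c = 2 * ψ 3 := by
    simp only [ite_mul, zero_mul]
    rw [Finset.sum_ite_eq', if_pos (Finset.mem_Icc.2 (by omega))]
  simp only [sub_mul, add_mul, Finset.sum_sub_distrib, Finset.sum_add_distrib, h3] at h
  rw [rowSum, rowSum]
  linear_combination h

lemma alternating_rowSum_entryC3 {m : ℕ} (hm : 1 ≤ m) (ψ : ℕ → ℝ) :
    ∑ a ∈ Finset.range m, (-1) ^ a * rowSum entryC3 (m + 1) ψ (a + 1) =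
      ∑ c ∈ Finset.Icc 1 (m + 1), (-1) ^ c * ψ c := by
  refine alternating_rowSum (fun c hc => ?_) ψ
  have hc' := Finset.mem_Icc.1 hc
  rcases Nat.lt_or_ge c 3 with h3 | h3
  · rw [sum_range_ite (N := 0) (γ := 0) (δ := (-1) ^ c) _ (by omega)]
    · simp
    · intro a _
      unfold entryC3
      rcases Nat.eq_zero_or_pos a with rfl | ha
      · rw [if_pos (by omega), if_neg (by omega), if_pos rfl]
        ring
      · rw [if_neg (by omega), if_neg (by omega), if_neg (by omega), if_neg (by omega),
          if_neg (by omega)]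
        ring
  · obtain ⟨d, rfl⟩ : ∃ d, c = d + 3 := ⟨c - 3, by omega⟩
    rw [sum_range_ite (N := d + 1) (γ := (-1) ^ d / ((d + 2) * (d + 1)))
      (δ := -(-1) ^ d * ((d + 3) / (d + 2))) _ (by omega)]
    · push_cast
      field_simp
      ring
    · intro a _
      have hn := neg_one_pow_mul_self a
      unfold entryC3
      rw [if_neg (by omega)]
      rcases lt_trichotomy a (d + 1) with h | rfl | h
      · rw [if_pos (by omega), if_pos h, if_neg (by omega),
          show a + 1 + (d + 3) = a + d + 4 by ring, pow_add, pow_add]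
        push_cast
        rw [show (d : ℝ) + 3 - 1 = d + 2 by ring, show (d : ℝ) + 3 - 2 = d + 1 by ring]
        linear_combination (((-1 : ℝ)) ^ d / ((d + 2) * (d + 1))) * hn
      · rw [if_neg (by omega), if_pos rfl, if_neg (by omega), if_pos rfl]
        push_cast
        rw [show (d : ℝ) + 3 - 1 = d + 2 by ring]
        ring
      · rw [if_neg (by omega), if_neg (by omega), if_neg (by omega), if_neg (by omega)]
        ring

lemma rowSum_entryC4_pair {m r : ℕ} (hr1 : 1 ≤ r) (hr : r + 2 ≤ m) (ψ : ℕ → ℝ) :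
    ((r : ℝ) + 1) * (rowSum entryC4 (m + 2) ψ (r + 1) + rowSum entryC4 (m + 2) ψ (r + 2)) =
      (r + 3) * (ψ (r + 3) + ψ (r + 4)) := by
  rw [rowSum_pair, sum_two_ite (α := (r + 3 : ℝ)) (β := (r + 3 : ℝ)) (p := r + 3) (q := r + 4)]
  · ring
  · intro c hc
    unfold entryC4
    rw [if_neg (show ¬(r + 1 = 1 ∧ (c = 1 ∨ c = 2 ∨ c = 3)) by omega),
      if_neg (show ¬(r + 2 = 1 ∧ (c = 1 ∨ c = 2 ∨ c = 3)) by omega)]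
    rcases lt_trichotomy c (r + 3) with h | rfl | h
    · rw [if_neg (by omega), if_neg (by omega), if_neg (by omega), if_neg (by omega),
        if_neg (by omega), if_neg (by omega)]
      ring
    · rw [if_neg (by omega), if_pos rfl, if_neg (by omega), if_neg (by omega), if_pos rfl,
        if_neg (by omega)]
      push_cast
      field_simp
      ring
    · rcases eq_or_lt_of_le (Nat.succ_le_of_lt h) with h | h
      · rw [Nat.succ_eq_add_one] at h
        subst h
        have hn := neg_one_pow_mul_self r
        rw [if_pos (by omega), if_neg (by omega), if_pos rfl, if_neg (by omega), if_pos rfl,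
          show r + 1 + (r + 3 + 1) + 1 = r + r + 6 by ring, pow_add, pow_add, hn]
        push_cast
        rw [show (r : ℝ) + 3 + 1 - 2 = r + 2 by ring, show (r : ℝ) + 3 + 1 - 3 = r + 1 by ring]
        field_simp
        ring
      · rw [if_pos (by omega), if_pos (by omega), if_neg (by omega), if_neg (by omega)]
        ring
  · exact Or.inl (Finset.mem_Icc.2 (by omega))
  · exact Or.inl (Finset.mem_Icc.2 (by omega))

lemma rowSum_entryC4_pair_zero {m : ℕ} (hm : 2 ≤ m) (ψ : ℕ → ℝ) :
    rowSum entryC4 (m + 2) ψ 1 + rowSum entryC4 (m + 2) ψ 2 =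
      ψ 1 - ψ 2 + ψ 3 + 3 * ψ 4 := by
  have h := sum_two_ite (M := m + 2) (E := fun c => entryC4 1 c + entryC4 2 c -
    (if c = 3 then 1 else 0) - (if c = 4 then 3 else 0)) (ψ := ψ) (α := 1) (β := -1)
    (p := 1) (q := 2)
    (fun c hc => by
      have hc' := Finset.mem_Icc.1 hc
      simp only [entryC4]
      rcases Nat.lt_or_ge 4 c with h | h
      · rw [if_neg (by omega), if_pos (by omega), if_neg (by omega), if_pos (by omega),
          if_neg (by omega), if_neg (by omega), if_neg (by omega), if_neg (by omega)]
        ring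
      · obtain ⟨h1, _⟩ := hc'
        interval_cases c <;> norm_num)
    (Or.inl (Finset.mem_Icc.2 (by omega))) (Or.inl (Finset.mem_Icc.2 (by omega)))
  have h3 : ∑ c ∈ Finset.Icc 1 (m + 2), (if c = 3 then (1 : ℝ) else 0) * ψ c = ψ 3 := by
    simp only [ite_mul, zero_mul]
    rw [Finset.sum_ite_eq', if_pos (Finset.mem_Icc.2 (by omega)), one_mul]
  have h4 : ∑ c ∈ Finset.Icc 1 (m + 2), (if c = 4 then (3 : ℝ) else 0) * ψ c = 3 * ψ 4 := by
    simp only [ite_mul, zero_mul]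
    rw [Finset.sum_ite_eq', if_pos (Finset.mem_Icc.2 (by omega))]
  simp only [sub_mul, add_mul, Finset.sum_sub_distrib, Finset.sum_add_distrib, h3, h4] at h
  rw [rowSum, rowSum]
  linear_combination h

lemma alternating_rowSum_entryC4 {m : ℕ} (hm : 1 ≤ m) (ψ : ℕ → ℝ) :
    ∑ a ∈ Finset.range m, (-1) ^ a * rowSum entryC4 (m + 2) ψ (a + 1) =
      ∑ c ∈ Finset.Icc 1 (m + 2), (-1) ^ (c + 1) * ψ c := by
  refine alternating_rowSum (fun c hc => ?_) ψ
  have hc' := Finset.mem_Icc.1 hc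
  rcases Nat.lt_or_ge c 4 with h3 | h3
  · rw [sum_range_ite (N := 0) (γ := 0) (δ := (-1) ^ (c + 1)) _ (by omega)]
    · simp
    · intro a _
      unfold entryC4
      rcases Nat.eq_zero_or_pos a with rfl | ha
      · rw [if_pos (by omega), if_neg (by omega), if_pos rfl]
        ring
      · rw [if_neg (by omega), if_neg (by omega), if_neg (by omega), if_neg (by omega),
          if_neg (by omega)]
        ring
  · obtain ⟨d, rfl⟩ : ∃ d, c = d + 4 := ⟨c - 4, by omega⟩
    rw [sum_range_ite (N := d + 1) (γ := (-1) ^ d * (2 / ((d + 2) * (d + 1))))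
      (δ := -(-1) ^ d * ((d + 4) / (d + 2))) _ (by omega)]
    · push_cast
      field_simp
      ring
    · intro a _
      have hn := neg_one_pow_mul_self a
      unfold entryC4
      rw [if_neg (by omega)]
      rcases lt_trichotomy a (d + 1) with h | rfl | h
      · rw [if_pos (by omega), if_pos h, if_neg (by omega),
          show a + 1 + (d + 4) + 1 = a + d + 6 by ring, pow_add, pow_add]
        push_cast
        rw [show (d : ℝ) + 4 - 2 = d + 2 by ring, show (d : ℝ) + 4 - 3 = d + 1 by ring]
        linear_combination (((-1 : ℝ)) ^ d * (2 / ((d + 2) * (d + 1)))) * hn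
      · rw [if_neg (by omega), if_pos rfl, if_neg (by omega), if_pos rfl]
        push_cast
        field_simp
        ring
      · rw [if_neg (by omega), if_neg (by omega), if_neg (by omega), if_neg (by omega)]
        ring

/-- A vector is determined by the sums of its consecutive entries and its alternating sum. -/
lemma eq_zero_of_pair_of_alternating {m : ℕ} {u : ℕ → ℝ}
    (h1 : ∀ r, r + 2 ≤ m → ((r : ℝ) + 1) * (u r + u (r + 1)) = 0)
    (h2 : ∑ a ∈ Finset.range m, (-1) ^ a * u a = 0) {a : ℕ} (ha : a < m) : u a = 0 := by
  have h : ∀ r, r < m → u r = (-1) ^ r * u 0 := by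
    intro r
    induction r with
    | zero => simp
    | succ r ih =>
      intro hr
      have hp : ((r : ℝ) + 1) ≠ 0 := by positivity
      have hs := (mul_eq_zero.1 (h1 r (by omega))).resolve_left hp
      rw [pow_succ]
      linear_combination hs - ih (by omega)
  have hu : u 0 = 0 := by
    have hs : ∑ a ∈ Finset.range m, (-1) ^ a * u a = m * u 0 := by
      rw [Finset.sum_congr rfl fun a ha => by
        rw [h a (Finset.mem_range.1 ha), ← mul_assoc, neg_one_pow_mul_self, one_mul]]
      simp
    rw [hs] at h2
    have hm : (m : ℝ) ≠ 0 := by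
      have : m ≠ 0 := by omega
      exact_mod_cast this
    exact (mul_eq_zero.1 h2).resolve_left hm
  rw [h a ha, hu, mul_zero]

/-! ### The recursive formula -/

lemma diffOp_congr {φ χ : ℝ → ℝ} (h : ∀ y, 0 < y → φ y = χ y) (c : ℝ) {x : ℝ} (hx : 0 < x) :
    diffOp c φ x = diffOp c χ x := by
  have he : φ =ᶠ[nhds x] χ := by
    filter_upwards [lt_mem_nhds hx] with y hy
    exact h y hy
  rw [diffOp, diffOp, he.deriv_eq, h x hx]

lemma colVec_congr {φ χ : ℕ → ℝ} {i M : ℕ} (h : ∀ q, i ≤ q → q ≤ M → φ q = χ q) (n : ℕ) :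
    colVec φ i M n = colVec χ i M n := by
  funext a
  rw [colVec, colVec]
  split_ifs with ha
  · exact h _ (by omega) ha
  · rfl

/-- The right-hand side of the recursive formula. -/
noncomputable def recursionRHS (k : ℕ) (f : ℕ → ℕ → ℕ → ℕ → ℝ → ℝ) (n₁ n₂ m : ℕ) (x : ℝ) :
    Fin m → ℝ :=
  -(√x • (matB m).mulVec
      (colVec (fun q => diffOp ((k : ℝ) ^ 2 + m - 1 - 2 * n₁ - 3 * n₂) (f n₁ n₂ (m - 1) q) x)
        1 (m - 1) m))
  - (1 / √x) • (matC1 k m).mulVec (colVec (fun q => f n₁ n₂ (m - 1) q x) 1 (m - 1) (m - 1))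
  + (matC2 k m).mulVec (colVec (fun q => f n₁ n₂ (m - 2) q x) 1 (m - 2) (m - 2))
  + (2 * n₁ / √x) •
      (matC3 m).mulVec (colVec (fun q => f (n₁ - 1) n₂ (m + 1) q x) 1 (m + 1) (m + 1))
  - (3 * n₂ / √x) •
      (matC4 m).mulVec (colVec (fun q => f n₁ (n₂ - 1) (m + 2) q x) 1 (m + 2) (m + 2))
  + (2 * n₁ : ℝ) • (matB m).mulVec
      (colVec (fun q => diffOp ((k : ℝ) ^ 2 + m + 2 * n₁ + 3 * n₂ - 2) (f (n₁ - 1) n₂ m q) x)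
        2 m m)
  + (3 * n₂ / √x) • (matB m).mulVec (colVec (fun q => f (n₁ + 1) (n₂ - 1) m q x) 2 m m)
  - (3 * n₂ : ℝ) • (matB m).mulVec
      (colVec (fun q => diffOp ((k : ℝ) ^ 2 + m + 1) (f n₁ (n₂ - 1) (m + 1) q) x) 3 (m + 1) m)
  + (3 * n₁ * n₂ / x) •
      (matB m).mulVec (colVec (fun q => f n₁ (n₂ - 1) (m + 1) q x) 3 (m + 1) m)
  + (9 * n₂ * ((n₂ : ℝ) - 1) / (2 * x)) •
      (matB m).mulVec (colVec (fun q => f n₁ (n₂ - 1) (m + 1) q x) 3 (m + 1) m)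

lemma hookRecursion_iff (k : ℕ) (f : ℕ → ℕ → ℕ → ℕ → ℝ → ℝ) :
    HookRecursion k f ↔ ∀ n₁ n₂ m : ℕ, 3 ≤ m → ∀ x : ℝ, 0 < x →
      colVec (fun q => f n₁ n₂ m q x) 1 m m = recursionRHS k f n₁ n₂ m x := Iff.rfl

/-- Two families agree in the indices `n₁`, `n₂`, `m`. -/
def AgreeAt (f g : ℕ → ℕ → ℕ → ℕ → ℝ → ℝ) (n₁ n₂ m : ℕ) : Prop :=
  ∀ q, 1 ≤ q → q ≤ m → ∀ y, 0 < y → f n₁ n₂ m q y = g n₁ n₂ m q y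

lemma recursionRHS_congr (k : ℕ) {f g : ℕ → ℕ → ℕ → ℕ → ℝ → ℝ} {n₁ n₂ m : ℕ}
    (h1 : AgreeAt f g n₁ n₂ (m - 1)) (h2 : AgreeAt f g n₁ n₂ (m - 2))
    (h3 : n₁ ≠ 0 → AgreeAt f g (n₁ - 1) n₂ (m + 1)) (h4 : n₁ ≠ 0 → AgreeAt f g (n₁ - 1) n₂ m)
    (h5 : n₂ ≠ 0 → ∀ n m, AgreeAt f g n (n₂ - 1) m) {x : ℝ} (hx : 0 < x) :
    recursionRHS k f n₁ n₂ m x = recursionRHS k g n₁ n₂ m x := by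
  have e1 : ∀ c : ℝ, colVec (fun q => diffOp c (f n₁ n₂ (m - 1) q) x) 1 (m - 1) m =
      colVec (fun q => diffOp c (g n₁ n₂ (m - 1) q) x) 1 (m - 1) m := fun c =>
    colVec_congr (fun q ha hb => diffOp_congr (h1 q ha hb) c hx) m
  have e2 : colVec (fun q => f n₁ n₂ (m - 1) q x) 1 (m - 1) (m - 1) =
      colVec (fun q => g n₁ n₂ (m - 1) q x) 1 (m - 1) (m - 1) :=
    colVec_congr (fun q ha hb => h1 q ha hb x hx) _
  have e3 : colVec (fun q => f n₁ n₂ (m - 2) q x) 1 (m - 2) (m - 2) =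
      colVec (fun q => g n₁ n₂ (m - 2) q x) 1 (m - 2) (m - 2) :=
    colVec_congr (fun q ha hb => h2 q ha hb x hx) _
  have e4 : (2 * n₁ / √x : ℝ) • (matC3 m).mulVec
      (colVec (fun q => f (n₁ - 1) n₂ (m + 1) q x) 1 (m + 1) (m + 1)) =
      (2 * n₁ / √x : ℝ) • (matC3 m).mulVec
      (colVec (fun q => g (n₁ - 1) n₂ (m + 1) q x) 1 (m + 1) (m + 1)) := by
    rcases eq_or_ne n₁ 0 with rfl | hn
    · simp
    · rw [colVec_congr (fun q ha hb => h3 hn q ha hb x hx) _]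
  have e5 : ∀ c : ℝ, (2 * n₁ : ℝ) • (matB m).mulVec
      (colVec (fun q => diffOp c (f (n₁ - 1) n₂ m q) x) 2 m m) =
      (2 * n₁ : ℝ) • (matB m).mulVec
      (colVec (fun q => diffOp c (g (n₁ - 1) n₂ m q) x) 2 m m) := fun c => by
    rcases eq_or_ne n₁ 0 with rfl | hn
    · simp
    · rw [colVec_congr (fun q ha hb => diffOp_congr (h4 hn q (by omega) hb) c hx) m]
  rw [recursionRHS, recursionRHS, e1, e2, e3, e4, e5]
  rcases eq_or_ne n₂ 0 with rfl | hn
  · simp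
  · have a1 : colVec (fun q => f n₁ (n₂ - 1) (m + 2) q x) 1 (m + 2) (m + 2) =
        colVec (fun q => g n₁ (n₂ - 1) (m + 2) q x) 1 (m + 2) (m + 2) :=
      colVec_congr (fun q ha hb => h5 hn _ _ q (by omega) hb x hx) _
    have a2 : colVec (fun q => f (n₁ + 1) (n₂ - 1) m q x) 2 m m =
        colVec (fun q => g (n₁ + 1) (n₂ - 1) m q x) 2 m m :=
      colVec_congr (fun q ha hb => h5 hn _ _ q (by omega) hb x hx) _
    have a3 : colVec (fun q => f n₁ (n₂ - 1) (m + 1) q x) 3 (m + 1) m =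
        colVec (fun q => g n₁ (n₂ - 1) (m + 1) q x) 3 (m + 1) m :=
      colVec_congr (fun q ha hb => h5 hn _ _ q (by omega) hb x hx) _
    have a4 : ∀ c : ℝ, colVec (fun q => diffOp c (f n₁ (n₂ - 1) (m + 1) q) x) 3 (m + 1) m =
        colVec (fun q => diffOp c (g n₁ (n₂ - 1) (m + 1) q) x) 3 (m + 1) m := fun c =>
      colVec_congr (fun q ha hb => diffOp_congr (h5 hn _ _ q (by omega) hb) c hx) m
    rw [a1, a2, a3, a4]

/-- The averages of hook Schur polynomials. They extend `hookDeriv` to the index `q = 0`. -/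
noncomputable def hookAvg (k n₁ n₂ m q : ℕ) (x : ℝ) : ℝ := avg k n₁ n₂ x (hookPoly k m q)

lemma hookDeriv_eq_hookAvg (k n₁ n₂ : ℕ) {m q : ℕ} (hq : 1 ≤ q) (hqm : q ≤ m) {x : ℝ}
    (hx : 0 < x) : hookDeriv k n₁ n₂ m q x = hookAvg k n₁ n₂ m q x :=
  hookDeriv_eq n₁ n₂ hq hqm hx.le

section

variable {k : ℕ}

lemma avg_elem_mul_comp_eq (n₁ n₂ : ℕ) (x : ℝ) {a r M : ℕ} (hM : M = a + r + 1) :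
    avg k n₁ n₂ x (elem k r * comp k (a + 1)) =
      hookAvg k n₁ n₂ M r x + hookAvg k n₁ n₂ M (r + 1) x := by
  rw [elem_mul_comp_eq_hookPoly, map_add, hM]
  rfl

lemma avg_psum_one_mul_hookPoly (n₁ n₂ : ℕ) {x : ℝ} (hx : 0 < x) {m q : ℕ} (hqm : q ≤ m) :
    avg k n₁ n₂ x (psum (Fin k) ℝ 1 * hookPoly k m q) =
      √x * diffOp ((k : ℝ) ^ 2 + m + 2 * n₁ + 3 * n₂) (hookAvg k n₁ n₂ m q) x :=
  avg_psum_one_mul n₁ n₂ hx (euler_hookPoly hqm)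

lemma avg_psum_one_mul_elem_mul_comp (n₁ n₂ : ℕ) {x : ℝ} (hx : 0 < x) {a r M : ℕ}
    (hM : M = a + r + 1) :
    avg k n₁ n₂ x (psum (Fin k) ℝ 1 * (elem k r * comp k (a + 1))) =
      √x * (diffOp ((k : ℝ) ^ 2 + M + 2 * n₁ + 3 * n₂) (hookAvg k n₁ n₂ M r) x +
        diffOp ((k : ℝ) ^ 2 + M + 2 * n₁ + 3 * n₂) (hookAvg k n₁ n₂ M (r + 1)) x) := by
  rw [elem_mul_comp_eq_hookPoly, mul_add, map_add, ← hM,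
    avg_psum_one_mul_hookPoly _ _ hx (by omega), avg_psum_one_mul_hookPoly _ _ hx (by omega)]
  ring

/-- The sum of two consecutive hook averages of size `m`, in terms of hooks of other sizes. -/
lemma hookAvg_pair (n₁ n₂ : ℕ) {M b : ℕ} (hb : b ≤ M) {x : ℝ} (hx : 0 < x) :
    ((b : ℝ) + 2) * (hookAvg k n₁ n₂ (M + 3) (b + 2) x + hookAvg k n₁ n₂ (M + 3) (b + 3) x) =
      -√x * (-(diffOp ((k : ℝ) ^ 2 + (M + 3) - 1 - 2 * n₁ - 3 * n₂)
            (hookAvg k n₁ n₂ (M + 2) (b + 1)) x +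
          diffOp ((k : ℝ) ^ 2 + (M + 3) - 1 - 2 * n₁ - 3 * n₂)
            (hookAvg k n₁ n₂ (M + 2) (b + 2)) x))
      - 1 / √x * (-(2 * k * (b + 1) - (b + 1) ^ 2) * hookAvg k n₁ n₂ (M + 2) (b + 2) x -
          ((b + 1) * (2 * k - (b + 1)) + (M + 3) - 1) * hookAvg k n₁ n₂ (M + 2) (b + 1) x)
      + ((b + 1) - 1 - k) * (hookAvg k n₁ n₂ (M + 1) (b + 1) x + hookAvg k n₁ n₂ (M + 1) b x)
      + 2 * n₁ / √x * (((b + 1) + 2) * (hookAvg k (n₁ - 1) n₂ (M + 4) (b + 3) x +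
          hookAvg k (n₁ - 1) n₂ (M + 4) (b + 4) x))
      - 3 * n₂ / √x * (((b + 1) + 3) * (hookAvg k n₁ (n₂ - 1) (M + 5) (b + 4) x +
          hookAvg k n₁ (n₂ - 1) (M + 5) (b + 5) x))
      + 2 * n₁ * (-(diffOp ((k : ℝ) ^ 2 + (M + 3) + 2 * n₁ + 3 * n₂ - 2)
            (hookAvg k (n₁ - 1) n₂ (M + 3) (b + 2)) x +
          diffOp ((k : ℝ) ^ 2 + (M + 3) + 2 * n₁ + 3 * n₂ - 2)
            (hookAvg k (n₁ - 1) n₂ (M + 3) (b + 3)) x))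
      + 3 * n₂ / √x * (-(hookAvg k (n₁ + 1) (n₂ - 1) (M + 3) (b + 2) x +
          hookAvg k (n₁ + 1) (n₂ - 1) (M + 3) (b + 3) x))
      - 3 * n₂ * (-(diffOp ((k : ℝ) ^ 2 + (M + 3) + 1)
            (hookAvg k n₁ (n₂ - 1) (M + 4) (b + 3)) x +
          diffOp ((k : ℝ) ^ 2 + (M + 3) + 1)
            (hookAvg k n₁ (n₂ - 1) (M + 4) (b + 4)) x))
      + 3 * n₁ * n₂ / x * (-(hookAvg k n₁ (n₂ - 1) (M + 4) (b + 3) x +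
          hookAvg k n₁ (n₂ - 1) (M + 4) (b + 4) x))
      + 9 * n₂ * ((n₂ : ℝ) - 1) / (2 * x) * (-(hookAvg k n₁ (n₂ - 1) (M + 4) (b + 3) x +
          hookAvg k n₁ (n₂ - 1) (M + 4) (b + 4) x)) := by
  obtain ⟨a, rfl⟩ : ∃ a, M = a + b := ⟨M - b, by omega⟩
  have h := avg_elem_mul_comp (k := k) n₁ n₂ a (b + 1) hx
  have hd : avg k n₁ n₂ x ((∑ i, pderiv i (elem k (b + 1))) * comp k (a + 1)) =
      ((k : ℝ) - b) * avg k n₁ n₂ x (elem k b * comp k (a + 1)) := by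
    rw [sum_pderiv_elem_succ, ← smul_eq_mul ((k : ℝ) - b), ← LinearMap.map_smul,
      Algebra.smul_def]
    congr 1
    simp only [map_sub, map_natCast]
    ring
  have hp : hookPoly k (a + (b + 1) + 1) (b + 1 + 1) = hookPoly k (a + b + 2) (b + 2) := rfl
  have hp' : avg k n₁ n₂ x (hookPoly k (a + b + 2) (b + 2)) =
    hookAvg k n₁ n₂ (a + b + 2) (b + 2) x := rfl
  rw [hd, hp, hp',
    avg_elem_mul_comp_eq n₁ n₂ x (show a + b + 1 = a + b + 1 from rfl),
    avg_elem_mul_comp_eq n₁ n₂ x (show a + b + 2 = a + (b + 1) + 1 by ring),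
    avg_elem_mul_comp_eq n₁ n₂ x (show a + b + 3 = a + (b + 1 + 1) + 1 by ring),
    avg_elem_mul_comp_eq (n₁ + 1) (n₂ - 1) x (show a + b + 3 = a + (b + 1 + 1) + 1 by ring),
    avg_elem_mul_comp_eq (n₁ - 1) n₂ x (show a + b + 4 = a + (b + 1 + 2) + 1 by ring),
    avg_elem_mul_comp_eq n₁ (n₂ - 1) x (show a + b + 5 = a + (b + 1 + 3) + 1 by ring),
    avg_psum_one_mul_elem_mul_comp n₁ n₂ hx (show a + b + 2 = a + (b + 1) + 1 by ring),
    avg_psum_one_mul_elem_mul_comp (n₁ - 1) n₂ hx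
      (show a + b + 3 = a + (b + 1 + 1) + 1 by ring),
    avg_psum_one_mul_elem_mul_comp n₁ (n₂ - 1) hx
      (show a + b + 4 = a + (b + 1 + 2) + 1 by ring)] at h
  have c1 : ∀ φ : ℝ → ℝ, (n₁ : ℝ) * diffOp ((k : ℝ) ^ 2 + ((a + b + 3 : ℕ) : ℝ) +
      2 * ((n₁ - 1 : ℕ) : ℝ) + 3 * n₂) φ x = n₁ * diffOp ((k : ℝ) ^ 2 + ((a + b : ℕ) + 3 : ℝ) +
      2 * n₁ + 3 * n₂ - 2) φ x := fun φ => by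
    rcases n₁ with _ | n
    · simp
    · rw [Nat.add_sub_cancel]
      congr 2
      push_cast
      ring
  have c2 : ∀ φ : ℝ → ℝ, (n₂ : ℝ) * diffOp ((k : ℝ) ^ 2 + ((a + b + 4 : ℕ) : ℝ) +
      2 * n₁ + 3 * ((n₂ - 1 : ℕ) : ℝ)) φ x = n₂ * diffOp ((k : ℝ) ^ 2 + ((a + b : ℕ) + 3 : ℝ) +
      1 + (2 * n₁ + 3 * (n₂ - 1))) φ x := fun φ => by
    rcases n₂ with _ | n
    · simp
    · rw [Nat.add_sub_cancel]
      congr 2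
      push_cast
      ring
  have c1a := c1 (hookAvg k (n₁ - 1) n₂ (a + b + 3) (b + 2))
  have c1b := c1 (hookAvg k (n₁ - 1) n₂ (a + b + 3) (b + 3))
  have c2a := c2 (hookAvg k n₁ (n₂ - 1) (a + b + 4) (b + 3))
  have c2b := c2 (hookAvg k n₁ (n₂ - 1) (a + b + 4) (b + 4))
  simp only [show b + 1 + 1 = b + 2 from rfl, show b + 1 + 2 = b + 3 from rfl,
    show b + 1 + 3 = b + 4 from rfl, show b + 4 + 1 = b + 5 from rfl] at h
  obtain ⟨s, hs, rfl⟩ : ∃ s : ℝ, 0 < s ∧ x = s ^ 2 :=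
    ⟨√x, Real.sqrt_pos.2 hx, (Real.sq_sqrt hx.le).symm⟩
  simp only [Real.sqrt_sq hs.le] at h ⊢
  have hs0 : s ≠ 0 := hs.ne'
  have hmul : ∀ {u v : ℝ}, s * u = s * v → u = v := fun h => mul_left_cancel₀ hs0 h
  apply hmul
  simp only [diffOp] at h c1a c1b c2a c2b ⊢
  push_cast at h c1a c1b c2a c2b ⊢
  linear_combination (norm := (field_simp; ring))
    h - 2 * s * c1a - 2 * s * c1b + 3 * s * c2a + 3 * s * c2b

lemma elem_one : elem k 1 = psum (Fin k) ℝ 1 := by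
  have h := sum_X_sq_mul_pderiv_elem (k := k) 0
  simp only [elem_zero, Derivation.map_one_eq_zero, mul_zero, Finset.sum_const_zero] at h
  push_cast at h
  linear_combination h

lemma psum_one_mul_hookPoly_one (M : ℕ) :
    psum (Fin k) ℝ 1 * hookPoly k (M + 1) 1 =
      hookPoly k (M + 2) 1 + hookPoly k (M + 2) 2 := by
  have h := elem_mul_comp_eq_hookPoly (k := k) M 1
  rw [elem_one] at h
  rw [hookPoly, hookSym_zero_right]
  exact h

lemma psum_two_mul_hookPoly_one (M : ℕ) :
    psum (Fin k) ℝ 2 * hookPoly k (M + 1) 1 =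
      psum (Fin k) ℝ 1 * hookPoly k (M + 2) 2 + hookPoly k (M + 3) 1 - hookPoly k (M + 3) 2 -
        2 * hookPoly k (M + 3) 3 := by
  have h := sum_X_cube_mul_pderiv_elem (k := k) 0
  simp only [elem_zero, Derivation.map_one_eq_zero, mul_zero, Finset.sum_const_zero] at h
  push_cast at h
  have h1 := psum_one_mul_hookPoly_one (k := k) M
  have h2 := psum_one_mul_hookPoly_one (k := k) (M + 1)
  have h3 := elem_mul_comp_eq_hookPoly (k := k) M 2
  have h4 : hookPoly k (M + 1) 1 = comp k (M + 1) := by rw [hookPoly, hookSym_zero_right]; rfl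
  simp only [zero_add] at h
  simp only [show M + 1 + 1 = M + 2 from rfl, show M + 1 + 2 = M + 3 from rfl] at h2
  simp only [show M + 2 + 1 = M + 3 from rfl, show 2 + 1 = 3 from rfl] at h3
  rw [elem_one] at h
  rw [← h4] at h3
  linear_combination -hookPoly k (M + 1) 1 * h + psum (Fin k) ℝ 1 * h1 + h2 - 2 * h3

lemma psum_three_mul_hookPoly_one (M : ℕ) :
    psum (Fin k) ℝ 3 * hookPoly k (M + 1) 1 =
      psum (Fin k) ℝ 2 * hookPoly k (M + 2) 2 - psum (Fin k) ℝ 1 * hookPoly k (M + 3) 3 +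
        hookPoly k (M + 4) 1 - hookPoly k (M + 4) 2 + hookPoly k (M + 4) 3 +
        3 * hookPoly k (M + 4) 4 := by
  have h := sum_X_pow_four_mul_pderiv_elem (k := k) 0
  simp only [elem_zero, Derivation.map_one_eq_zero, mul_zero, Finset.sum_const_zero] at h
  push_cast at h
  have h1 := psum_one_mul_hookPoly_one (k := k) M
  have h2 := psum_two_mul_hookPoly_one (k := k) (M + 1)
  have h3 := elem_mul_comp_eq_hookPoly (k := k) M 3
  have h5 := elem_mul_comp_eq_hookPoly (k := k) M 2
  have h4 : hookPoly k (M + 1) 1 = comp k (M + 1) := by rw [hookPoly, hookSym_zero_right]; rfl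
  simp only [zero_add] at h
  simp only [show M + 1 + 1 = M + 2 from rfl, show M + 1 + 2 = M + 3 from rfl,
    show M + 1 + 3 = M + 4 from rfl] at h2
  simp only [show M + 3 + 1 = M + 4 from rfl, show 3 + 1 = 4 from rfl] at h3
  simp only [show M + 2 + 1 = M + 3 from rfl, show 2 + 1 = 3 from rfl] at h5
  rw [elem_one] at h
  rw [← h4] at h3 h5
  linear_combination -hookPoly k (M + 1) 1 * h + psum (Fin k) ℝ 2 * h1 + h2 + 3 * h3 -
    psum (Fin k) ℝ 1 * h5

/-- The sum of the first two hook averages of size `m`, in terms of hooks of other sizes. Here the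
loop equation is replaced by the expansions of the products of `h_{m-1}` with power sums. -/
lemma hookAvg_pair_one (n₁ n₂ M : ℕ) {x : ℝ} (hx : 0 < x) :
    hookAvg k n₁ n₂ (M + 3) 1 x + hookAvg k n₁ n₂ (M + 3) 2 x =
      -√x * (-diffOp ((k : ℝ) ^ 2 + (M + 3) - 1 - 2 * n₁ - 3 * n₂)
            (hookAvg k n₁ n₂ (M + 2) 1) x)
      + 2 * n₁ / √x * (-hookAvg k (n₁ - 1) n₂ (M + 4) 1 x + hookAvg k (n₁ - 1) n₂ (M + 4) 2 x +
          2 * hookAvg k (n₁ - 1) n₂ (M + 4) 3 x)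
      - 3 * n₂ / √x * (hookAvg k n₁ (n₂ - 1) (M + 5) 1 x - hookAvg k n₁ (n₂ - 1) (M + 5) 2 x +
          hookAvg k n₁ (n₂ - 1) (M + 5) 3 x + 3 * hookAvg k n₁ (n₂ - 1) (M + 5) 4 x)
      + 2 * n₁ * (-diffOp ((k : ℝ) ^ 2 + (M + 3) + 2 * n₁ + 3 * n₂ - 2)
            (hookAvg k (n₁ - 1) n₂ (M + 3) 2) x)
      + 3 * n₂ / √x * (-hookAvg k (n₁ + 1) (n₂ - 1) (M + 3) 2 x)
      - 3 * n₂ * (-diffOp ((k : ℝ) ^ 2 + (M + 3) + 1) (hookAvg k n₁ (n₂ - 1) (M + 4) 3) x)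
      + 3 * n₁ * n₂ / x * (-hookAvg k n₁ (n₂ - 1) (M + 4) 3 x)
      + 9 * n₂ * ((n₂ : ℝ) - 1) / (2 * x) * (-hookAvg k n₁ (n₂ - 1) (M + 4) 3 x) := by
  have h1 := avg_psum_one_mul_hookPoly (k := k) n₁ n₂ hx (show 1 ≤ M + 2 by omega)
  have h2 := natCast_mul_avg_psum_two n₁ n₂ x (hookPoly k (M + 2) 1)
  have h3 := natCast_mul_avg_psum_three n₁ n₂ x (hookPoly k (M + 2) 1)
  rw [psum_one_mul_hookPoly_one, map_add] at h1
  rw [psum_two_mul_hookPoly_one, map_sub, map_sub, map_add, two_mul, map_add,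
    avg_psum_one_mul_hookPoly _ _ hx (by omega)] at h2
  rw [psum_three_mul_hookPoly_one, map_add, map_add, map_sub, map_add, map_sub, avg_psum_two,
    avg_psum_one_mul_hookPoly _ _ hx (by omega), show (3 : MvPolynomial (Fin k) ℝ) = 1 + 1 + 1 by
      norm_num, add_mul, add_mul, one_mul, map_add, map_add] at h3
  have e : ∀ n₁ n₂ m q, avg k n₁ n₂ x (hookPoly k m q) = hookAvg k n₁ n₂ m q x :=
    fun _ _ _ _ => rfl
  simp only [e, show M + 1 + 2 = M + 3 from rfl, show M + 1 + 3 = M + 4 from rfl,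
    show M + 1 + 4 = M + 5 from rfl] at h1 h2 h3
  have c1 : ∀ φ : ℝ → ℝ, (n₁ : ℝ) * diffOp ((k : ℝ) ^ 2 + ((M + 3 : ℕ) : ℝ) +
      2 * ((n₁ - 1 : ℕ) : ℝ) + 3 * n₂) φ x = n₁ * diffOp ((k : ℝ) ^ 2 + (M + 3 : ℝ) +
      2 * n₁ + 3 * n₂ - 2) φ x := fun φ => by
    rcases n₁ with _ | n
    · simp
    · rw [Nat.add_sub_cancel]
      congr 2
      push_cast
      ring
  have c2 : ∀ φ : ℝ → ℝ, (n₂ : ℝ) * diffOp ((k : ℝ) ^ 2 + ((M + 4 : ℕ) : ℝ) +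
      2 * n₁ + 3 * ((n₂ - 1 : ℕ) : ℝ)) φ x = n₂ * diffOp ((k : ℝ) ^ 2 + (M + 3 : ℝ) +
      1 + (2 * n₁ + 3 * (n₂ - 1))) φ x := fun φ => by
    rcases n₂ with _ | n
    · simp
    · rw [Nat.add_sub_cancel]
      congr 2
      push_cast
      ring
  have c1a := c1 (hookAvg k (n₁ - 1) n₂ (M + 3) 2)
  have c2a := c2 (hookAvg k n₁ (n₂ - 1) (M + 4) 3)
  obtain ⟨s, hs, rfl⟩ : ∃ s : ℝ, 0 < s ∧ x = s ^ 2 :=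
    ⟨√x, Real.sqrt_pos.2 hx, (Real.sq_sqrt hx.le).symm⟩
  simp only [Real.sqrt_sq hs.le] at h1 h2 h3 ⊢
  have hs0 : s ≠ 0 := hs.ne'
  refine mul_left_cancel₀ hs0 ?_
  simp only [diffOp] at h1 h2 h3 c1a c2a ⊢
  push_cast at h1 h2 h3 c1a c2a ⊢
  linear_combination (norm := (field_simp; ring))
    s * h1 + 2 * h2 + 3 * h3 - 2 * s * c1a + 3 * s * c2a

end

/-- The rows of the recursive formula, with the vectors as sequences numbered from `1`. -/
lemma recursionRHS_apply (k : ℕ) (f : ℕ → ℕ → ℕ → ℕ → ℝ → ℝ) (n₁ n₂ M : ℕ) (x : ℝ)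
    (a : Fin (M + 3)) :
    recursionRHS k f n₁ n₂ (M + 3) x a =
      -(√x * rowSum (entryB (M + 3)) (M + 3)
        (seg (fun q => diffOp ((k : ℝ) ^ 2 + (M + 3) - 1 - 2 * n₁ - 3 * n₂)
          (f n₁ n₂ (M + 2) q) x) 0 (M + 2)) (a + 1))
      - 1 / √x * rowSum (entryC1 k (M + 3)) (M + 2)
        (seg (fun q => f n₁ n₂ (M + 2) q x) 0 (M + 2)) (a + 1)
      + rowSum (entryC2 k) (M + 1) (seg (fun q => f n₁ n₂ (M + 1) q x) 0 (M + 1)) (a + 1)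
      + 2 * n₁ / √x * rowSum entryC3 (M + 4)
        (seg (fun q => f (n₁ - 1) n₂ (M + 4) q x) 0 (M + 4)) (a + 1)
      - 3 * n₂ / √x * rowSum entryC4 (M + 5)
        (seg (fun q => f n₁ (n₂ - 1) (M + 5) q x) 0 (M + 5)) (a + 1)
      + 2 * n₁ * rowSum (entryB (M + 3)) (M + 3)
        (seg (fun q => diffOp ((k : ℝ) ^ 2 + (M + 3) + 2 * n₁ + 3 * n₂ - 2)
          (f (n₁ - 1) n₂ (M + 3) q) x) 1 (M + 2)) (a + 1)
      + 3 * n₂ / √x * rowSum (entryB (M + 3)) (M + 3)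
        (seg (fun q => f (n₁ + 1) (n₂ - 1) (M + 3) q x) 1 (M + 2)) (a + 1)
      - 3 * n₂ * rowSum (entryB (M + 3)) (M + 3)
        (seg (fun q => diffOp ((k : ℝ) ^ 2 + (M + 3) + 1)
          (f n₁ (n₂ - 1) (M + 4) q) x) 2 (M + 2)) (a + 1)
      + 3 * n₁ * n₂ / x * rowSum (entryB (M + 3)) (M + 3)
        (seg (fun q => f n₁ (n₂ - 1) (M + 4) q x) 2 (M + 2)) (a + 1)
      + 9 * n₂ * ((n₂ : ℝ) - 1) / (2 * x) * rowSum (entryB (M + 3)) (M + 3)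
        (seg (fun q => f n₁ (n₂ - 1) (M + 4) q x) 2 (M + 2)) (a + 1) := by
  simp only [← mulVec_colVec]
  simp only [recursionRHS, Pi.add_apply, Pi.sub_apply, Pi.neg_apply, Pi.smul_apply, smul_eq_mul,
    Nat.cast_add, Nat.cast_ofNat]
  rfl

section

variable {k : ℕ}

lemma sum_neg_one_pow_mul_seg_hookAvg (n₁ n₂ : ℕ) {N : ℕ} (hN : N ≠ 0) (x : ℝ) :
    ∑ c ∈ Finset.Icc 1 N, (-1) ^ (c + 1) * seg (fun q => hookAvg k n₁ n₂ N q x) 0 N c =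
      avg k n₁ n₂ x (psum (Fin k) ℝ N) := by
  rw [avg_psum hN]
  refine Finset.sum_congr rfl fun c hc => ?_
  obtain ⟨h1, h2⟩ := Finset.mem_Icc.1 hc
  obtain ⟨c, rfl⟩ : ∃ d, c = d + 1 := ⟨c - 1, by omega⟩
  rw [seg_of_le _ _ h1 h2, Nat.add_sub_cancel, pow_succ, pow_succ]
  simp only [add_zero, hookAvg]
  ring

/-- The averages of hook Schur polynomials satisfy the recursive formula: both sides agree in
all sums of two consecutive entries, by the loop equations of the vector fields
`u_i² h_{a+1} (∂_i e_r) ∂_i`, and in the alternating sum of all entries, by that of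
`u_i ^ m ∂_i`. -/
lemma hookRecursion_hookAvg : HookRecursion k (hookAvg k) := by
  rw [hookRecursion_iff]
  intro n₁ n₂ m hm x hx
  obtain ⟨M, rfl⟩ : ∃ M, m = M + 3 := ⟨m - 3, by omega⟩
  funext a
  rw [recursionRHS_apply, colVec, if_pos (by omega), ← sub_eq_zero, add_comm 1 (a : ℕ)]
  set ψ1 := seg (fun q => diffOp ((k : ℝ) ^ 2 + (M + 3) - 1 - 2 * n₁ - 3 * n₂)
    (hookAvg k n₁ n₂ (M + 2) q) x) 0 (M + 2) with h1
  set ψ2 := seg (fun q => hookAvg k n₁ n₂ (M + 2) q x) 0 (M + 2) with h2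
  set ψ3 := seg (fun q => hookAvg k n₁ n₂ (M + 1) q x) 0 (M + 1) with h3
  set ψ4 := seg (fun q => hookAvg k (n₁ - 1) n₂ (M + 4) q x) 0 (M + 4) with h4
  set ψ5 := seg (fun q => hookAvg k n₁ (n₂ - 1) (M + 5) q x) 0 (M + 5) with h5
  set ψ6 := seg (fun q => diffOp ((k : ℝ) ^ 2 + (M + 3) + 2 * n₁ + 3 * n₂ - 2)
    (hookAvg k (n₁ - 1) n₂ (M + 3) q) x) 1 (M + 2) with h6
  set ψ7 := seg (fun q => hookAvg k (n₁ + 1) (n₂ - 1) (M + 3) q x) 1 (M + 2) with h7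
  set ψ8 := seg (fun q => diffOp ((k : ℝ) ^ 2 + (M + 3) + 1)
    (hookAvg k n₁ (n₂ - 1) (M + 4) q) x) 2 (M + 2) with h8
  set ψ9 := seg (fun q => hookAvg k n₁ (n₂ - 1) (M + 4) q x) 2 (M + 2) with h9
  refine eq_zero_of_pair_of_alternating (m := M + 3) (u := fun a =>
    hookAvg k n₁ n₂ (M + 3) (a + 1) x -
    (-(√x * rowSum (entryB (M + 3)) (M + 3) ψ1 (a + 1))
      - 1 / √x * rowSum (entryC1 k (M + 3)) (M + 2) ψ2 (a + 1)
      + rowSum (entryC2 k) (M + 1) ψ3 (a + 1)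
      + 2 * n₁ / √x * rowSum entryC3 (M + 4) ψ4 (a + 1)
      - 3 * n₂ / √x * rowSum entryC4 (M + 5) ψ5 (a + 1)
      + 2 * n₁ * rowSum (entryB (M + 3)) (M + 3) ψ6 (a + 1)
      + 3 * n₂ / √x * rowSum (entryB (M + 3)) (M + 3) ψ7 (a + 1)
      - 3 * n₂ * rowSum (entryB (M + 3)) (M + 3) ψ8 (a + 1)
      + 3 * n₁ * n₂ / x * rowSum (entryB (M + 3)) (M + 3) ψ9 (a + 1)
      + 9 * n₂ * ((n₂ : ℝ) - 1) / (2 * x) * rowSum (entryB (M + 3)) (M + 3) ψ9 (a + 1)))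
    (fun r hr => ?_) ?_ a.isLt
  · have b1 := rowSum_entryB_pair hr (ψ := ψ1) (seg_zero _ _ _)
    have b2 := rowSum_entryC1_pair k hr (ψ := ψ2) (seg_zero _ _ _)
    have b3 := rowSum_entryC2_pair k hr (ψ := ψ3) (seg_zero _ _ _)
    have b6 := rowSum_entryB_pair hr (ψ := ψ6) (seg_zero _ _ _)
    have b7 := rowSum_entryB_pair hr (ψ := ψ7) (seg_zero _ _ _)
    have b8 := rowSum_entryB_pair hr (ψ := ψ8) (seg_zero _ _ _)
    have b9 := rowSum_entryB_pair hr (ψ := ψ9) (seg_zero _ _ _)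
    have z3 : ψ3 0 = hookAvg k n₁ n₂ (M + 1) 0 x :=
      (seg_zero _ _ _).trans (by simp [hookAvg, hookPoly])
    have v1 : ∀ c, 1 ≤ c → c ≤ M + 2 → ψ1 c = diffOp ((k : ℝ) ^ 2 + (M + 3) - 1 - 2 * n₁ - 3 * n₂)
      (hookAvg k n₁ n₂ (M + 2) c) x := fun _ => seg_of_le _ _
    have v2 : ∀ c, 1 ≤ c → c ≤ M + 2 → ψ2 c = hookAvg k n₁ n₂ (M + 2) c x :=
      fun _ => seg_of_le _ _
    have v3 : ∀ c, 1 ≤ c → c ≤ M + 1 → ψ3 c = hookAvg k n₁ n₂ (M + 1) c x :=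
      fun _ => seg_of_le _ _
    have v4 : ∀ c, 1 ≤ c → c ≤ M + 4 → ψ4 c = hookAvg k (n₁ - 1) n₂ (M + 4) c x :=
      fun _ => seg_of_le _ _
    have v5 : ∀ c, 1 ≤ c → c ≤ M + 5 → ψ5 c = hookAvg k n₁ (n₂ - 1) (M + 5) c x :=
      fun _ => seg_of_le _ _
    have v6 : ∀ c, 1 ≤ c → c ≤ M + 2 → ψ6 c = diffOp ((k : ℝ) ^ 2 + (M + 3) + 2 * n₁ + 3 * n₂ - 2)
      (hookAvg k (n₁ - 1) n₂ (M + 3) (c + 1)) x := fun _ => seg_of_le _ _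
    have v7 : ∀ c, 1 ≤ c → c ≤ M + 2 → ψ7 c = hookAvg k (n₁ + 1) (n₂ - 1) (M + 3) (c + 1) x :=
      fun _ => seg_of_le _ _
    have v8 : ∀ c, 1 ≤ c → c ≤ M + 2 → ψ8 c = diffOp ((k : ℝ) ^ 2 + (M + 3) + 1)
      (hookAvg k n₁ (n₂ - 1) (M + 4) (c + 2)) x := fun _ => seg_of_le _ _
    have v9 : ∀ c, 1 ≤ c → c ≤ M + 2 → ψ9 c = hookAvg k n₁ (n₂ - 1) (M + 4) (c + 2) x :=
      fun _ => seg_of_le _ _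
    rw [show M + 3 - 1 = M + 2 from rfl] at b2
    rw [show M + 3 - 2 = M + 1 from rfl] at b3
    rcases r with _ | b
    · have b4 := rowSum_entryC3_pair_zero (by omega : 2 ≤ M + 3) ψ4
      have b5 := rowSum_entryC4_pair_zero (by omega : 2 ≤ M + 3) ψ5
      have hp := hookAvg_pair_one (k := k) n₁ n₂ M hx
      rw [show ψ1 0 = 0 from seg_zero _ _ _, v1 _ (by omega) (by omega)] at b1
      rw [show ψ2 0 = 0 from seg_zero _ _ _] at b2
      rw [show ψ3 0 = 0 from seg_zero _ _ _] at b3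
      rw [v4 _ (by omega) (by omega), v4 _ (by omega) (by omega), v4 _ (by omega) (by omega)] at b4
      rw [v5 _ (by omega) (by omega), v5 _ (by omega) (by omega), v5 _ (by omega) (by omega),
        v5 _ (by omega) (by omega)] at b5
      rw [show ψ6 0 = 0 from seg_zero _ _ _, v6 _ (by omega) (by omega)] at b6
      rw [show ψ7 0 = 0 from seg_zero _ _ _, v7 _ (by omega) (by omega)] at b7
      rw [show ψ8 0 = 0 from seg_zero _ _ _, v8 _ (by omega) (by omega)] at b8
      rw [show ψ9 0 = 0 from seg_zero _ _ _, v9 _ (by omega) (by omega)] at b9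
      simp only [zero_add, Nat.reduceAdd, CharP.cast_eq_zero] at b1 b2 b3 b6 b7 b8 b9 ⊢
      linear_combination hp + √x * b1 + 1 / √x * b2 - b3 - 2 * n₁ / √x * b4 + 3 * n₂ / √x * b5
        - 2 * n₁ * b6 - 3 * n₂ / √x * b7 + 3 * n₂ * b8 - 3 * n₁ * n₂ / x * b9
        - 9 * n₂ * ((n₂ : ℝ) - 1) / (2 * x) * b9
    · have b4 := rowSum_entryC3_pair (by omega : 1 ≤ b + 1) hr ψ4
      have b5 := rowSum_entryC4_pair (by omega : 1 ≤ b + 1) hr ψ5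
      have hp := hookAvg_pair (k := k) n₁ n₂ (show b ≤ M by omega) hx
      have z3' : ψ3 b = hookAvg k n₁ n₂ (M + 1) b x := by
        rcases Nat.eq_zero_or_pos b with rfl | hb
        · exact z3
        · exact v3 _ hb (by omega)
      rw [v1 _ (by omega) (by omega), v1 _ (by omega) (by omega)] at b1
      rw [v2 _ (by omega) (by omega), v2 _ (by omega) (by omega)] at b2
      rw [Nat.add_sub_cancel, v3 _ (by omega) (by omega), z3'] at b3
      rw [v4 _ (by omega) (by omega), v4 _ (by omega) (by omega)] at b4
      rw [v5 _ (by omega) (by omega), v5 _ (by omega) (by omega)] at b5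
      rw [v6 _ (by omega) (by omega), v6 _ (by omega) (by omega)] at b6
      rw [v7 _ (by omega) (by omega), v7 _ (by omega) (by omega)] at b7
      rw [v8 _ (by omega) (by omega), v8 _ (by omega) (by omega)] at b8
      rw [v9 _ (by omega) (by omega), v9 _ (by omega) (by omega)] at b9
      simp only [add_assoc, Nat.reduceAdd] at b1 b2 b3 b4 b5 b6 b7 b8 b9 hp ⊢
      push_cast at b1 b2 b3 b4 b5 b6 b7 b8 b9 hp ⊢
      linear_combination hp + √x * b1 + 1 / √x * b2 - b3 - 2 * n₁ / √x * b4 + 3 * n₂ / √x * b5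
        - 2 * n₁ * b6 - 3 * n₂ / √x * b7 + 3 * n₂ * b8 - 3 * n₁ * n₂ / x * b9
        - 9 * n₂ * ((n₂ : ℝ) - 1) / (2 * x) * b9
  · have a1 := alternating_rowSum_entryB (m := M + 3) (ψ := ψ1) (seg_of_lt _ _ (by omega))
    have a2 := alternating_rowSum_entryC1 k (m := M + 3) ψ2
    have a3 := alternating_rowSum_entryC2 k (m := M + 3) ψ3
    have a4 := alternating_rowSum_entryC3 (by omega : 1 ≤ M + 3) ψ4
    have a5 := alternating_rowSum_entryC4 (by omega : 1 ≤ M + 3) ψ5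
    have a6 := alternating_rowSum_entryB (m := M + 3) (ψ := ψ6) (seg_of_lt _ _ (by omega))
    have a7 := alternating_rowSum_entryB (m := M + 3) (ψ := ψ7) (seg_of_lt _ _ (by omega))
    have a8 := alternating_rowSum_entryB (m := M + 3) (ψ := ψ8) (seg_of_lt _ _ (by omega))
    have a9 := alternating_rowSum_entryB (m := M + 3) (ψ := ψ9) (seg_of_lt _ _ (by omega))
    have s3 := sum_neg_one_pow_mul_seg_hookAvg (k := k) n₁ n₂ (N := M + 1) (by omega) x
    have s4 := sum_neg_one_pow_mul_seg_hookAvg (k := k) (n₁ - 1) n₂ (N := M + 4) (by omega) x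
    have s5 := sum_neg_one_pow_mul_seg_hookAvg (k := k) n₁ (n₂ - 1) (N := M + 5) (by omega) x
    have hv : ∑ a ∈ Finset.range (M + 3), (-1) ^ a * hookAvg k n₁ n₂ (M + 3) (a + 1) x =
        avg k n₁ n₂ x (psum (Fin k) ℝ (M + 3)) := by
      have h := Finset.sum_Ico_add'
        (fun q => (-1) ^ (q - 1) * hookAvg k n₁ n₂ (M + 3) q x) 0 (M + 3) 1
      rw [← Finset.range_eq_Ico] at h
      rw [avg_psum (by omega)]
      exact h
    have hr := avg_psum_recurrence (k := k) n₁ n₂ (M + 1) hx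
    have h2' : ∑ q ∈ Finset.Icc 1 (M + 1 + 1), (-1) ^ (q - 1) * (2 * (k : ℝ) - 2 * q +
        ((M + 1 : ℕ) : ℝ) + 2) * avg k n₁ n₂ x (hookPoly k (M + 1 + 1) q) =
        ∑ c ∈ Finset.Icc 1 (M + 3 - 1), (-1) ^ (c + 1) * (2 * k - 2 * c + ((M + 3 : ℕ) : ℝ)) *
          ψ2 c := by
      refine Finset.sum_congr rfl fun c hc => ?_
      obtain ⟨h1, h2⟩ := Finset.mem_Icc.1 hc
      obtain ⟨c, rfl⟩ : ∃ d, c = d + 1 := ⟨c - 1, by omega⟩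
      rw [show ψ2 (c + 1) = hookAvg k n₁ n₂ (M + 2) (c + 1) x from seg_of_le _ _ h1 h2,
        Nat.add_sub_cancel, pow_succ, pow_succ, hookAvg]
      push_cast
      ring
    rw [h2'] at hr
    have h4' : ∑ c ∈ Finset.Icc 1 (M + 3 + 1), (-1) ^ c * ψ4 c =
        -avg k (n₁ - 1) n₂ x (psum (Fin k) ℝ (M + 4)) := by
      rw [← s4, ← Finset.sum_neg_distrib]
      exact Finset.sum_congr rfl fun c _ => by rw [pow_succ]; ring
    rw [h4'] at a4
    rw [← a2] at hr
    have e : ∀ c : ℝ, ∀ S : ℕ → ℝ, ∑ a ∈ Finset.range (M + 3), (-1) ^ a * (c * S (a + 1)) =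
        c * ∑ a ∈ Finset.range (M + 3), (-1) ^ a * S (a + 1) := fun c S => by
      rw [Finset.mul_sum]
      exact Finset.sum_congr rfl fun a _ => by ring
    simp only [mul_sub, mul_add, mul_neg, Finset.sum_sub_distrib, Finset.sum_add_distrib,
      Finset.sum_neg_distrib, e]
    rw [hv, a1, show (∑ a ∈ Finset.range (M + 3), (-1) ^ a * rowSum (entryC2 k) (M + 1) ψ3 (a + 1))
        = _ from a3.trans s3, show (∑ a ∈ Finset.range (M + 3), (-1) ^ a *
        rowSum entryC3 (M + 4) ψ4 (a + 1)) = _ from a4, show (∑ a ∈ Finset.range (M + 3), (-1) ^ a *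
        rowSum entryC4 (M + 5) ψ5 (a + 1)) = _ from a5.trans s5, a6, a7, a8, a9]
    have hs : √x ≠ 0 := (Real.sqrt_pos.2 hx).ne'
    rw [show M + 3 - 1 = M + 2 from rfl] at hr
    refine mul_left_cancel₀ hs ?_
    linear_combination (norm := (field_simp; ring)) -hr

end

/-! ### The initial conditions -/

section

variable {k : ℕ}

lemma hookRecursion_hookDeriv : HookRecursion k (hookDeriv k) := by
  have h : ∀ n₁ n₂ m, AgreeAt (hookDeriv k) (hookAvg k) n₁ n₂ m := fun n₁ n₂ m q hq hqm y hy =>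
    hookDeriv_eq_hookAvg k n₁ n₂ hq hqm hy
  rw [hookRecursion_iff]
  intro n₁ n₂ m hm x hx
  rw [colVec_congr (fun q hq hqm => h n₁ n₂ m q hq hqm x hx) m,
    recursionRHS_congr k (h _ _ _) (h _ _ _) (fun _ => h _ _ _) (fun _ => h _ _ _)
      (fun _ _ _ => h _ _ _) hx]
  exact hookRecursion_hookAvg n₁ n₂ m hm x hx

lemma sumDet_eq_avg (n₁ n₂ : ℕ) : sumDet k n₁ n₂ = fun y => avg k n₁ n₂ y 1 :=
  funext (sumDet_eq n₁ n₂)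

lemma contDiffOn_sumDet (n₁ n₂ : ℕ) : ContDiffOn ℝ ∞ (sumDet k n₁ n₂) (Set.Ioi 0) := by
  rw [sumDet_eq_avg]
  exact contDiffOn_avg n₁ n₂ 1

lemma contDiffOn_hookDeriv (n₁ n₂ : ℕ) {m q : ℕ} (hq : 1 ≤ q) (hqm : q ≤ m) :
    ContDiffOn ℝ ∞ (hookDeriv k n₁ n₂ m q) (Set.Ioi 0) :=
  (contDiffOn_avg n₁ n₂ (hookPoly k m q)).congr fun _ hx => hookDeriv_eq n₁ n₂ hq hqm (le_of_lt hx)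

lemma sumDet_zero_zero (x : ℝ) : sumDet k 0 0 x = tau k x := by
  simp [sumDet, tau, Nat.multinomial]

lemma hookAvg_one_one (n₁ n₂ : ℕ) {x : ℝ} (hx : 0 < x) :
    hookAvg k n₁ n₂ 1 1 x =
      √x * diffOp ((k : ℝ) ^ 2 + 2 * n₁ + 3 * n₂) (sumDet k n₁ n₂) x := by
  have h := avg_psum_one_mul (k := k) n₁ n₂ hx (s := 1) (d := 0) (by simp)
  have h1 := avg_psum (k := k) one_ne_zero n₁ n₂ x
  rw [Finset.Icc_self, Finset.sum_singleton, Nat.sub_self, pow_zero, one_mul] at h1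
  rw [mul_one, h1, Nat.cast_zero, add_zero, ← sumDet_eq_avg] at h
  exact h

lemma hookAvg_two_one_sub (n₁ n₂ : ℕ) (x : ℝ) :
    hookAvg k n₁ n₂ 2 1 x - hookAvg k n₁ n₂ 2 2 x = sumDet k (n₁ + 1) n₂ x := by
  have h := avg_psum (k := k) two_ne_zero n₁ n₂ x
  rw [show Finset.Icc 1 2 = {1, 2} from rfl, Finset.sum_pair (by norm_num)] at h
  rw [sumDet_eq, ← avg_psum_two, mul_one, h, hookAvg, hookAvg]
  norm_num
  ring

lemma hookAvg_two_one_add (n₁ n₂ : ℕ) {x : ℝ} (hx : 0 < x) :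
    hookAvg k n₁ n₂ 2 1 x + hookAvg k n₁ n₂ 2 2 x = diffOp2 k n₁ n₂ (sumDet k n₁ n₂) x := by
  have h := avg_psum_one_mul_hookPoly (k := k) n₁ n₂ hx (le_refl 1)
  rw [psum_one_mul_hookPoly_one, map_add] at h
  set F := sumDet k n₁ n₂ with hF
  have hs : √x ≠ 0 := (Real.sqrt_pos.2 hx).ne'
  have hC : ContDiffAt ℝ ∞ F x := (contDiffOn_sumDet n₁ n₂).contDiffAt (Ioi_mem_nhds hx)
  have h1 : HasDerivAt F (deriv F x) x := (hC.differentiableAt (by simp)).hasDerivAt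
  have h2 : HasDerivAt (deriv F) (iteratedDeriv 2 F x) x := by
    rw [iteratedDeriv_succ, iteratedDeriv_one]
    have hC' : ContDiffAt ℝ ∞ (deriv F) x := by
      have := (contDiffOn_sumDet (k := k) n₁ n₂).deriv_of_isOpen isOpen_Ioi (m := ∞) (by simp)
      exact this.contDiffAt (Ioi_mem_nhds hx)
    exact (hC'.differentiableAt (by simp)).hasDerivAt
  set c : ℝ := (k : ℝ) ^ 2 + 2 * n₁ + 3 * n₂ with hc
  have h3 : HasDerivAt (hookAvg k n₁ n₂ 1 1) (1 / (2 * √x) * (deriv F x - c / (2 * x) * F x) +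
      √x * (iteratedDeriv 2 F x - ((-(c * 2)) / (2 * x) ^ 2 * F x + c / (2 * x) * deriv F x)))
      x := by
    have he : (fun y => √y * diffOp c F y) =ᶠ[nhds x] hookAvg k n₁ n₂ 1 1 := by
      filter_upwards [lt_mem_nhds hx] with y hy
      exact (hookAvg_one_one n₁ n₂ hy).symm
    refine HasDerivAt.congr_of_eventuallyEq ?_ he.symm
    have hq : HasDerivAt (fun y : ℝ => c / (2 * y)) ((-(c * 2)) / (2 * x) ^ 2) x := by
      have := (hasDerivAt_const x c).div ((hasDerivAt_id x).const_mul 2) (by simpa using hx.ne')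
      exact this.congr_deriv (by simp)
    exact (Real.hasDerivAt_sqrt hx.ne').mul (h2.sub (hq.mul h1))
  have h4 := hookAvg_one_one (k := k) n₁ n₂ hx
  rw [← hF, ← hc] at h4
  rw [diffOp, h3.deriv, h4, diffOp] at h
  refine Eq.trans (show _ = _ from h) ?_
  have hx2 : x = √x * √x := (Real.mul_self_sqrt hx.le).symm
  rw [diffOp2]
  generalize iteratedDeriv 2 F x = F2
  generalize deriv F x = F1
  generalize F x = F0
  generalize √x = s at hs hx2
  subst hx2
  rw [hc]
  push_cast
  field_simp
  ring

lemma hookAvg_recurrence_zero {x : ℝ} (hx : 0 < x) :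
    √x * (k * sumDet k 0 0 x - sumDet k 1 0 x) = 2 * k * hookAvg k 0 0 1 1 x := by
  have h := avg_psum_recurrence (k := k) 0 0 0 hx
  have h2 := avg_psum_two (k := k) 0 0 x 1
  have h0 : avg k 0 0 x (psum (Fin k) ℝ 0) = k * sumDet k 0 0 x := by
    rw [psum_zero, Fintype.card_fin, sumDet_eq]
    simpa using map_natCast_mul (avg k 0 0 x) k 1
  rw [mul_one] at h2
  rw [zero_add, h0, h2, zero_add, zero_add, Finset.Icc_self, Finset.sum_singleton,
    ← sumDet_eq] at h
  simp only [zero_add] at h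
  simp at h
  rw [h]
  rfl

lemma initialConditions_hookDeriv : InitialConditions k (hookDeriv k) (sumDet k) := by
  intro x hx
  have hs : √x ≠ 0 := (Real.sqrt_pos.2 hx).ne'
  have hx2 : x = √x * √x := (Real.mul_self_sqrt hx.le).symm
  refine ⟨sumDet_zero_zero x, ?_, fun n₁ n₂ => ?_⟩
  · have h := hookAvg_recurrence_zero (k := k) hx
    rw [hookAvg_one_one 0 0 hx, diffOp, show sumDet k 0 0 = tau k from funext sumDet_zero_zero] at h
    refine mul_left_cancel₀ hs ?_
    generalize √x = s at hs hx2 h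
    subst hx2
    linear_combination (norm := (push_cast; field_simp; ring)) -h
  · rw [hookDeriv_eq_hookAvg k n₁ n₂ le_rfl le_rfl hx,
      hookDeriv_eq_hookAvg k n₁ n₂ le_rfl (by norm_num) hx,
      hookDeriv_eq_hookAvg k n₁ n₂ (by norm_num) le_rfl hx]
    have h1 := hookAvg_two_one_sub (k := k) n₁ n₂ x
    have h2 := hookAvg_two_one_add (k := k) n₁ n₂ hx
    refine ⟨?_, by linear_combination (h1 + h2) / 2, by linear_combination (h2 - h1) / 2⟩
    rw [hookAvg_one_one n₁ n₂ hx, diffOp]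
    generalize √x = s at hs hx2
    subst hx2
    field_simp
    ring

end

/-! ### The formulae for `F` -/

/-- The contribution of `T (n₁ - i) (n₂ - j)` to the solution of the recurrence
`P n₁ n₂ m = T n₁ n₂ m - n₁ a P (n₁ - 1) n₂ (m + 1) - n₂ b P n₁ (n₂ - 1) (m + 2)`: there are
`(i + j)! / (i! j!)` orders in which `i` steps of the first kind and `j` steps of the second kind
can be taken. -/
noncomputable def stepTerm (a b : ℝ) (T : ℕ → ℕ → ℕ → ℝ) (n₁ n₂ m i j : ℕ) : ℝ :=
  (-1) ^ (i + j) * ((i + j).factorial : ℝ) * a ^ i * (n₁.choose i : ℝ) * (b ^ j *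
    (n₂.choose j : ℝ)) * T (n₁ - i) (n₂ - j) (m + i + 2 * j)

lemma succ_mul_choose_eq_cast (n i : ℕ) :
    ((i : ℝ) + 1) * ((n + 1).choose (i + 1) : ℝ) = (n + 1) * (n.choose i : ℝ) := by
  have h := Nat.add_one_mul_choose_eq n i
  have h' : (((n + 1) * n.choose i : ℕ) : ℝ) = (((n + 1).choose (i + 1) * (i + 1) : ℕ) : ℝ) := by
    rw [h]
  push_cast at h'
  linear_combination -h'

lemma sum_stepTerm_unroll (a b : ℝ) (T : ℕ → ℕ → ℕ → ℝ) (n₁ n₂ m : ℕ) :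
    ∑ j ∈ Finset.range (n₂ + 1), ∑ i ∈ Finset.range (n₁ + 1), stepTerm a b T n₁ n₂ m i j =
      T n₁ n₂ m
      - n₁ * a * ∑ j ∈ Finset.range (n₂ + 1), ∑ i ∈ Finset.range (n₁ - 1 + 1),
          stepTerm a b T (n₁ - 1) n₂ (m + 1) i j
      - n₂ * b * ∑ j ∈ Finset.range (n₂ - 1 + 1), ∑ i ∈ Finset.range (n₁ + 1),
          stepTerm a b T n₁ (n₂ - 1) (m + 2) i j := by
  -- the weight `(i + j)!` is `i (i + j - 1)! + j (i + j - 1)!`, except at `i = j = 0`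
  set E : ℕ → ℕ → ℝ := fun i j => (-1) ^ (i + j) * ((i + j - 1).factorial : ℝ) * a ^ i *
    (n₁.choose i : ℝ) * (b ^ j * (n₂.choose j : ℝ)) * T (n₁ - i) (n₂ - j) (m + i + 2 * j) with hE
  have h1 : ∀ i j, stepTerm a b T n₁ n₂ m i j =
      (if j = 0 then (if i = 0 then T n₁ n₂ m else 0) else 0) + i * E i j + j * E i j := by
    intro i j
    rcases Nat.eq_zero_or_pos (i + j) with h | h
    · obtain ⟨rfl, rfl⟩ : i = 0 ∧ j = 0 := by omega
      simp [stepTerm]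
    · obtain ⟨d, hd⟩ : ∃ d, i + j = d + 1 := ⟨i + j - 1, by omega⟩
      have hd' : (i : ℝ) + j = d + 1 := by exact_mod_cast hd
      have h0 : (if j = 0 then (if i = 0 then T n₁ n₂ m else 0) else 0) = 0 := by
        split_ifs
        · omega
        · rfl
        · rfl
      rw [h0, stepTerm, hE]
      simp only [hd, Nat.factorial_succ, Nat.add_sub_cancel]
      push_cast
      rw [← hd']
      ring
  have h2 : ∑ j ∈ Finset.range (n₂ + 1), ∑ i ∈ Finset.range (n₁ + 1), (i : ℝ) * E i j =
      -(n₁ * a * ∑ j ∈ Finset.range (n₂ + 1), ∑ i ∈ Finset.range (n₁ - 1 + 1),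
          stepTerm a b T (n₁ - 1) n₂ (m + 1) i j) := by
    rcases n₁ with _ | n
    · simp
    · rw [Nat.add_sub_cancel, Finset.mul_sum, ← Finset.sum_neg_distrib]
      refine Finset.sum_congr rfl fun j _ => ?_
      rw [Finset.sum_range_succ', Finset.mul_sum, ← Finset.sum_neg_distrib, Nat.cast_zero,
        zero_mul, add_zero]
      refine Finset.sum_congr rfl fun i _ => ?_
      have hc := succ_mul_choose_eq_cast n i
      rw [hE, stepTerm]
      simp only [show i + 1 + j - 1 = i + j by omega, Nat.add_sub_add_right,
        show m + (i + 1) + 2 * j = m + 1 + i + 2 * j by ring]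
      push_cast
      rw [pow_succ a, show i + 1 + j = i + j + 1 by ring, pow_succ (-1 : ℝ)]
      linear_combination (-1) ^ (i + j) * (-1) * ((i + j).factorial : ℝ) * (a ^ i * a) *
        (b ^ j * (n₂.choose j : ℝ)) * T (n - i) (n₂ - j) (m + 1 + i + 2 * j) * hc
  have h3 : ∑ j ∈ Finset.range (n₂ + 1), ∑ i ∈ Finset.range (n₁ + 1), (j : ℝ) * E i j =
      -(n₂ * b * ∑ j ∈ Finset.range (n₂ - 1 + 1), ∑ i ∈ Finset.range (n₁ + 1),
          stepTerm a b T n₁ (n₂ - 1) (m + 2) i j) := by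
    rcases n₂ with _ | n
    · simp
    · rw [Nat.add_sub_cancel, Finset.sum_range_succ', Finset.mul_sum, ← Finset.sum_neg_distrib]
      simp only [Nat.cast_zero, zero_mul, Finset.sum_const_zero, add_zero]
      refine Finset.sum_congr rfl fun j _ => ?_
      rw [Finset.mul_sum, ← Finset.sum_neg_distrib]
      refine Finset.sum_congr rfl fun i _ => ?_
      have hc := succ_mul_choose_eq_cast n j
      rw [hE, stepTerm]
      simp only [show i + (j + 1) - 1 = i + j by omega, Nat.add_sub_add_right,
        show m + i + 2 * (j + 1) = m + 2 + i + 2 * j by ring]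
      push_cast
      rw [pow_succ b, ← add_assoc i j 1, pow_succ (-1 : ℝ)]
      linear_combination (-1) ^ (i + j) * (-1) * ((i + j).factorial : ℝ) * a ^ i *
        (n₁.choose i : ℝ) * (b ^ j * b) * T (n₁ - i) (n - j) (m + 2 + i + 2 * j) * hc
  simp only [h1, Finset.sum_add_distrib]
  rw [h2, h3]
  simp
  ring

lemma eq_sum_stepTerm {a b : ℝ} {P T : ℕ → ℕ → ℕ → ℝ}
    (h : ∀ n₁ n₂ m, P n₁ n₂ m =
      T n₁ n₂ m - n₁ * a * P (n₁ - 1) n₂ (m + 1) - n₂ * b * P n₁ (n₂ - 1) (m + 2))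
    (n₁ n₂ m : ℕ) : P n₁ n₂ m =
      ∑ j ∈ Finset.range (n₂ + 1), ∑ i ∈ Finset.range (n₁ + 1), stepTerm a b T n₁ n₂ m i j := by
  induction hN : n₁ + n₂ using Nat.strong_induction_on generalizing n₁ n₂ m with
  | _ N ih =>
    rw [h, sum_stepTerm_unroll]
    congr 1
    · congr 1
      rcases n₁ with _ | n
      · simp
      · rw [ih (n + n₂) (by omega) _ _ _ (by omega)]
    · rcases n₂ with _ | n
      · simp
      · rw [ih (n₁ + n) (by omega) _ _ _ (by omega)]

section

variable {k : ℕ}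

lemma sumRecursion_hookDeriv : SumRecursion k (hookDeriv k) (sumDet k) := by
  -- the inhomogeneous term of the recurrence for the averages of power sums
  set T : ℝ → ℕ → ℕ → ℕ → ℝ := fun x n₁ n₂ m => avg k n₁ n₂ x (psum (Fin k) ℝ m) -
    1 / √x * ∑ q ∈ Finset.Icc 1 (m + 1), (-1) ^ (q - 1) * (2 * (k : ℝ) - 2 * q + m + 2) *
        hookDeriv k n₁ n₂ (m + 1) q x with hT
  have hrec : ∀ x : ℝ, 0 < x → ∀ n₁ n₂ m : ℕ, avg k n₁ n₂ x (psum (Fin k) ℝ (m + 2)) =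
      ∑ j ∈ Finset.range (n₂ + 1), ∑ i ∈ Finset.range (n₁ + 1),
        stepTerm (2 / √x) (3 / √x) (T x) n₁ n₂ m i j := by
    intro x hx n₁ n₂ m
    refine eq_sum_stepTerm (P := fun n₁ n₂ m => avg k n₁ n₂ x (psum (Fin k) ℝ (m + 2)))
      (fun n₁ n₂ m => ?_) n₁ n₂ m
    have h := avg_psum_recurrence (k := k) n₁ n₂ m hx
    have hs : √x ≠ 0 := (Real.sqrt_pos.2 hx).ne'
    have e : ∑ q ∈ Finset.Icc 1 (m + 1), (-1) ^ (q - 1) * (2 * (k : ℝ) - 2 * q + m + 2) *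
        avg k n₁ n₂ x (hookPoly k (m + 1) q) = ∑ q ∈ Finset.Icc 1 (m + 1), (-1) ^ (q - 1) *
        (2 * (k : ℝ) - 2 * q + m + 2) * hookDeriv k n₁ n₂ (m + 1) q x :=
      Finset.sum_congr rfl fun q hq => by
        rw [hookDeriv_eq n₁ n₂ (Finset.mem_Icc.1 hq).1 (Finset.mem_Icc.1 hq).2 hx.le]
    rw [e] at h
    refine mul_left_cancel₀ hs ?_
    simp only [hT, show m + 1 + 2 = m + 3 from rfl, show m + 2 + 2 = m + 4 from rfl]
    linear_combination (norm := (field_simp; ring)) -h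
  have hpsum : ∀ x : ℝ, 0 < x → ∀ n₁ n₂ m : ℕ, m ≠ 0 → avg k n₁ n₂ x (psum (Fin k) ℝ m) =
      ∑ q ∈ Finset.Icc 1 m, (-1) ^ (q - 1) * hookDeriv k n₁ n₂ m q x := by
    intro x hx n₁ n₂ m hm
    rw [avg_psum hm]
    exact Finset.sum_congr rfl fun q hq => by
      rw [hookDeriv_eq n₁ n₂ (Finset.mem_Icc.1 hq).1 (Finset.mem_Icc.1 hq).2 hx.le]
  have hpsum_zero : ∀ (x : ℝ) (n₁ n₂ : ℕ), avg k n₁ n₂ x (psum (Fin k) ℝ 0) =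
      k * sumDet k n₁ n₂ x := by
    intro x n₁ n₂
    rw [psum_zero, Fintype.card_fin, sumDet_eq]
    simpa using map_natCast_mul (avg k n₁ n₂ x) k 1
  constructor
  · intro n₁ n₂ hn x hx
    obtain ⟨n, rfl⟩ : ∃ n, n₁ = n + 1 := ⟨n₁ - 1, by omega⟩
    have h := hrec x hx n n₂ 0
    have h2 := avg_psum_two (k := k) n n₂ x 1
    rw [mul_one, ← sumDet_eq] at h2
    rw [zero_add, h2] at h
    rw [Nat.add_sub_cancel, h, ← hpsum_zero]
    have ht : ∀ i j, stepTerm (2 / √x) (3 / √x) (T x) n n₂ 0 i j =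
        (if j = 0 then (if i = 0 then avg k n n₂ x (psum (Fin k) ℝ 0) else 0) else 0) +
        (3 / √x) ^ j * (n₂.choose j : ℝ) *
          ((-1) ^ (i + j) * ((i + j).factorial : ℝ) * (2 / √x) ^ i * (n.choose i : ℝ) *
              (∑ s ∈ Finset.Icc 1 (i + 2 * j),
                  (-1) ^ (s - 1) * hookDeriv k (n - i) (n₂ - j) (i + 2 * j) s x
                - 1 / √x * ∑ s ∈ Finset.Icc 1 (i + 2 * j + 1),
                    (-1) ^ (s - 1) * (2 * (k : ℝ) - 2 * s + i + 2 * j + 2) *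
                      hookDeriv k (n - i) (n₂ - j) (i + 2 * j + 1) s x)) := by
      intro i j
      have hW : ∑ q ∈ Finset.Icc 1 (i + 2 * j + 1), (-1) ^ (q - 1) *
          (2 * (k : ℝ) - 2 * q + ((i + 2 * j : ℕ) : ℝ) + 2) *
            hookDeriv k (n - i) (n₂ - j) (i + 2 * j + 1) q x =
          ∑ s ∈ Finset.Icc 1 (i + 2 * j + 1),
            (-1) ^ (s - 1) * (2 * (k : ℝ) - 2 * s + i + 2 * j + 2) *
              hookDeriv k (n - i) (n₂ - j) (i + 2 * j + 1) s x :=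
        Finset.sum_congr rfl fun q _ => by push_cast; ring
      rw [stepTerm, hT]
      simp only [zero_add]
      rw [hW]
      rcases Nat.eq_zero_or_pos (i + 2 * j) with h0 | h0
      · obtain ⟨rfl, rfl⟩ : i = 0 ∧ j = 0 := by omega
        simp
        ring
      · rw [hpsum x hx _ _ _ h0.ne']
        have h1 : (if j = 0 then (if i = 0 then avg k n n₂ x (psum (Fin k) ℝ 0) else 0)
            else 0) = 0 := by
          split_ifs
          · omega
          · rfl
          · rfl
        rw [h1]
        ring
    simp only [ht, Finset.sum_add_distrib, ← Finset.mul_sum]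
    simp
  · intro n₂ hn x hx
    obtain ⟨n, rfl⟩ : ∃ n, n₂ = n + 1 := ⟨n₂ - 1, by omega⟩
    have h := hrec x hx 0 n 1
    have h2 := avg_psum_three (k := k) 0 n x 1
    rw [mul_one, ← sumDet_eq] at h2
    rw [show 1 + 2 = 3 from rfl, h2] at h
    rw [Nat.add_sub_cancel, h, Finset.sum_range_succ', add_comm]
    simp only [zero_add, Finset.sum_range_one]
    congr 1
    · rw [stepTerm, hT]
      simp only [show 1 + 0 + 2 * 0 = 1 from rfl, Nat.sub_zero]
      rw [hpsum x hx _ _ _ one_ne_zero, show Finset.Icc 1 (1 + 1) = {1, 2} from rfl,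
        Finset.Icc_self, Finset.sum_singleton, Finset.sum_pair (by norm_num)]
      norm_num
      ring_nf
      simp
    · have hI := Finset.sum_Ico_add' (fun i : ℕ =>
          (-1) ^ i * (i.factorial : ℝ) * (3 / √x) ^ i * (n.choose i : ℝ) *
            (∑ s ∈ Finset.Icc 1 (2 * i + 1),
                (-1) ^ (s - 1) * hookDeriv k 0 (n - i) (2 * i + 1) s x
              - 1 / √x * ∑ s ∈ Finset.Icc 1 (2 * i + 2),
                  (-1) ^ (s - 1) * (2 * (k : ℝ) - 2 * s + 2 * i + 3) *
                    hookDeriv k 0 (n - i) (2 * i + 2) s x)) 0 n 1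
      rw [← Finset.range_eq_Ico] at hI
      refine Eq.trans (Finset.sum_congr rfl fun j _ => ?_) hI
      rw [stepTerm, hT]
      generalize j + 1 = l
      have hl : 1 + 0 + 2 * l = 2 * l + 1 := by ring
      simp only [hl, hpsum x hx _ _ _ (Nat.succ_ne_zero (2 * l))]
      have hW : ∑ q ∈ Finset.Icc 1 (2 * l + 1 + 1), (-1) ^ (q - 1) *
          (2 * (k : ℝ) - 2 * q + ((2 * l + 1 : ℕ) : ℝ) + 2) *
            hookDeriv k (0 - 0) (n - l) (2 * l + 1 + 1) q x =
          ∑ s ∈ Finset.Icc 1 (2 * l + 2), (-1) ^ (s - 1) * (2 * (k : ℝ) - 2 * s + 2 * l + 3) *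
            hookDeriv k 0 (n - l) (2 * l + 2) s x :=
        Finset.sum_congr rfl fun q _ => by push_cast; ring
      rw [hW, zero_add, pow_zero, Nat.choose_self, Nat.cast_one]
      ring

end

/-! ### Uniqueness -/

section

variable {k : ℕ} {f g : ℕ → ℕ → ℕ → ℕ → ℝ → ℝ} {F G : ℕ → ℕ → ℝ → ℝ}

lemma diffOp2_congr {φ χ : ℝ → ℝ} (h : ∀ y, 0 < y → φ y = χ y) (n₁ n₂ : ℕ) {x : ℝ} (hx : 0 < x) :
    diffOp2 k n₁ n₂ φ x = diffOp2 k n₁ n₂ χ x := by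
  have he : φ =ᶠ[nhds x] χ := by
    filter_upwards [lt_mem_nhds hx] with y hy
    exact h y hy
  rw [diffOp2, diffOp2, he.deriv_eq, he.iteratedDeriv_eq, h x hx]

lemma agreeAt_one (hf : InitialConditions k f F) (hg : InitialConditions k g G) {n₁ n₂ : ℕ}
    (h : ∀ x, 0 < x → F n₁ n₂ x = G n₁ n₂ x) : AgreeAt f g n₁ n₂ 1 := by
  intro q hq hq1 x hx
  obtain rfl : q = 1 := by omega
  have he : F n₁ n₂ =ᶠ[nhds x] G n₁ n₂ := by
    filter_upwards [lt_mem_nhds hx] with y hy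
    exact h y hy
  rw [((hf x hx).2.2 n₁ n₂).1, ((hg x hx).2.2 n₁ n₂).1, he.deriv_eq, h x hx]

lemma agreeAt_two (hf : InitialConditions k f F) (hg : InitialConditions k g G) {n₁ n₂ : ℕ}
    (h : ∀ x, 0 < x → F n₁ n₂ x = G n₁ n₂ x)
    (h' : ∀ x, 0 < x → F (n₁ + 1) n₂ x = G (n₁ + 1) n₂ x) : AgreeAt f g n₁ n₂ 2 := by
  intro q hq hq1 x hx
  obtain rfl | rfl : q = 1 ∨ q = 2 := by omega
  · rw [((hf x hx).2.2 n₁ n₂).2.1, ((hg x hx).2.2 n₁ n₂).2.1, diffOp2_congr h n₁ n₂ hx, h' x hx]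
  · rw [((hf x hx).2.2 n₁ n₂).2.2, ((hg x hx).2.2 n₁ n₂).2.2, diffOp2_congr h n₁ n₂ hx, h' x hx]

lemma agreeAt_of_three_le (hf : HookRecursion k f) (hg : HookRecursion k g) {n₁ n₂ m : ℕ}
    (hm : 3 ≤ m) (h1 : AgreeAt f g n₁ n₂ (m - 1)) (h2 : AgreeAt f g n₁ n₂ (m - 2))
    (h3 : n₁ ≠ 0 → ∀ m, AgreeAt f g (n₁ - 1) n₂ m)
    (h4 : n₂ ≠ 0 → ∀ n m, AgreeAt f g n (n₂ - 1) m) : AgreeAt f g n₁ n₂ m := by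
  intro q hq hqm x hx
  have e := (((hookRecursion_iff k f).1 hf n₁ n₂ m hm x hx).trans
    (recursionRHS_congr k h1 h2 (fun h => h3 h _) (fun h => h3 h _) h4 hx)).trans
    ((hookRecursion_iff k g).1 hg n₁ n₂ m hm x hx).symm
  have e' := congrFun e ⟨q - 1, by omega⟩
  simp only [colVec, show 1 + (q - 1) = q by omega, if_pos hqm] at e'
  exact e'

/-- `F (n₁ + 1) n₂` is determined by `F n₁ n₂`, by the functions `f` of size `1` with the same
upper indices and by the functions `f` with smaller upper indices. -/
lemma sum_succ_congr (hf : SumRecursion k f F) (hg : SumRecursion k g G) {n₁ n₂ : ℕ}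
    (h0 : ∀ x, 0 < x → F n₁ n₂ x = G n₁ n₂ x) (h1 : AgreeAt f g n₁ n₂ 1)
    (h : ∀ i j, i ≤ n₁ → j ≤ n₂ → 0 < i + j → ∀ m, AgreeAt f g (n₁ - i) (n₂ - j) m)
    {x : ℝ} (hx : 0 < x) : F (n₁ + 1) n₂ x = G (n₁ + 1) n₂ x := by
  rw [hf.1 _ _ (by omega) x hx, hg.1 _ _ (by omega) x hx, Nat.add_sub_cancel, h0 x hx]
  congr 1
  refine Finset.sum_congr rfl fun j hj => ?_
  have hj' := Finset.mem_range.1 hj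
  congr 1
  refine Finset.sum_congr rfl fun i hi => ?_
  have hi' := Finset.mem_range.1 hi
  have hA : ∀ m, m = i + 2 * j ∨ m = i + 2 * j + 1 → AgreeAt f g (n₁ - i) (n₂ - j) m := by
    intro m hm
    rcases Nat.eq_zero_or_pos (i + j) with h0 | h0
    · obtain ⟨rfl, rfl⟩ : i = 0 ∧ j = 0 := by omega
      obtain rfl | rfl : m = 0 ∨ m = 1 := by omega
      · intro q hq hq0
        omega
      · exact h1
    · exact h i j (by omega) (by omega) h0 m
  congr 2
  · refine Finset.sum_congr rfl fun q hq => ?_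
    obtain ⟨hq1, hq2⟩ := Finset.mem_Icc.1 hq
    rw [hA _ (Or.inl rfl) q hq1 hq2 x hx]
  · congr 1
    refine Finset.sum_congr rfl fun q hq => ?_
    obtain ⟨hq1, hq2⟩ := Finset.mem_Icc.1 hq
    rw [hA _ (Or.inr rfl) q hq1 hq2 x hx]

/-- `F 0 (n₂ + 1)` is determined by the functions `f` with smaller second upper index. -/
lemma sum_zero_succ_congr (hf : SumRecursion k f F) (hg : SumRecursion k g G) {n₂ : ℕ}
    (h : ∀ n, n ≤ n₂ → ∀ m, AgreeAt f g 0 n m) {x : ℝ} (hx : 0 < x) :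
    F 0 (n₂ + 1) x = G 0 (n₂ + 1) x := by
  rw [hf.2 _ (by omega) x hx, hg.2 _ (by omega) x hx, Nat.add_sub_cancel,
    h n₂ le_rfl 1 1 le_rfl le_rfl x hx, h n₂ le_rfl 2 1 (by norm_num) (by norm_num) x hx,
    h n₂ le_rfl 2 2 (by norm_num) le_rfl x hx]
  congr 1
  refine Finset.sum_congr rfl fun i _ => ?_
  congr 2
  · refine Finset.sum_congr rfl fun q hq => ?_
    obtain ⟨hq1, hq2⟩ := Finset.mem_Icc.1 hq
    rw [h _ (by omega) _ q hq1 hq2 x hx]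
  · congr 1
    refine Finset.sum_congr rfl fun q hq => ?_
    obtain ⟨hq1, hq2⟩ := Finset.mem_Icc.1 hq
    rw [h _ (by omega) _ q hq1 hq2 x hx]

/-- The recursive formulae and the initial conditions have at most one solution. The induction is
on the second upper index, then on the first, then on the size. -/
lemma agree_of_recursions (hf : HookRecursion k f) (hfi : InitialConditions k f F)
    (hfs : SumRecursion k f F) (hg : HookRecursion k g) (hgi : InitialConditions k g G)
    (hgs : SumRecursion k g G) (n₁ n₂ : ℕ) :
    (∀ x, 0 < x → F n₁ n₂ x = G n₁ n₂ x) ∧ ∀ m, AgreeAt f g n₁ n₂ m := by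
  induction n₂ using Nat.strong_induction_on generalizing n₁ with
  | _ n₂ ih₂ =>
    induction n₁ using Nat.strong_induction_on with
    | _ n₁ ih₁ =>
      have hF : ∀ x, 0 < x → F n₁ n₂ x = G n₁ n₂ x := by
        intro x hx
        rcases n₁ with _ | n
        · rcases n₂ with _ | n'
          · rw [(hfi x hx).1, (hgi x hx).1]
          · exact sum_zero_succ_congr hfs hgs (fun l hl => (ih₂ l (by omega) 0).2) hx
        · refine sum_succ_congr hfs hgs (ih₁ n (by omega)).1 ((ih₁ n (by omega)).2 1)
            (fun i j hi hj _ m => ?_) hx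
          rcases Nat.eq_zero_or_pos j with rfl | hj0
          · exact (ih₁ (n - i) (by omega)).2 m
          · exact (ih₂ (n₂ - j) (by omega) _).2 m
      have h1 : AgreeAt f g n₁ n₂ 1 := agreeAt_one hfi hgi hF
      have h2 : AgreeAt f g n₁ n₂ 2 := by
        refine agreeAt_two hfi hgi hF fun x hx => sum_succ_congr hfs hgs hF h1
          (fun i j hi hj hij m => ?_) hx
        rcases Nat.eq_zero_or_pos j with rfl | hj0
        · exact (ih₁ (n₁ - i) (by omega)).2 m
        · exact (ih₂ (n₂ - j) (by omega) _).2 m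
      refine ⟨hF, fun m => ?_⟩
      induction m using Nat.strong_induction_on with
      | _ m ihm =>
        rcases Nat.lt_or_ge m 3 with hm | hm
        · obtain rfl | rfl | rfl : m = 0 ∨ m = 1 ∨ m = 2 := by omega
          · intro q hq hq0
            omega
          · exact h1
          · exact h2
        · exact agreeAt_of_three_le hf hg hm (ihm _ (by omega)) (ihm _ (by omega))
            (fun h m => (ih₁ _ (by omega)).2 m) (fun h n m => (ih₂ _ (by omega) n).2 m)

end

end HankelHook

theorem proposition8p1 (k : ℕ) (hk : 1 ≤ k) :
    -- the series and the derivatives that occur below exist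
    (∀ (n : ℕ) (z : ℝ), Summable fun j : ℕ =>
      z ^ (2 * j) / (2 ^ (2 * j) * ((n + j).factorial : ℝ) * (j.factorial : ℝ))) ∧
    (∀ (β : ℕ) (x t₁ t₂ : ℝ), 0 < x → Summable fun p : ℕ × ℕ =>
      t₁ ^ p.1 * t₂ ^ p.2 / ((p.1.factorial : ℝ) * (p.2.factorial : ℝ)) *
        HankelHook.besselI (2 * p.1 + 3 * p.2 + β) (2 * √x)) ∧
    (∀ (Y : YoungDiagram) (x : ℝ), 0 < x →
      ContDiff ℝ ∞ fun t : ℝ × ℝ => HankelHook.shiftedDet k Y x t.1 t.2) ∧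
    (∀ n₁ n₂ : ℕ, ContDiffOn ℝ ∞ (HankelHook.sumDet k n₁ n₂) (Set.Ioi 0)) ∧
    (∀ n₁ n₂ m q : ℕ, 1 ≤ q → q ≤ m →
      ContDiffOn ℝ ∞ (HankelHook.hookDeriv k n₁ n₂ m q) (Set.Ioi 0)) ∧
    -- `F(n₁, n₂)` is a derivative of the unshifted determinant
    (∀ (n₁ n₂ : ℕ) (x : ℝ), 0 < x → HankelHook.sumDet k n₁ n₂ x =
      iteratedDeriv n₁ (fun t₁ =>
        iteratedDeriv n₂ (fun t₂ => HankelHook.shiftedDet k ⊥ x t₁ t₂) 0) 0) ∧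
    -- the recursive formulae and the initial conditions
    HankelHook.HookRecursion k (HankelHook.hookDeriv k) ∧
    HankelHook.InitialConditions k (HankelHook.hookDeriv k) (HankelHook.sumDet k) ∧
    HankelHook.SumRecursion k (HankelHook.hookDeriv k) (HankelHook.sumDet k) ∧
    -- these relations determine all the quantities
    (∀ (f : ℕ → ℕ → ℕ → ℕ → ℝ → ℝ) (F : ℕ → ℕ → ℝ → ℝ),
      HankelHook.HookRecursion k f → HankelHook.InitialConditions k f F →
      HankelHook.SumRecursion k f F →
      (∀ (n₁ n₂ : ℕ) (x : ℝ), 0 < x → F n₁ n₂ x = HankelHook.sumDet k n₁ n₂ x) ∧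
      (∀ (n₁ n₂ m q : ℕ) (x : ℝ), 1 ≤ q → q ≤ m → 0 < x →
        f n₁ n₂ m q x = HankelHook.hookDeriv k n₁ n₂ m q x)) := by
  refine ⟨HankelHook.summable_besselI, fun β x t₁ t₂ hx => ?_, fun Y x hx =>
    HankelHook.contDiff_shiftedDet Y hx.le, HankelHook.contDiffOn_sumDet,
    fun n₁ n₂ m q hq hqm => HankelHook.contDiffOn_hookDeriv n₁ n₂ hq hqm, fun n₁ n₂ x hx => ?_,
    HankelHook.hookRecursion_hookDeriv, HankelHook.initialConditions_hookDeriv,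
    HankelHook.sumRecursion_hookDeriv, fun f F hf hfi hfs => ?_⟩
  · exact HankelHook.summable_expGen ((HankelHook.geomBounded_besselI hx.le).shift β) (t₁, t₂)
  · rw [HankelHook.sumDet_eq, HankelHook.iteratedDeriv_shiftedDet_bot n₁ n₂ hx.le]
  · have h := HankelHook.agree_of_recursions hf hfi hfs HankelHook.hookRecursion_hookDeriv
      HankelHook.initialConditions_hookDeriv HankelHook.sumRecursion_hookDeriv
    exact ⟨fun n₁ n₂ => (h n₁ n₂).1, fun n₁ n₂ m q x hq hqm hx => (h n₁ n₂).2 m q hq hqm x hx⟩
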